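/- **Setting.** Let $N,M,d\ge1$, $a_1,\dots,a_N\in\mathbb R$ with $a_N=1$, and $b_\alpha\in\mathbb R$ for $\alpha\in\mathbb N^d$, $|\alpha|\le M$, with $b_\alpha\ne0$ for some $|\alpha|=M$. Let $p_1,\dots,p_N>0$ with $\sum_np_n=1$, $f_1,\dots,f_N:\mathbb R^d\to\mathbb R$ bounded continuous, $q_j\ge0$ $(j\ge 0)$ with $\sum_jq_j=1$, and $c_j:\mathbb R_+\times\mathbb R^d\to\mathbb R$ bounded continuous. Consider the semilinear Cauchy problem $$\sum_{n=1}^Na_n\partial_t^nu-\sum_{|\alpha|\le M}b_\alpha D^\alpha u-\sum_{j\ge0}q_jc_ju^j=0,\qquad \partial_t^{n-1}u(0,\cdot)=p_nf_n,\quad n=1,\dots,N.\tag{1}$$ **Green functions.** Let $b(\xi)=\sum_{|\alpha|\le M} i^{|\alpha|}b_\alpha\xi^\alpha$, let $B(\xi)$ be the $N\times N$ matrix with ones on the superdiagonal, last row $(b(\xi),-a_1,\dots,-a_{N-1})$ and zeros elsewhere, and $\hat g(t,\xi)=(2\pi)^{-d/2}e^{tB(\xi)^{\rm T}}{\rm e}_1\in\mathbb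 C^N$. Let $T_0\in(0,\infty]$ and assume that, for all $t\in[0,T_0)$: * $\hat g_n(t,\cdot)$ is a tempered distribution for every $n$; let $g_n(t,\cdot)=\mathfrak F^{-1}\hat g_n(t,\cdot)$, where $\mathfrak F^{-1}\varphi(x)=(2\pi)^{-d/2}\int e^{i\xi\cdot x}\varphi(\xi)\,d\xi$ for Schwartz functions $\varphi$; * $g_n(t,\cdot)$ is a signed measure $g_n(t,dx)=\gamma_n(t,x)\,\mu_n(t,dx)$, where $\mu_n(t,\cdot)$ is a probability measure depending measurably on $t$, $\gamma_n$ is jointly measurable and $\sup_x|\gamma_n(t,x)|<\infty$; * $(t,x)\mapsto(g_n(t,\cdot)*\phi)(x)$ is continuous on $[0,T_0)\times\mathbb R^d$ for every bounded continuous $\phi$ on $\mathbb R^d$; * $s\mapsto|g_N|(s,\mathbb R^d)=\int|\gamma_N(s,x)|\mu_N(s,dx)$ is integrable on $[0,t]$. **Non-explosion.** Let $0<T<\infty$ with $T\le T_0$, and let $\mathbb I=[0,T]$ if $T<T_0$, $\mathbb I=[0,T)$ if $T=T_0$. Put $\|\gamma_n\|_\infty=\sup_{t\in\mathbb I,\,x}|\gamma_n(t,x)|\in[0,\infty]$,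 $r_1=\sup_n\|f_n\|_\infty\|\gamma_n\|_\infty$ (with $0\cdot\infty=0$), $H_1(s)=\sum_{j\ge0}q_j\|c_j\|_\infty s^j$, and let $R_1$ be the radius of convergence of $H_1$. Assume $r_1<R_1$ and that there is a finite $s_1\in(r_1,R_1)$ with $\int_{r_1}^{s_1}H_1(s)^{-1}ds\ge T\|\gamma_N\|_\infty$ (integral in $[0,\infty]$, $1/0=\infty$); that is, $w'=\|\gamma_N\|_\infty H_1(w)$, $w(0)=r_1$, does not explode on $[0,T]$. **Branching process.** Let $\rho$ be a probability density on $[0,\infty)$, continuous, and positive on $(0,\infty)$; $\bar\rho(t)=\int_t^\infty\rho(s)\,ds$. Particles are the finite sequences $k=(0,k_1,\dots,k_\nu)$, and $k_-$ is the parent of $k$. On a probability space let $(\tau_k),(I^0_k),(J_k)$ be independent families of i.i.d. variables, with $\tau_k$ of density $\rho$, $\mathbb P[I^0_k=n]=p_n$, $\mathbb P[J_k=j]=q_j$. For $t\ge0$ let $T^t_{0-}=0$, $T^t_k=t\wedge(T^t_{k_-}+\tau_k)$, $\Delta T^t_k=T^t_k-T^t_{k_-}$. Particle $0$ starts at time $0$;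 a particle $k$ with $T^t_k<t$ has the children $(k,1),\dots,(k,J_k)$. Let $\overline{\mathcal K}_t$ be the set of all particles so obtained, $\mathcal K_t=\{k\in\overline{\mathcal K}_t:T^t_k=t\}$, and $I^t_k=I^0_k$ if $k\in\mathcal K_t$, $I^t_k=N$ if $k\in\overline{\mathcal K}_t\setminus\mathcal K_t$. For each $t\in\mathbb I$ let the displacements $Z^k_{T^t_k}$ of the particles $k\in\overline{\mathcal K}_t$ be, conditionally on all $\tau,I^0,J$, independent with laws $\mu_{I^t_k}(\Delta T^t_k,\cdot)$. Let $X^k_{T^t_k}=X^{k_-}_{T^t_{k_-}}-Z^k_{T^t_k}$, starting from $X^{0-}_{0}=x$, and $$\xi_{t,x}=\prod_{k\in\mathcal K_t}\frac{\gamma_{I^t_k}(\Delta T^t_k,Z^k_{T^t_k})}{\bar\rho(\Delta T^t_k)}f_{I^t_k}(X^k_t)\prod_{k\in\overline{\mathcal K}_t\setminus\mathcal K_t}\frac{\gamma_N(\Delta T^t_k,Z^k_{T^t_k})}{\rho(\Delta T^t_k)}c_{J_k}(t-T^t_k,X^k_{T^t_k}),$$ with the convention $\xi_{t,x}=0$ if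 $\overline{\mathcal K}_t$ is infinite. **Solutions.** A bounded continuous solution of (1) on $\mathbb I\times\mathbb R^d$ is a bounded continuous $u:\mathbb I\times\mathbb R^d\to\mathbb R$ such that $F=\sum_jq_jc_ju^j$ converges pointwise on $\mathbb I\times\mathbb R^d$ to a bounded continuous function and such that, for every Schwartz function $\varphi$ on $\mathbb R^d$, $t\mapsto\langle u(t,\cdot),\varphi\rangle=\int u(t,x)\varphi(x)\,dx$ is $C^N$ on $\mathbb I$ (one-sided derivatives at the end points), with $$\sum_{n=1}^Na_n\partial_t^n\langle u(t,\cdot),\varphi\rangle-\sum_{|\alpha|\le M}(-1)^{|\alpha|}b_\alpha\langle u(t,\cdot),D^\alpha\varphi\rangle-\langle F(t,\cdot),\varphi\rangle=0\quad(t\in\mathbb I)$$ and $\partial_t^{n-1}\langle u(t,\cdot),\varphi\rangle|_{t=0}=p_n\langle f_n,\varphi\rangle$ for $n=1,\dots,N$. **Theorem 3.1.** Under these assumptions $\xi_{t,x}$ is integrable for all $(t,x)\in\mathbb I\times\mathbb R^d$, and $u(t,x)=\mathbb E[\xi_{t,x}]$ is the unique bounded continuous solution of (1) on $\mathbb I\times\mathbb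 R^d$. -/

import Mathlib

open MeasureTheory ProbabilityTheory Set
open scoped NNReal ENNReal SchwartzMap BoundedContinuousFunction LineDeriv FourierTransform

noncomputable section

namespace BranchingCauchy

/-- The space variable lives in `ℝ^d` with its Euclidean norm. -/
abbrev Space (d : ℕ) := EuclideanSpace ℝ (Fin d)

/-- Multi-indices `α ∈ ℕ^d` with `|α| ≤ M`. -/
def multiIdx (d M : ℕ) : Finset (Fin d → ℕ) :=
  (Fintype.piFinset fun _ => Finset.range (M + 1)).filter fun α => ∑ i, α i ≤ M

theorem mem_multiIdx {d M : ℕ} {α : Fin d → ℕ} : α ∈ multiIdx d M ↔ ∑ i, α i ≤ M := by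
  simp only [multiIdx, Finset.mem_filter, Fintype.mem_piFinset, Finset.mem_range,
    and_iff_right_iff_imp]
  intro h i
  have := Finset.single_le_sum (f := α) (fun _ _ => Nat.zero_le _) (Finset.mem_univ i)
  omega

/-- The data of the semilinear Cauchy problem of order `N = m + 1` in time
`∑_{n=1}^N a_n ∂_t^n u - ∑_{|α| ≤ M} b_α D^α u - ∑_j q_j c_j u^j = 0`,
`∂_t^{n-1} u(0,·) = p_n f_n` for `n = 1, …, N`.
The index `n : Fin (m + 1)` stands for the number `n + 1` in `{1, …, N}`; in particular
`Fin.last m` stands for `N`. -/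
structure Problem (m d : ℕ) where
  /-- the time coefficients `a_1, …, a_N` -/
  a : Fin (m + 1) → ℝ
  a_last : a (Fin.last m) = 1
  /-- the order in space -/
  M : ℕ
  one_le_M : 1 ≤ M
  /-- the space coefficients; only multi-indices with `|α| ≤ M` are used -/
  b : (Fin d → ℕ) → ℝ
  b_top : ∃ α : Fin d → ℕ, ∑ i, α i = M ∧ b α ≠ 0
  p : Fin (m + 1) → ℝ
  p_pos : ∀ n, 0 < p n
  p_sum : ∑ n, p n = 1
  f : Fin (m + 1) → (Space d →ᵇ ℝ)
  q : ℕ → ℝ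
  q_nonneg : ∀ j, 0 ≤ q j
  q_sum : HasSum q 1
  c : ℕ → ((ℝ≥0 × Space d) →ᵇ ℝ)

variable {m d : ℕ}

namespace Problem

/-- The symbol `b(ξ) = ∑_{|α| ≤ M} i^{|α|} b_α ξ^α`. -/
def symbol (P : Problem m d) (ξ : Space d) : ℂ :=
  ∑ α ∈ multiIdx d P.M, Complex.I ^ (∑ i, α i) * (P.b α : ℂ) * ∏ i, ((ξ i : ℝ) : ℂ) ^ α i

/-- The companion matrix `B(ξ)`: ones above the diagonal, last row
`(b(ξ), -a_1, …, -a_{N-1})`. -/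
def companion (P : Problem m d) (ξ : Space d) : Matrix (Fin (m + 1)) (Fin (m + 1)) ℂ :=
  Matrix.of fun i j =>
    if i = Fin.last m then
      Fin.cases (P.symbol ξ) (fun k : Fin m => -((P.a k.castSucc : ℝ) : ℂ)) j
    else if (j : ℕ) = (i : ℕ) + 1 then 1 else 0

/-- `ĝ(t,ξ) = (2π)^{-d/2} exp(t B(ξ)ᵀ) e_1`. -/
def ghat (P : Problem m d) (n : Fin (m + 1)) (t : ℝ) (ξ : Space d) : ℂ :=
  (((2 * Real.pi) ^ (-(d : ℝ) / 2) : ℝ) : ℂ) *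
    (NormedSpace.exp ((t : ℂ) • (P.companion ξ).transpose)).mulVec (Pi.single 0 1) n

end Problem

/-- Multiplication by `(2π)⁻¹` as a linear equivalence of `ℝ^d`. -/
def dilation (d : ℕ) : Space d ≃L[ℝ] Space d :=
  ContinuousLinearEquiv.smulLeft (Units.mk0 ((2 * Real.pi)⁻¹ : ℝ) (by positivity))

/-- The inverse Fourier transform `φ ↦ (2π)^{-d/2} ∫ e^{i ξ·x} φ(ξ) dξ` on the Schwartz space,
obtained from Mathlib's (which has the kernel `e^{2π i ξ·x}`); see `invFourier_apply`. -/
def invFourier (φ : 𝓢(Space d, ℂ)) : 𝓢(Space d, ℂ) :=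
  (((2 * Real.pi) ^ (-(d : ℝ) / 2) : ℝ) : ℂ) •
    SchwartzMap.compCLMOfContinuousLinearEquiv ℂ (dilation d) (𝓕⁻ φ)

theorem invFourier_apply (φ : 𝓢(Space d, ℂ)) (x : Space d) :
    invFourier φ x = (((2 * Real.pi) ^ (-(d : ℝ) / 2) : ℝ) : ℂ) *
      ∫ ξ : Space d, Complex.exp (Complex.I * ((inner ℝ ξ x : ℝ) : ℂ)) * φ ξ := by
  have hd : dilation d x = (2 * Real.pi)⁻¹ • x := rfl
  simp only [invFourier, _root_.smul_apply, smul_eq_mul,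
    SchwartzMap.compCLMOfContinuousLinearEquiv_apply, Function.comp_apply,
    SchwartzMap.fourierInv_coe, hd, Real.fourierInv_eq', inner_smul_right]
  congr 1
  refine integral_congr_ae (Filter.Eventually.of_forall fun ξ => ?_)
  simp only
  congr 2
  push_cast
  have : (Real.pi : ℂ) ≠ 0 := by exact_mod_cast Real.pi_ne_zero
  field_simp

/-- The tempered distribution `G` is (represented by) the function `h`: they agree as
distributions, i.e. on all smooth functions of compact support. -/
def IsRepresentedBy (G : 𝓢'(Space d, ℂ)) (h : Space d → ℂ) : Prop :=
  ∀ φ : 𝓢(Space d, ℂ), HasCompactSupport φ → G φ = ∫ ξ, h ξ * φ ξ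

/-- `ĝ(t,·)` is a tempered distribution for all `t ∈ [0,T₀)`, where `T₀ ∈ (0,∞]`. -/
def TemperedGreen (P : Problem m d) (T₀ : EReal) : Prop :=
  ∀ n, ∀ t : ℝ, 0 ≤ t → (t : EReal) < T₀ →
    ∃ G : 𝓢'(Space d, ℂ), IsRepresentedBy G (P.ghat n t)

/-- The Green functions `g_n(t,·) = 𝔉⁻¹ ĝ_n(t,·)`, `t ∈ [0,T₀)`, are the signed measures
`g_n(t,dx) = γ_n(t,x) μ_n(t,dx)` with `μ_n(t,·)` a probability measure (a Markov kernel in `t`)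
and `γ_n(t,·)` a bounded density. So `g_n^± = γ_n^± μ_n` with `γ_n^±` the positive and negative
parts of `γ_n`, and `|g_n| = |γ_n| μ_n`. -/
structure GreenDensities (P : Problem m d) (T₀ : EReal)
    (μ : Fin (m + 1) → Kernel ℝ (Space d)) (γ : Fin (m + 1) → ℝ → Space d → ℝ) : Prop where
  markov : ∀ n, IsMarkovKernel (μ n)
  measurable : ∀ n, Measurable (Function.uncurry (γ n))
  /-- `⟨g_n(t,·), φ⟩ = ⟨ĝ_n(t,·), 𝔉⁻¹ φ⟩` -/
  green : ∀ n, ∀ t : ℝ, 0 ≤ t → (t : EReal) < T₀ →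
    ∀ G : 𝓢'(Space d, ℂ), IsRepresentedBy G (P.ghat n t) →
      ∀ φ : 𝓢(Space d, ℂ), G (invFourier φ) = ∫ x, φ x * (γ n t x : ℂ) ∂(μ n t)
  /-- `(t,x) ↦ (g_n(t,·) * φ)(x)` is continuous for `φ` bounded and continuous -/
  continuous_conv : ∀ n, ∀ φ : Space d →ᵇ ℝ,
    ContinuousOn (fun z : ℝ × Space d => ∫ y, φ (z.2 - y) * γ n z.1 y ∂(μ n z.1))
      ({t : ℝ | 0 ≤ t ∧ (t : EReal) < T₀} ×ˢ univ)
  bounded : ∀ n, ∀ t : ℝ, 0 ≤ t → (t : EReal) < T₀ → ∃ C : ℝ, ∀ x, |γ n t x| ≤ C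
  /-- the total mass `|g_N|(s,ℝ^d)` is integrable on `[0,t]` for `t < T₀` -/
  integrable_mass : ∀ t : ℝ, 0 ≤ t → (t : EReal) < T₀ →
    IntegrableOn (fun s => ∫ x, |γ (Fin.last m) s x| ∂(μ (Fin.last m) s)) (Icc 0 t)

/-- The times on which the problem is solved: `[0,T]` if `T < T₀`, and `[0,T)` if `T = T₀`. -/
def timeSet (T : ℝ) (T₀ : EReal) : Set ℝ := {t | 0 ≤ t ∧ t ≤ T ∧ (t : EReal) < T₀}

/-- `sup {|γ(t,x)| : t ∈ 𝕀, x ∈ ℝ^d}`, in `[0,∞]`. -/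
def supNorm (𝕀 : Set ℝ) (γ : ℝ → Space d → ℝ) : ℝ≥0∞ := ⨆ t ∈ 𝕀, ⨆ x, ‖γ t x‖ₑ

/-- `r₁ = sup_n ‖f_n‖_∞ ‖γ_n‖_∞`. -/
def r₁ (P : Problem m d) (𝕀 : Set ℝ) (γ : Fin (m + 1) → ℝ → Space d → ℝ) : ℝ≥0∞ :=
  ⨆ n, ‖P.f n‖ₑ * supNorm 𝕀 (γ n)

/-- The radius of convergence `R₁` of the power series `∑_j q_j ‖c_j‖_∞ s^j`. -/
def R₁ (P : Problem m d) : ℝ≥0∞ :=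
  (FormalMultilinearSeries.ofScalars ℝ fun j => P.q j * ‖P.c j‖).radius

/-- `H₁(s) = ∑_j q_j ‖c_j‖_∞ s^j`. -/
def H₁ (P : Problem m d) (s : ℝ) : ℝ := ∑' j, P.q j * ‖P.c j‖ * s ^ j

/-- The condition that the equation `w' = ‖γ_N‖_∞ H₁(w)`, `w(0) = r₁`, does not explode on
`[0,T]`: `r₁ < R₁`, and `∫_{r₁}^{s₁} ds / H₁(s)` attains the value `T ‖γ_N‖_∞` for some finite
`s₁ > r₁` in the domain of `H₁`. The integral is taken in `[0,∞]` with `1/0 = ∞`. -/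
def NonExplosion (P : Problem m d) (T : ℝ) (𝕀 : Set ℝ)
    (γ : Fin (m + 1) → ℝ → Space d → ℝ) : Prop :=
  r₁ P 𝕀 γ < R₁ P ∧
  ∃ s₁ : ℝ, (r₁ P 𝕀 γ).toReal < s₁ ∧ ENNReal.ofReal s₁ < R₁ P ∧
    ENNReal.ofReal T * supNorm 𝕀 (γ (Fin.last m)) ≤
      ∫⁻ s in Icc (r₁ P 𝕀 γ).toReal s₁, (ENNReal.ofReal (H₁ P s))⁻¹

/-! ### Solutions -/

/-- `D^α φ` for a Schwartz function `φ`. -/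
def multiDeriv (α : Fin d → ℕ) (φ : 𝓢(Space d, ℝ)) : 𝓢(Space d, ℝ) :=
  (List.finRange d).foldr
    (fun i ψ => (fun χ : 𝓢(Space d, ℝ) => ∂_{EuclideanSpace.single i (1 : ℝ)} χ)^[α i] ψ) φ

/-- `⟨v, φ⟩ = ∫ v(x) φ(x) dx`. -/
def pairing (v : Space d → ℝ) (φ : 𝓢(Space d, ℝ)) : ℝ := ∫ x, v x * φ x

/-- `v` is bounded and continuous on `𝕀 × ℝ^d`. -/
def IsBoundedContinuousOn (𝕀 : Set ℝ) (v : ℝ → Space d → ℝ) : Prop :=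
  ContinuousOn (Function.uncurry v) (𝕀 ×ˢ univ) ∧ ∃ C : ℝ, ∀ t ∈ 𝕀, ∀ x, |v t x| ≤ C

/-- `u` is a bounded continuous solution on `𝕀 × ℝ^d` of the linear Cauchy problem
`∑_n a_n ∂_t^n u - ∑_α b_α D^α u - F = 0`, `∂_t^{n-1} u(0,·) = p_n f_n`, where the equation and
the initial conditions hold in the sense of tempered distributions in the space variable: for all
Schwartz functions `φ`, the function `t ↦ ⟨u(t,·), φ⟩` is of class `C^N` on `𝕀` (one-sided
derivatives at the end points) and satisfies the equation and the initial conditions tested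
against `φ`. -/
structure IsLinearSolution (P : Problem m d) (𝕀 : Set ℝ) (F u : ℝ → Space d → ℝ) : Prop where
  boundedContinuous : IsBoundedContinuousOn 𝕀 u
  smooth : ∀ φ : 𝓢(Space d, ℝ), ContDiffOn ℝ (m + 1 : ℕ) (fun t => pairing (u t) φ) 𝕀
  equation : ∀ φ : 𝓢(Space d, ℝ), ∀ t ∈ 𝕀,
    ∑ n : Fin (m + 1), P.a n * iteratedDerivWithin (n + 1) (fun s => pairing (u s) φ) 𝕀 t
      - ∑ α ∈ multiIdx d P.M, P.b α * ((-1) ^ (∑ i, α i) * pairing (u t) (multiDeriv α φ))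
      - pairing (F t) φ = 0
  initial : ∀ φ : 𝓢(Space d, ℝ), ∀ n : Fin (m + 1),
    iteratedDerivWithin n (fun s => pairing (u s) φ) 𝕀 0 = P.p n * pairing (P.f n) φ

/-- `u` is a bounded continuous solution on `𝕀 × ℝ^d` of the semilinear Cauchy problem: the
nonlinearity `F = ∑_j q_j c_j u^j` is a convergent series and a bounded continuous function, and
`u` solves the linear problem with source term `F`. -/
structure IsSolution (P : Problem m d) (𝕀 : Set ℝ) (u : ℝ → Space d → ℝ) : Prop where
  summable : ∀ t ∈ 𝕀, ∀ x, Summable fun j => P.q j * P.c j (t.toNNReal, x) * u t x ^ j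
  source : IsBoundedContinuousOn 𝕀
    fun t x => ∑' j, P.q j * P.c j (t.toNNReal, x) * u t x ^ j
  linear : IsLinearSolution P 𝕀
    (fun t x => ∑' j, P.q j * P.c j (t.toNNReal, x) * u t x ^ j) u

/-! ### The branching process -/

/-- Particles: `[]` is the ancestor `0`, and `j :: k` is the `j`-th child `(k,j)` of `k`. -/
abbrev Particle := List ℕ

variable {Ω : Type*}

/-- The branching time `T^t_k = t ∧ (T^t_{k-} + τ_k)`, with `T^t_{0-} = 0`. -/
def branchTime (τ : Particle → Ω → ℝ) (t : ℝ) : Particle → Ω → ℝ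
  | [], ω => min t (0 + τ [] ω)
  | j :: k, ω => min t (branchTime τ t k ω + τ (j :: k) ω)

/-- The life time `ΔT^t_k = T^t_k - T^t_{k-}`. -/
def lifeTime (τ : Particle → Ω → ℝ) (t : ℝ) : Particle → Ω → ℝ
  | [], ω => branchTime τ t [] ω - 0
  | j :: k, ω => branchTime τ t (j :: k) ω - branchTime τ t k ω

/-- The particle `k` has been living prior to time `t`: all its ancestors branched before `t` and
had enough children. -/
def IsBorn (τ : Particle → Ω → ℝ) (J : Particle → Ω → ℕ) (t : ℝ) : Particle → Ω → Prop
  | [], _ => True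
  | j :: k, ω => IsBorn τ J t k ω ∧ branchTime τ t k ω < t ∧ 1 ≤ j ∧ j ≤ J k ω

/-- The set of all particles living prior to time `t`. -/
def population (τ : Particle → Ω → ℝ) (J : Particle → Ω → ℕ) (t : ℝ) (ω : Ω) : Set Particle :=
  {k | IsBorn τ J t k ω}

/-- The set of particles living at time `t`, that is, those with `T^t_k = t`. -/
def alive (τ : Particle → Ω → ℝ) (J : Particle → Ω → ℕ) (t : ℝ) (ω : Ω) : Set Particle :=
  {k ∈ population τ J t ω | branchTime τ t k ω = t}

open Classical in
/-- The type `I^t_k`: `I^0_k` for a particle living at time `t`, and `N` for the others. -/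
def particleType (τ : Particle → Ω → ℝ) (I : Particle → Ω → Fin (m + 1)) (J : Particle → Ω → ℕ)
    (t : ℝ) (k : Particle) (ω : Ω) : Fin (m + 1) :=
  if k ∈ alive τ J t ω then I k ω else Fin.last m

/-- `ρ` is a probability density on `[0,∞)`, continuous, and positive on `(0,∞)`. -/
structure IsLifeDensity (ρ : ℝ → ℝ) : Prop where
  continuousOn : ContinuousOn ρ (Ici 0)
  pos : ∀ t, 0 < t → 0 < ρ t
  mass : ∫⁻ t in Ici (0 : ℝ), ENNReal.ofReal (ρ t) = 1

/-- `ρ̄(t) = ∫_t^∞ ρ(s) ds`. -/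
def tail (ρ : ℝ → ℝ) (t : ℝ) : ℝ := ∫ s in Ioi t, ρ s

/-- The random variables of the branching mechanism on a probability space: the families
`(τ_k)`, `(I^0_k)`, `(J_k)` are i.i.d. and independent of each other, with
`ℙ[τ_k ∈ dt] = ρ(t) 1_{t ≥ 0} dt`, `ℙ[I^0_k = n] = p_n`, `ℙ[J_k = j] = q_j`; and for each
`t ∈ 𝕀`, conditionally on these families, the displacements `Z t k` of the particles `k` living
prior to `t` are independent with laws `μ_{I^t_k}(ΔT^t_k, ·)`. -/
structure BranchingMechanism (P : Problem m d) (𝕀 : Set ℝ) (μ : Fin (m + 1) → Kernel ℝ (Space d))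
    (ρ : ℝ → ℝ) [MeasurableSpace Ω] (Pr : Measure Ω) (τ : Particle → Ω → ℝ)
    (I : Particle → Ω → Fin (m + 1)) (J : Particle → Ω → ℕ)
    (Z : ℝ → Particle → Ω → Space d) : Prop where
  measurable_τ : ∀ k, Measurable (τ k)
  measurable_I : ∀ k, Measurable (I k)
  measurable_J : ∀ k, Measurable (J k)
  measurable_Z : ∀ t ∈ 𝕀, ∀ k, Measurable (Z t k)
  law_τ : ∀ k, Pr.map (τ k) =
    (volume.restrict (Ici (0 : ℝ))).withDensity fun t => ENNReal.ofReal (ρ t)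
  law_I : ∀ k n, Pr (I k ⁻¹' {n}) = ENNReal.ofReal (P.p n)
  law_J : ∀ k j, Pr (J k ⁻¹' {j}) = ENNReal.ofReal (P.q j)
  indep_marks : ∀ k, IndepFun (τ k) (fun ω => (I k ω, J k ω)) Pr ∧ IndepFun (I k) (J k) Pr
  indep_particles : iIndepFun (fun k ω => (τ k ω, I k ω, J k ω)) Pr
  /-- The conditional law of the displacements, integrated over an arbitrary event `B` of the
  σ-algebra of all `τ`, `I^0`, `J`, on which the finitely many particles in `S` are born. -/
  law_Z : ∀ t ∈ 𝕀, ∀ S : Finset Particle, ∀ A : Particle → Set (Space d),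
    (∀ k, MeasurableSet (A k)) →
    ∀ B : Set Ω, MeasurableSet[MeasurableSpace.comap
        (fun ω k => (τ k ω, I k ω, J k ω)) inferInstance] B →
      (∀ ω ∈ B, ∀ k ∈ S, k ∈ population τ J t ω) →
      Pr (B ∩ ⋂ k ∈ S, Z t k ⁻¹' A k) =
        ∫⁻ ω in B, ∏ k ∈ S, μ (particleType τ I J t k ω) (lifeTime τ t k ω) (A k) ∂Pr

/-- The position `X^k_{T^t_k}` of the particle `k` at its branching time, for the ancestor
starting from `x`: each particle adds its displacement, with the sign of the convolution
`(f * g)(x) = ∫ f(x - z) g(dz)`. -/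
def position (Z : ℝ → Particle → Ω → Space d) (t : ℝ) (x : Space d) : Particle → Ω → Space d
  | [], ω => x - Z t [] ω
  | j :: k, ω => position Z t x k ω - Z t (j :: k) ω

open Classical in
/-- The factor of the particle `k` in the branching functional: with `n = I^t_k`,
`γ_n(ΔT^t_k, Z^k) f_n(X^k_t) / ρ̄(ΔT^t_k)` if `k` lives at time `t`, and
`γ_N(ΔT^t_k, Z^k) c_{J_k}(t - T^t_k, X^k_{T^t_k}) / ρ(ΔT^t_k)` if `k` branched before `t`. -/
def factor (P : Problem m d) (γ : Fin (m + 1) → ℝ → Space d → ℝ) (ρ : ℝ → ℝ)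
    (τ : Particle → Ω → ℝ) (I : Particle → Ω → Fin (m + 1)) (J : Particle → Ω → ℕ)
    (Z : ℝ → Particle → Ω → Space d) (t : ℝ) (x : Space d) (k : Particle) (ω : Ω) : ℝ :=
  if k ∈ alive τ J t ω then
    γ (particleType τ I J t k ω) (lifeTime τ t k ω) (Z t k ω) / tail ρ (lifeTime τ t k ω)
      * P.f (particleType τ I J t k ω) (position Z t x k ω)
  else
    γ (Fin.last m) (lifeTime τ t k ω) (Z t k ω) / ρ (lifeTime τ t k ω)
      * P.c (J k ω) ((t - branchTime τ t k ω).toNNReal, position Z t x k ω)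

open Classical in
/-- The branching functional `ξ_{t,x}`: the product of the factors of all particles which have
been living prior to `t`. On the event that there are infinitely many of them (the tree explodes
before `t`) the product has no meaning, and `ξ_{t,x}` is set to `0`. -/
def xi (P : Problem m d) (γ : Fin (m + 1) → ℝ → Space d → ℝ) (ρ : ℝ → ℝ)
    (τ : Particle → Ω → ℝ) (I : Particle → Ω → Fin (m + 1)) (J : Particle → Ω → ℕ)
    (Z : ℝ → Particle → Ω → Space d) (t : ℝ) (x : Space d) (ω : Ω) : ℝ :=
  if h : (population τ J t ω).Finite then
    ∏ k ∈ h.toFinset, factor P γ ρ τ I J Z t x k ω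
  else 0

end BranchingCauchy

end

/-!
The problem is turned into a fixed point equation, which the expectation of the branching functional
satisfies by the branching property.

**The linear problem.** Let `A` be the companion matrix of the time operator, so that `B(ξ)` is `A`
with the symbol `b(ξ)` in one more entry. Variation of constants for `exp(tB(ξ))` with respect to
`exp(tA)` (`exp_companion_eq`), tested with Schwartz functions, gives the Volterra equation of the
Green functions (`green_volterra`). Test functions whose Fourier transform has compact support come
first, because only for them the tempered distribution `ĝ_n(t, ·)` is known to act by integration;
the general case follows by approximation. For a bounded source `F` put
`mild F = ∑_n p_n g_n(t) ∗ f_n + ∫_0^t g_N(s) ∗ F(t-s) ds`. Fubini's theorem on a triangle and the Volterra equation show that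
`mild F` solves, against each test function, the linear equation with source `F` in the form given
by variation of constants (`pairing_mild_eq_duhamel`), hence it is a weak solution
(`isLinearSolution_mild`). There is no other one (`IsLinearSolution.eq_mild`): for a solution `v` of
the homogeneous problem, the convolution in time of `⟨g_N ∗ v, φ⟩` can be computed with the Volterra
equation of `g_N` or with that of `v`, and the comparison gives `v = 0`
(`eq_zero_of_pairing_volterra`). So the bounded continuous solutions of the semilinear problem are
the bounded continuous solutions of `u = mild (F(u))`, where `F(u) = ∑_j q_j c_j u^j`.

**Integrability.** The non-explosion condition provides a function `w` with values in `[0, s₁]`,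
`s₁ < R₁`, such that `r₁ + ∫_0^t |g_N|(s, ℝ^d) H₁(w(t-s)) ds ≤ w(t)` (`NonExplosion.exists_majorant`).
The law of `ξ_{t,x}` depends only on the joint law of the marks and of the displacements of the
particles that are born (`HasPathLaw.xi_transfer`). Therefore the given branching process may be
replaced by a canonical one on a product space: each particle has its own independent cell, made of
its marks and a uniform random number, and its displacement is a function of that number which
transforms the uniform distribution into `μ_n(s, ·)`. For the canonical process the functional
satisfies a recursion pointwise (`canonXi_eq`), and the subtrees of the children of the ancestor are
independent copies of the whole tree (`infinitePi_list_split`). Conditioning on the ancestor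
(`lintegral_step_le`), the weights `1 / ρ` and `1 / ρ̄` cancel, and induction over the generations
yields `𝔼|ξ_{t,x}| ≤ w(t)` (`lintegral_canonXi_le`). With integrability at hand, the same
conditioning without absolute values (`integral_step`) shows that `u(t,x) = 𝔼[ξ_{t,x}]` satisfies
`u = mild (F(u))` (`expectedXi_eq_mild`).

**Continuity and uniqueness.** On functions with values in `[-s₁, s₁]`, the map `v ↦ mild (F(v))` is
a contraction in an exponentially weighted supremum norm on each `[0, b]` (`exists_contraction`),
because `|g_N|(s, ℝ^d)` is integrable and `F` is Lipschitz inside the disc of convergence. So `u`,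
which is a priori only measurable, is a uniform limit of continuous Picard iterates
(`continuousOn_of_eq_mild`) and hence a solution (`isSolution_of_eq_mild`). Another solution might
take values up to the boundary of the disc of convergence or beyond; but as long as it agrees with
`u`, it stays in `[-s₁, s₁]`, and on a further short interval, of a length depending only on the
bounds of the sources, it stays in `[-s₂, s₂]` with `s₁ < s₂ < R₁`, where the contraction applies
(`IsSolution.eq_of_abs_le`).

The density `ρ` is arbitrary on the negative half-line, where it need not be measurable. On the
canonical space it is replaced by `0` there, which changes neither the law of the life times nor,
almost surely, the functional.
-/

open scoped Topology

noncomputable section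

namespace BranchingCauchy

/-! ### Matrix exponentials, entry by entry -/

section MatrixExp

attribute [local instance] Matrix.linftyOpNormedRing Matrix.linftyOpNormedAlgebra

theorem hasDerivAt_exp_smul_entry {n : ℕ} {𝕜 : Type*} [RCLike 𝕜] (A : Matrix (Fin n) (Fin n) 𝕜)
    (i j : Fin n) (t : 𝕜) :
    HasDerivAt (fun u : 𝕜 => NormedSpace.exp (u • A) i j)
      ((NormedSpace.exp (t • A) * A) i j) t := by
  have h := hasDerivAt_exp_smul_const (𝕂 := 𝕜) A t
  exact (hasDerivAt_pi.1 ((hasDerivAt_pi.1 h) i)) j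

theorem hasDerivAt_exp_smul_entry' {n : ℕ} {𝕜 : Type*} [RCLike 𝕜] (A : Matrix (Fin n) (Fin n) 𝕜)
    (i j : Fin n) (t : 𝕜) :
    HasDerivAt (fun u : 𝕜 => NormedSpace.exp (u • A) i j)
      ((A * NormedSpace.exp (t • A)) i j) t := by
  have h := hasDerivAt_exp_smul_const' (𝕂 := 𝕜) A t
  exact (hasDerivAt_pi.1 ((hasDerivAt_pi.1 h) i)) j

theorem exp_smul_mul_exp_smul {n : ℕ} (A : Matrix (Fin n) (Fin n) ℝ) (s t : ℝ) :
    NormedSpace.exp (s • A) * NormedSpace.exp (t • A) = NormedSpace.exp ((s + t) • A) := by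
  rw [add_smul, Matrix.exp_add_of_commute]
  exact ((Commute.refl A).smul_left s).smul_right t

end MatrixExp

/-! ### Linear equations in time -/

/-- The companion matrix of the polynomial `∑_n a_n λ^n` of the operator `∑_n a_n ∂_t^n`. -/
def timeMatrix {m : ℕ} (a : Fin (m + 1) → ℝ) : Matrix (Fin (m + 1)) (Fin (m + 1)) ℝ :=
  Matrix.of fun i j =>
    if i = Fin.last m then Fin.cases 0 (fun k : Fin m => -a k.castSucc) j
    else if (j : ℕ) = (i : ℕ) + 1 then 1 else 0

/-- The propagator `exp(t A)` of the ordinary differential equation `∑_n a_n y^{(n)} = 0`. -/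
def propagator {m : ℕ} (a : Fin (m + 1) → ℝ) (t : ℝ) : Matrix (Fin (m + 1)) (Fin (m + 1)) ℝ :=
  NormedSpace.exp (t • timeMatrix a)

section Propagator

variable {m : ℕ} (a : Fin (m + 1) → ℝ)

theorem propagator_zero : propagator a 0 = 1 := by simp [propagator]

theorem propagator_mul (s t : ℝ) : propagator a s * propagator a t = propagator a (s + t) :=
  exp_smul_mul_exp_smul _ _ _

theorem propagator_hasDerivAt (i j : Fin (m + 1)) (t : ℝ) :
    HasDerivAt (fun s => propagator a s i j) ((timeMatrix a * propagator a t) i j) t :=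
  hasDerivAt_exp_smul_entry' (𝕜 := ℝ) (timeMatrix a) i j t

theorem propagator_hasDerivAt' (i j : Fin (m + 1)) (t : ℝ) :
    HasDerivAt (fun s => propagator a s i j) ((propagator a t * timeMatrix a) i j) t :=
  hasDerivAt_exp_smul_entry (𝕜 := ℝ) (timeMatrix a) i j t

theorem propagator_continuous (i j : Fin (m + 1)) : Continuous fun t => propagator a t i j :=
  continuous_iff_continuousAt.2 fun t => (propagator_hasDerivAt a i j t).continuousAt

theorem timeMatrix_mul_castSucc (i : Fin m) (X : Fin (m + 1) → ℝ) :
    ∑ j, timeMatrix a i.castSucc j * X j = X i.succ := by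
  have h : ∀ j, timeMatrix a i.castSucc j * X j = if j = i.succ then X j else 0 := by
    intro j
    have h1 : i.castSucc ≠ Fin.last m := (Fin.castSucc_lt_last i).ne
    have h2 : ((j : ℕ) = (i.castSucc : ℕ) + 1) ↔ j = i.succ := by
      rw [Fin.ext_iff]; simp
    simp only [timeMatrix, Matrix.of_apply, h1, if_false, h2]
    split_ifs <;> simp
  simp [h]

theorem timeMatrix_mul_last (X : Fin (m + 1) → ℝ) :
    ∑ j, timeMatrix a (Fin.last m) j * X j = -∑ k : Fin m, a k.castSucc * X k.succ := by
  rw [Fin.sum_univ_succ]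
  simp [timeMatrix, Finset.sum_neg_distrib]

end Propagator

/-- A time interval containing its left end point `0`. -/
structure IsTimeInterval (𝕀 : Set ℝ) : Prop where
  zero_mem : (0 : ℝ) ∈ 𝕀
  ordConnected : OrdConnected 𝕀
  nonneg : ∀ t ∈ 𝕀, 0 ≤ t
  uniqueDiff : UniqueDiffOn ℝ 𝕀

namespace IsTimeInterval

variable {𝕀 : Set ℝ} (h𝕀 : IsTimeInterval 𝕀)
include h𝕀

theorem Icc_subset {t : ℝ} (ht : t ∈ 𝕀) : Icc 0 t ⊆ 𝕀 := h𝕀.ordConnected.out h𝕀.zero_mem ht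

/-- Every `t ∈ 𝕀` has a neighbourhood in `𝕀` of the form `[0, b]`; if `t` is the right end point of
`𝕀`, then `b = t`. -/
theorem exists_nhds {t : ℝ} (ht : t ∈ 𝕀) : ∃ b ∈ 𝕀, t ≤ b ∧ Icc 0 b ∈ 𝓝[𝕀] t := by
  by_cases hmax : ∃ b ∈ 𝕀, t < b
  · obtain ⟨b, hb, htb⟩ := hmax
    refine ⟨b, hb, htb.le, ?_⟩
    filter_upwards [self_mem_nhdsWithin, mem_nhdsWithin_of_mem_nhds (Iio_mem_nhds htb)] with s h1 h2
    exact ⟨h𝕀.nonneg s h1, (mem_Iio.1 h2).le⟩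
  · push Not at hmax
    exact ⟨t, ht, le_rfl, Filter.mem_of_superset self_mem_nhdsWithin
      fun s hs => ⟨h𝕀.nonneg s hs, hmax s hs⟩⟩

theorem intervalIntegrable {k : ℝ → ℝ} (hk : ContinuousOn k 𝕀) {t : ℝ} (ht : t ∈ 𝕀) :
    IntervalIntegrable k volume 0 t := by
  apply ContinuousOn.intervalIntegrable
  rw [uIcc_of_le (h𝕀.nonneg t ht)]
  exact hk.mono (h𝕀.Icc_subset ht)

theorem hasDerivWithinAt_integral {k : ℝ → ℝ} (hk : ContinuousOn k 𝕀) {t : ℝ} (ht : t ∈ 𝕀) :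
    HasDerivWithinAt (fun u => ∫ s in (0 : ℝ)..u, k s) (k t) 𝕀 t := by
  obtain ⟨b, hb, htb, hnhds⟩ := h𝕀.exists_nhds ht
  have h0b : 0 ≤ b := h𝕀.nonneg b hb
  set k' : ℝ → ℝ := IccExtend h0b ((Icc 0 b).domRestrict k) with hk'
  have hk'c : Continuous k' :=
    continuous_IccExtend_iff.2 (hk.mono (h𝕀.Icc_subset hb)).domRestrict
  have heq : ∀ s ∈ Icc 0 b, k' s = k s := fun s hs => by
    rw [hk', IccExtend_of_mem _ _ hs]; rfl
  have hd : HasDerivAt (fun u => ∫ s in (0 : ℝ)..u, k' s) (k' t) t :=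
    intervalIntegral.integral_hasDerivAt_right (hk'c.intervalIntegrable _ _)
      (hk'c.stronglyMeasurableAtFilter _ _) hk'c.continuousAt
  have htI : t ∈ Icc 0 b := ⟨h𝕀.nonneg t ht, htb⟩
  rw [heq t htI] at hd
  have hint : ∀ u ∈ Icc 0 b, ∫ s in (0 : ℝ)..u, k s = ∫ s in (0 : ℝ)..u, k' s := by
    intro u hu
    refine intervalIntegral.integral_congr fun s hs => ?_
    rw [uIcc_of_le hu.1] at hs
    exact (heq s ⟨hs.1, hs.2.trans hu.2⟩).symm
  refine hd.hasDerivWithinAt.congr_of_eventuallyEq ?_ (hint t htI)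
  filter_upwards [hnhds] with u hu using hint u hu

theorem eq_of_hasDerivWithinAt {f g f' : ℝ → ℝ} (hf : ∀ t ∈ 𝕀, HasDerivWithinAt f (f' t) 𝕀 t)
    (hg : ∀ t ∈ 𝕀, HasDerivWithinAt g (f' t) 𝕀 t) (h0 : f 0 = g 0) {t : ℝ} (ht : t ∈ 𝕀) :
    f t = g t := by
  have h := Convex.norm_image_sub_le_of_norm_hasDerivWithin_le (f := fun s => f s - g s)
    (f' := fun s => f' s - f' s) (C := 0) (fun s hs => (hf s hs).sub (hg s hs))
    (fun s _ => by simp) h𝕀.ordConnected.convex h𝕀.zero_mem ht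
  have : f t - g t - (f 0 - g 0) = 0 := by
    apply norm_le_zero_iff.1; simpa using h
  linarith

end IsTimeInterval

section Duhamel

variable {m : ℕ} (a : Fin (m + 1) → ℝ) (y₀ : Fin (m + 1) → ℝ) (h : ℝ → ℝ)

/-- The solution of `Y' = A Y + h e_N`, `Y(0) = y₀`, by variation of constants. -/
def duhamel (l : Fin (m + 1)) (t : ℝ) : ℝ :=
  ∑ n, propagator a t l n * y₀ n + ∫ s in (0 : ℝ)..t, propagator a (t - s) l (Fin.last m) * h s

theorem duhamel_zero (l : Fin (m + 1)) : duhamel a y₀ h l 0 = y₀ l := by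
  simp [duhamel, propagator_zero, Matrix.one_apply]

variable {𝕀 : Set ℝ} (h𝕀 : IsTimeInterval 𝕀) {h}
include h𝕀

/-- Variation of constants with the time `t` separated from the integral, `exp((t-s)A)` being
`exp(tA) exp(-sA)`. -/
theorem duhamel_eq (hh : ContinuousOn h 𝕀) (l : Fin (m + 1)) {t : ℝ} (ht : t ∈ 𝕀) :
    duhamel a y₀ h l t = ∑ n, propagator a t l n *
      (y₀ n + ∫ s in (0 : ℝ)..t, propagator a (-s) n (Fin.last m) * h s) := by
  have hint : ∀ n, IntervalIntegrable
      (fun s => propagator a (-s) n (Fin.last m) * h s) volume 0 t := fun n =>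
    h𝕀.intervalIntegrable (((propagator_continuous a n _).comp continuous_neg).continuousOn.mul hh)
      ht
  simp only [duhamel, mul_add, Finset.sum_add_distrib]
  congr 1
  have : ∀ s, propagator a (t - s) l (Fin.last m) * h s =
      ∑ n, propagator a t l n * (propagator a (-s) n (Fin.last m) * h s) := by
    intro s
    rw [sub_eq_add_neg, ← propagator_mul, Matrix.mul_apply, Finset.sum_mul]
    simp only [mul_assoc]
  simp only [this]
  rw [intervalIntegral.integral_finsetSum fun n _ => (hint n).const_mul _]
  simp only [intervalIntegral.integral_const_mul]

theorem duhamel_hasDerivWithinAt (hh : ContinuousOn h 𝕀) (l : Fin (m + 1)) {t : ℝ} (ht : t ∈ 𝕀) :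
    HasDerivWithinAt (duhamel a y₀ h l)
      (∑ j, timeMatrix a l j * duhamel a y₀ h j t + if l = Fin.last m then h t else 0) 𝕀 t := by
  have hc : ∀ n, ContinuousOn (fun s => propagator a (-s) n (Fin.last m) * h s) 𝕀 := fun n =>
    ((propagator_continuous a n _).comp continuous_neg).continuousOn.mul hh
  have hd := HasDerivWithinAt.fun_sum (u := Finset.univ) fun n _ =>
    ((propagator_hasDerivAt a l n t).hasDerivWithinAt (s := 𝕀)).mul
      ((h𝕀.hasDerivWithinAt_integral (hc n) ht).const_add (y₀ n))
  refine (hd.congr_deriv ?_).congr (fun s hs => duhamel_eq a y₀ h𝕀 hh l hs)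
    (duhamel_eq a y₀ h𝕀 hh l ht)
  simp only [duhamel_eq a y₀ h𝕀 hh _ ht, Finset.sum_add_distrib, Matrix.mul_apply, Finset.sum_mul,
    Finset.mul_sum]
  congr 1
  · rw [Finset.sum_comm]
    simp only [mul_assoc]
  · have := congr_fun (congr_fun (propagator_mul a t (-t)) l) (Fin.last m)
    rw [Matrix.mul_apply, add_neg_cancel, propagator_zero, Matrix.one_apply] at this
    simp only [← mul_assoc, ← Finset.sum_mul, this]
    split_ifs <;> simp

/-- The components of the solution of the first order system are the derivatives of the first one,
since the matrix `A` of the system has ones on the superdiagonal. -/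
theorem iteratedDerivWithin_duhamel (hh : ContinuousOn h 𝕀) {y : ℝ → ℝ}
    (hy : ∀ t ∈ 𝕀, y t = duhamel a y₀ h 0 t) (l : Fin (m + 1)) :
    ∀ t ∈ 𝕀, iteratedDerivWithin l y 𝕀 t = duhamel a y₀ h l t := by
  induction l using Fin.induction with
  | zero => simpa using hy
  | succ l ih =>
    intro t ht
    have hv : ((l.succ : Fin (m + 1)) : ℕ) = (l.castSucc : ℕ) + 1 := by simp
    rw [hv, iteratedDerivWithin_succ, derivWithin_congr ih (ih t ht),
      (duhamel_hasDerivWithinAt a y₀ h𝕀 hh l.castSucc ht).derivWithin (h𝕀.uniqueDiff t ht),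
      timeMatrix_mul_castSucc, if_neg (Fin.castSucc_lt_last l).ne, add_zero]

theorem iteratedDerivWithin_duhamel_last (hh : ContinuousOn h 𝕀) {y : ℝ → ℝ}
    (hy : ∀ t ∈ 𝕀, y t = duhamel a y₀ h 0 t) :
    ∀ t ∈ 𝕀, iteratedDerivWithin (m + 1) y 𝕀 t =
      h t - ∑ k : Fin m, a k.castSucc * duhamel a y₀ h k.succ t := by
  intro t ht
  have ih := iteratedDerivWithin_duhamel a y₀ h𝕀 hh hy (Fin.last m)
  rw [Fin.val_last] at ih
  rw [iteratedDerivWithin_succ, derivWithin_congr ih (ih t ht),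
    (duhamel_hasDerivWithinAt a y₀ h𝕀 hh _ ht).derivWithin (h𝕀.uniqueDiff t ht),
    timeMatrix_mul_last, if_pos rfl]
  ring

/-- A function given by variation of constants solves the equation `∑_n a_n y^{(n)} = h`. -/
theorem duhamel_equation (ha : a (Fin.last m) = 1) (hh : ContinuousOn h 𝕀) {y : ℝ → ℝ}
    (hy : ∀ t ∈ 𝕀, y t = duhamel a y₀ h 0 t) {t : ℝ} (ht : t ∈ 𝕀) :
    ∑ n : Fin (m + 1), a n * iteratedDerivWithin (n + 1) y 𝕀 t = h t := by
  rw [Fin.sum_univ_castSucc, ha, Fin.val_last,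
    iteratedDerivWithin_duhamel_last a y₀ h𝕀 hh hy t ht]
  have : ∀ k : Fin m, iteratedDerivWithin ((k.castSucc : ℕ) + 1) y 𝕀 t = duhamel a y₀ h k.succ t :=
    fun k => by
      rw [← iteratedDerivWithin_duhamel a y₀ h𝕀 hh hy k.succ t ht]; simp
  simp only [this]
  ring

theorem duhamel_initial (hh : ContinuousOn h 𝕀) {y : ℝ → ℝ}
    (hy : ∀ t ∈ 𝕀, y t = duhamel a y₀ h 0 t) (n : Fin (m + 1)) :
    iteratedDerivWithin n y 𝕀 0 = y₀ n := by
  rw [iteratedDerivWithin_duhamel a y₀ h𝕀 hh hy n 0 h𝕀.zero_mem, duhamel_zero]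

theorem duhamel_contDiffOn (hh : ContinuousOn h 𝕀) {y : ℝ → ℝ}
    (hy : ∀ t ∈ 𝕀, y t = duhamel a y₀ h 0 t) : ContDiffOn ℝ (m + 1 : ℕ) y 𝕀 := by
  have hdiff : ∀ l, DifferentiableOn ℝ (duhamel a y₀ h l) 𝕀 := fun l t ht =>
    (duhamel_hasDerivWithinAt a y₀ h𝕀 hh l ht).differentiableWithinAt
  have hlow : ∀ k < m + 1, DifferentiableOn ℝ (iteratedDerivWithin k y 𝕀) 𝕀 := fun k hk =>
    (hdiff ⟨k, hk⟩).congr (iteratedDerivWithin_duhamel a y₀ h𝕀 hh hy ⟨k, hk⟩)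
  rw [contDiffOn_nat_iff_continuousOn_differentiableOn_deriv h𝕀.uniqueDiff]
  refine ⟨fun k hk => ?_, hlow⟩
  rcases hk.lt_or_eq with hk | rfl
  · exact (hlow k hk).continuousOn
  · refine ContinuousOn.congr ?_ (iteratedDerivWithin_duhamel_last a y₀ h𝕀 hh hy)
    exact hh.sub (continuousOn_finsetSum _ fun k _ =>
      continuousOn_const.mul (hdiff _).continuousOn)

/-- A solution of `∑_n a_n y^{(n)} = h` is given by variation of constants. -/
theorem eq_duhamel (ha : a (Fin.last m) = 1) (hh : ContinuousOn h 𝕀) {y : ℝ → ℝ}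
    (hy : ContDiffOn ℝ (m + 1 : ℕ) y 𝕀)
    (heq : ∀ t ∈ 𝕀, ∑ n : Fin (m + 1), a n * iteratedDerivWithin (n + 1) y 𝕀 t = h t)
    (h0 : ∀ n : Fin (m + 1), iteratedDerivWithin n y 𝕀 0 = y₀ n) {t : ℝ} (ht : t ∈ 𝕀) :
    y t = duhamel a y₀ h 0 t := by
  have hd : ∀ k < m + 1, ∀ t ∈ 𝕀, HasDerivWithinAt (iteratedDerivWithin k y 𝕀)
      (iteratedDerivWithin (k + 1) y 𝕀 t) 𝕀 t := by
    intro k hk t ht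
    rw [iteratedDerivWithin_succ]
    exact (((contDiffOn_nat_iff_continuousOn_differentiableOn_deriv h𝕀.uniqueDiff).1 hy).2 k hk
      t ht).hasDerivWithinAt
  -- the vector of derivatives solves the first order system
  have hY : ∀ l : Fin (m + 1), ∀ t ∈ 𝕀, HasDerivWithinAt (iteratedDerivWithin l y 𝕀)
      (∑ j, timeMatrix a l j * iteratedDerivWithin j y 𝕀 t + if l = Fin.last m then h t else 0)
      𝕀 t := by
    intro l t ht
    refine (hd l l.2 t ht).congr_deriv ?_
    cases l using Fin.lastCases with
    | last =>
      have := heq t ht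
      rw [Fin.sum_univ_castSucc, ha] at this
      rw [if_pos rfl, timeMatrix_mul_last, ← this]
      simp
    | cast i =>
      rw [if_neg (Fin.castSucc_lt_last i).ne,
        timeMatrix_mul_castSucc a i (fun j => iteratedDerivWithin j y 𝕀 t)]
      simp
  have hc : ∀ n, ContinuousOn (fun s => propagator a (-s) n (Fin.last m) * h s) 𝕀 := fun n =>
    ((propagator_continuous a n _).comp continuous_neg).continuousOn.mul hh
  -- the quantity `exp(-tA) Y(t)` has the derivative `h(t) exp(-tA) e_N`
  have hZ : ∀ l, ∀ t ∈ 𝕀, ∑ k, propagator a (-t) l k * iteratedDerivWithin k y 𝕀 t =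
      y₀ l + ∫ s in (0 : ℝ)..t, propagator a (-s) l (Fin.last m) * h s := by
    intro l t ht
    refine h𝕀.eq_of_hasDerivWithinAt
      (f := fun t => ∑ k, propagator a (-t) l k * iteratedDerivWithin k y 𝕀 t)
      (g := fun t => y₀ l + ∫ s in (0 : ℝ)..t, propagator a (-s) l (Fin.last m) * h s)
      (f' := fun t => propagator a (-t) l (Fin.last m) * h t)
      (fun s hs => ?_) (fun s hs => (h𝕀.hasDerivWithinAt_integral (hc l) hs).const_add _) ?_ ht
    · have hp : ∀ k, HasDerivAt (fun t => propagator a (-t) l k)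
          (-(propagator a (-s) * timeMatrix a) l k) s := fun k => by
        have h1 := (propagator_hasDerivAt' a l k (-s)).scomp s (hasDerivAt_neg s)
        rw [neg_one_smul] at h1
        exact h1
      have := HasDerivWithinAt.fun_sum (u := Finset.univ) fun k _ =>
        ((hp k).hasDerivWithinAt (s := 𝕀)).mul (hY k s hs)
      refine this.congr_deriv ?_
      simp only [mul_add, Finset.sum_add_distrib, mul_ite, mul_zero, Finset.sum_ite_eq',
        Finset.mem_univ, if_true, Matrix.mul_apply, neg_mul, Finset.sum_neg_distrib,
        Finset.sum_mul, Finset.mul_sum]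
      rw [Finset.sum_comm]
      simp only [mul_assoc]
      ring
    · simp [propagator_zero, Matrix.one_apply, h0]
  rw [duhamel_eq a y₀ h𝕀 hh 0 ht]
  simp only [← hZ _ t ht, Finset.mul_sum]
  rw [Finset.sum_comm]
  simp only [← mul_assoc, ← Finset.sum_mul, ← Matrix.mul_apply, propagator_mul, add_neg_cancel,
    propagator_zero, Matrix.one_apply]
  simp

end Duhamel

/-! ### The symbol of the Green functions -/

section Symbol

variable {m d : ℕ} (P : Problem m d)

attribute [local instance] Matrix.linftyOpNormedRing Matrix.linftyOpNormedAlgebra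

/-- The matrix `B(ξ)` is the matrix of the time operator, perturbed by the symbol in the entry
`(N, 1)`. -/
theorem companion_entry (ξ : Space d) (i j : Fin (m + 1)) :
    P.companion ξ i j = ((timeMatrix P.a i j : ℝ) : ℂ) +
      if i = Fin.last m ∧ j = 0 then P.symbol ξ else 0 := by
  simp only [Problem.companion, timeMatrix, Matrix.of_apply]
  by_cases hi : i = Fin.last m
  · subst hi
    cases j using Fin.cases <;> simp
  · simp only [hi, if_false, false_and]
    split_ifs <;> simp

/-- Up to the constant, `ĝ_n(t, ξ)` is the entry `(1, n)` of `exp(tB(ξ))`. -/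
theorem ghat_eq (n : Fin (m + 1)) (t : ℝ) (ξ : Space d) :
    P.ghat n t ξ = (((2 * Real.pi) ^ (-(d : ℝ) / 2) : ℝ) : ℂ) *
      NormedSpace.exp ((t : ℂ) • P.companion ξ) 0 n := by
  simp only [Problem.ghat]
  rw [← Matrix.transpose_smul, Matrix.exp_transpose]
  simp [Matrix.mulVec_single]

theorem exp_companion_hasDerivAt (ξ : Space d) (i j : Fin (m + 1)) (t : ℝ) :
    HasDerivAt (fun s : ℝ => NormedSpace.exp ((s : ℂ) • P.companion ξ) i j)
      ((P.companion ξ * NormedSpace.exp ((t : ℂ) • P.companion ξ)) i j) t :=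
  (hasDerivAt_exp_smul_entry' (𝕜 := ℂ) (P.companion ξ) i j t).comp_ofReal

/-- Variation of constants for `exp(tB(ξ))`, with the symbol regarded as a perturbation of the
matrix `A` of the time operator. -/
theorem exp_companion_eq (ξ : Space d) (n : Fin (m + 1)) (t : ℝ) :
    NormedSpace.exp ((t : ℂ) • P.companion ξ) 0 n = (propagator P.a t 0 n : ℂ) +
      ∫ s in (0 : ℝ)..t, (propagator P.a (t - s) 0 (Fin.last m) : ℂ) *
        (P.symbol ξ * NormedSpace.exp ((s : ℂ) • P.companion ξ) 0 n) := by
  have hexpc : ∀ i j, Continuous fun s : ℝ => NormedSpace.exp ((s : ℂ) • P.companion ξ) i j :=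
    fun i j => continuous_iff_continuousAt.2 fun s =>
      (exp_companion_hasDerivAt P ξ i j s).continuousAt
  have hpc : Continuous fun s : ℝ => (propagator P.a (t - s) 0 (Fin.last m) : ℂ) :=
    Complex.continuous_ofReal.comp
      ((propagator_continuous P.a _ _).comp (continuous_const.sub continuous_id))
  -- in the derivative of `exp((t-s)A) exp(sB)`, only the difference of `B` and `A` is left
  have hd : ∀ s : ℝ, HasDerivAt (fun s : ℝ => ∑ k, (propagator P.a (t - s) 0 k : ℂ) *
      NormedSpace.exp ((s : ℂ) • P.companion ξ) k n)
      ((propagator P.a (t - s) 0 (Fin.last m) : ℂ) *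
        (P.symbol ξ * NormedSpace.exp ((s : ℂ) • P.companion ξ) 0 n)) s := by
    intro s
    have hp : ∀ k, HasDerivAt (fun s : ℝ => (propagator P.a (t - s) 0 k : ℂ))
        ((-(propagator P.a (t - s) * timeMatrix P.a) 0 k : ℝ) : ℂ) s := fun k => by
      have h1 := (propagator_hasDerivAt' P.a 0 k (t - s)).scomp s
        ((hasDerivAt_id s).const_sub t)
      simpa using h1.ofReal_comp
    have := HasDerivAt.fun_sum (u := Finset.univ) fun k _ =>
      (hp k).mul (exp_companion_hasDerivAt P ξ k n s)
    refine this.congr_deriv ?_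
    simp only [Matrix.mul_apply, companion_entry, add_mul, Finset.sum_add_distrib, mul_add,
      Complex.ofReal_neg, Complex.ofReal_sum, Complex.ofReal_mul, neg_mul, Finset.sum_neg_distrib,
      Finset.sum_mul, Finset.mul_sum]
    rw [Finset.sum_comm]
    simp only [mul_assoc, neg_add_cancel_left]
    rw [Finset.sum_eq_single (Fin.last m)
      (fun j _ hj => Finset.sum_eq_zero fun i _ => by rw [if_neg (by simp [hj])]; ring) (by simp),
      Finset.sum_eq_single 0 (fun j _ hj => by rw [if_neg (by simp [hj])]; ring)
      (by simp), if_pos ⟨rfl, rfl⟩]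
  have := intervalIntegral.integral_eq_sub_of_hasDerivAt (a := 0) (b := t) (fun s _ => hd s)
    ((hpc.mul (continuous_const.mul (hexpc 0 n))).intervalIntegrable _ _)
  rw [this, sub_self, propagator_zero, sub_zero]
  simp only [Complex.ofReal_zero, zero_smul, NormedSpace.exp_zero, Matrix.one_apply]
  simp [Finset.sum_ite_eq, apply_ite]

end Symbol

variable {m d : ℕ}

/-! ### The inverse Fourier transform on the Schwartz space -/

section FourierInversion

/-- The constant `(2π)^{-d/2}`. -/
def fourierConst (d : ℕ) : ℂ := (((2 * Real.pi) ^ (-(d : ℝ) / 2) : ℝ) : ℂ)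

theorem fourierConst_ne_zero : fourierConst d ≠ 0 := by
  unfold fourierConst
  exact_mod_cast (by positivity : ((2 * Real.pi) ^ (-(d : ℝ) / 2) : ℝ) ≠ 0)

theorem fourierConst_sq : fourierConst d * fourierConst d * (((2 * Real.pi) ^ d : ℝ) : ℂ) = 1 := by
  unfold fourierConst
  rw [← Complex.ofReal_mul, ← Complex.ofReal_mul, ← Complex.ofReal_one]
  congr 1
  rw [← Real.rpow_add (by positivity), ← Real.rpow_natCast, ← Real.rpow_add (by positivity)]
  ring_nf
  simp

theorem invFourier_eq (φ : 𝓢(Space d, ℂ)) (ξ : Space d) :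
    invFourier φ ξ = fourierConst d * (𝓕⁻ φ) ((2 * Real.pi)⁻¹ • ξ) := rfl

theorem invFourier_lineDeriv (φ : 𝓢(Space d, ℂ)) (e ξ : Space d) :
    invFourier (∂_{e} φ) ξ = -Complex.I * ((inner ℝ ξ e : ℝ) : ℂ) * invFourier φ ξ := by
  rw [invFourier_eq, invFourier_eq, SchwartzMap.fourierInv_lineDerivOp_eq]
  have hg : Function.HasTemperateGrowth (fun x : Space d => (inner ℝ x e : ℝ)) := by fun_prop
  rw [_root_.smul_apply, SchwartzMap.smulLeftCLM_apply_apply hg, inner_smul_left]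
  have hpi : (Real.pi : ℂ) ≠ 0 := by exact_mod_cast Real.pi_ne_zero
  simp only [smul_eq_mul, Complex.real_smul]
  push_cast
  simp only [map_inv₀, map_mul, conj_trivial]
  push_cast
  field_simp

/-- A translation becomes a multiplication by a wave. -/
theorem invFourier_comp_add (φ : 𝓢(Space d, ℂ)) (x ξ : Space d) :
    invFourier (SchwartzMap.compSubConstCLM ℂ (-x) φ) ξ =
      Complex.exp (-(Complex.I * ((inner ℝ ξ x : ℝ) : ℂ))) * invFourier φ ξ := by
  rw [invFourier_apply, invFourier_apply]
  have h : ∀ y : Space d, Complex.exp (Complex.I * ((inner ℝ y ξ : ℝ) : ℂ)) *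
      SchwartzMap.compSubConstCLM ℂ (-x) φ y =
      (fun z : Space d => Complex.exp (-(Complex.I * ((inner ℝ ξ x : ℝ) : ℂ))) *
        (Complex.exp (Complex.I * ((inner ℝ z ξ : ℝ) : ℂ)) * φ z)) (y + x) := by
    intro y
    simp only [SchwartzMap.compSubConstCLM_apply, sub_neg_eq_add, inner_add_left, ← mul_assoc,
      ← Complex.exp_add]
    congr 2
    rw [real_inner_comm ξ x]
    push_cast
    ring
  simp only [h]
  rw [integral_add_right_eq_self (μ := volume)
    (fun z : Space d => Complex.exp (-(Complex.I * ((inner ℝ ξ x : ℝ) : ℂ))) *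
        (Complex.exp (Complex.I * ((inner ℝ z ξ : ℝ) : ℂ)) * φ z)), integral_const_mul]
  ring

/-- Fourier inversion. -/
theorem eq_integral_invFourier (φ : 𝓢(Space d, ℂ)) (x : Space d) :
    φ x = fourierConst d *
      ∫ ξ : Space d, Complex.exp (-(Complex.I * ((inner ℝ ξ x : ℝ) : ℂ))) * invFourier φ ξ := by
  have hpi : (Real.pi : ℂ) ≠ 0 := by exact_mod_cast Real.pi_ne_zero
  have hinv : 𝓕 (𝓕⁻ φ) = φ := FourierTransform.fourier_fourierInv_eq φ
  conv_lhs => rw [← hinv]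
  rw [SchwartzMap.fourier_coe, Real.fourier_eq']
  let g : Space d → ℂ := fun w => fourierConst d *
    (Complex.exp (((-2 * Real.pi * inner ℝ w x : ℝ) : ℂ) * Complex.I) • (𝓕⁻ φ) w)
  have h : ∀ v : Space d, Complex.exp (-(Complex.I * ((inner ℝ v x : ℝ) : ℂ))) * invFourier φ v =
      g ((2 * Real.pi)⁻¹ • v) := by
    intro v
    simp only [invFourier_eq, inner_smul_left, smul_eq_mul, conj_trivial, g]
    have : ((-2 * Real.pi * ((2 * Real.pi)⁻¹ * inner ℝ v x) : ℝ) : ℂ) * Complex.I =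
        -(Complex.I * ((inner ℝ v x : ℝ) : ℂ)) := by
      push_cast; field_simp
    rw [this]
    ring
  rw [integral_congr_ae (Filter.Eventually.of_forall h),
    Measure.integral_comp_smul (μ := volume) g, integral_const_mul, finrank_euclideanSpace_fin,
    abs_of_nonneg (by positivity), inv_pow, inv_inv, Complex.real_smul]
  have := fourierConst_sq (d := d)
  generalize (∫ v : Space d,
    Complex.exp (((-2 * Real.pi * inner ℝ v x : ℝ) : ℂ) * Complex.I) • (𝓕⁻ φ) v) = A
  linear_combination (-A) * this

theorem invFourier_surjective (χ : 𝓢(Space d, ℂ)) : ∃ φ : 𝓢(Space d, ℂ), invFourier φ = χ := by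
  refine ⟨(fourierConst d)⁻¹ •
    𝓕 (SchwartzMap.compCLMOfContinuousLinearEquiv ℂ (dilation d).symm χ), ?_⟩
  ext ξ
  have h1 : 𝓕⁻ ((fourierConst d)⁻¹ •
      𝓕 (SchwartzMap.compCLMOfContinuousLinearEquiv ℂ (dilation d).symm χ)) =
      (fourierConst d)⁻¹ • SchwartzMap.compCLMOfContinuousLinearEquiv ℂ (dilation d).symm χ := by
    rw [← FourierTransform.fourier_smul, FourierPair.fourierInv_fourier_eq]
  have hd : (2 * Real.pi)⁻¹ • ξ = dilation d ξ := rfl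
  rw [invFourier_eq, h1, _root_.smul_apply,
    SchwartzMap.compCLMOfContinuousLinearEquiv_apply, Function.comp_apply, hd,
    ContinuousLinearEquiv.symm_apply_apply, smul_eq_mul, mul_inv_cancel_left₀ fourierConst_ne_zero]

theorem invFourier_add (φ ψ : 𝓢(Space d, ℂ)) :
    invFourier (φ + ψ) = invFourier φ + invFourier ψ := by
  ext ξ
  rw [invFourier_eq, FourierTransform.fourierInv_add]
  simp only [_root_.add_apply, invFourier_eq]
  ring

/-- `D^α φ` for Schwartz functions with values in any normed space. -/
def multiDerivOp {F : Type*} [NormedAddCommGroup F] [NormedSpace ℝ F] (α : Fin d → ℕ)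
    (φ : 𝓢(Space d, F)) : 𝓢(Space d, F) :=
  (List.finRange d).foldr
    (fun i ψ => (fun χ : 𝓢(Space d, F) => ∂_{EuclideanSpace.single i (1 : ℝ)} χ)^[α i] ψ) φ

theorem multiDerivOp_real (α : Fin d → ℕ) (φ : 𝓢(Space d, ℝ)) :
    multiDerivOp α φ = multiDeriv α φ := rfl

/-- The formal adjoint `φ ↦ ∑_α (-1)^{|α|} b_α D^α φ` of the space operator. -/
def adjointOp {F : Type*} [NormedAddCommGroup F] [NormedSpace ℝ F] (P : Problem m d)
    (φ : 𝓢(Space d, F)) : 𝓢(Space d, F) :=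
  ∑ α ∈ multiIdx d P.M, (P.b α * (-1) ^ (∑ i, α i)) • multiDerivOp α φ

/-- A relation between Schwartz functions that is compatible with the line derivatives is
compatible with `D^α`. -/
theorem multiDerivOp_rel {F F' : Type*} [NormedAddCommGroup F] [NormedSpace ℝ F]
    [NormedAddCommGroup F'] [NormedSpace ℝ F'] (T : 𝓢(Space d, F) → 𝓢(Space d, F'))
    (hT : ∀ (e : Space d) (φ : 𝓢(Space d, F)), T (∂_{e} φ) = ∂_{e} (T φ)) (α : Fin d → ℕ)
    (φ : 𝓢(Space d, F)) : T (multiDerivOp α φ) = multiDerivOp α (T φ) := by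
  unfold multiDerivOp
  induction List.finRange d with
  | nil => rfl
  | cons i l ih =>
    simp only [List.foldr_cons]
    rw [← ih]
    exact Function.Semiconj.iterate_right (f := T) (fun ψ => hT _ ψ) (α i) _

theorem adjointOp_rel {F F' : Type*} [NormedAddCommGroup F] [NormedSpace ℝ F]
    [NormedAddCommGroup F'] [NormedSpace ℝ F'] (P : Problem m d)
    (T : 𝓢(Space d, F) →ₗ[ℝ] 𝓢(Space d, F'))
    (hT : ∀ (e : Space d) (φ : 𝓢(Space d, F)), T (∂_{e} φ) = ∂_{e} (T φ))
    (φ : 𝓢(Space d, F)) : T (adjointOp P φ) = adjointOp P (T φ) := by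
  simp only [adjointOp, map_sum, map_smul, multiDerivOp_rel T hT]

theorem adjointOp_apply {F : Type*} [NormedAddCommGroup F] [NormedSpace ℝ F] (P : Problem m d)
    (φ : 𝓢(Space d, F)) (x : Space d) : adjointOp P φ x =
      ∑ α ∈ multiIdx d P.M, (P.b α * (-1) ^ (∑ i, α i)) • multiDerivOp α φ x := by
  simp [adjointOp]

theorem invFourier_multiDerivOp (α : Fin d → ℕ) (φ : 𝓢(Space d, ℂ)) (ξ : Space d) :
    invFourier (multiDerivOp α φ) ξ =
      (∏ i, (-Complex.I * ((ξ i : ℝ) : ℂ)) ^ α i) * invFourier φ ξ := by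
  have hit : ∀ (i : Fin d) (k : ℕ) (ψ : 𝓢(Space d, ℂ)), invFourier
      ((fun χ : 𝓢(Space d, ℂ) => ∂_{EuclideanSpace.single i (1 : ℝ)} χ)^[k] ψ) ξ =
      (-Complex.I * ((ξ i : ℝ) : ℂ)) ^ k * invFourier ψ ξ := by
    intro i k ψ
    induction k with
    | zero => simp
    | succ k ih =>
      rw [Function.iterate_succ_apply', invFourier_lineDeriv, ih, pow_succ]
      simp [EuclideanSpace.inner_single_right]
      ring
  have : ∀ l : List (Fin d), invFourier (l.foldr (fun i ψ =>
      (fun χ : 𝓢(Space d, ℂ) => ∂_{EuclideanSpace.single i (1 : ℝ)} χ)^[α i] ψ) φ) ξ =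
      (l.map fun i => (-Complex.I * ((ξ i : ℝ) : ℂ)) ^ α i).prod * invFourier φ ξ := by
    intro l
    induction l with
    | nil => simp
    | cons i l ih => rw [List.foldr_cons, hit, ih, List.map_cons, List.prod_cons, mul_assoc]
  rw [multiDerivOp, this, ← List.ofFn_eq_map, List.prod_ofFn]

/-- The inverse Fourier transform turns the adjoint of the space operator into the multiplication by
the symbol. -/
theorem invFourier_adjointOp (P : Problem m d) (φ : 𝓢(Space d, ℂ)) (ξ : Space d) :
    invFourier (adjointOp P φ) ξ = P.symbol ξ * invFourier φ ξ := by
  let L : 𝓢(Space d, ℂ) →+ ℂ :=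
    { toFun := fun ψ => invFourier ψ ξ
      map_zero' := by rw [invFourier_apply]; simp
      map_add' := fun ψ₁ ψ₂ => by rw [invFourier_add, _root_.add_apply] }
  have hsmul : ∀ (r : ℝ) (ψ : 𝓢(Space d, ℂ)), L (r • ψ) = r * L ψ := by
    intro r ψ
    change invFourier (r • ψ) ξ = r * invFourier ψ ξ
    rw [invFourier_apply, invFourier_apply]
    have : ∀ x : Space d, Complex.exp (Complex.I * ((inner ℝ x ξ : ℝ) : ℂ)) * (r • ψ) x =
        r * (Complex.exp (Complex.I * ((inner ℝ x ξ : ℝ) : ℂ)) * ψ x) := fun x => by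
      rw [_root_.smul_apply, Complex.real_smul]; ring
    simp only [this]
    rw [integral_const_mul]
    ring
  change L (adjointOp P φ) = _
  rw [adjointOp, map_sum, Problem.symbol, Finset.sum_mul]
  refine Finset.sum_congr rfl fun α _ => ?_
  rw [hsmul]
  change _ * invFourier (multiDerivOp α φ) ξ = _
  rw [invFourier_multiDerivOp]
  simp only [mul_pow, Finset.prod_mul_distrib, Finset.prod_pow_eq_pow_sum]
  rw [neg_pow]
  push_cast
  have : ((-1 : ℂ) ^ (∑ i, α i)) * (-1) ^ (∑ i, α i) = 1 := by
    rw [← mul_pow]; simp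
  linear_combination (Complex.I ^ (∑ i, α i) * (P.b α : ℂ) *
    (∏ i, ((ξ i : ℝ) : ℂ) ^ α i) * invFourier φ ξ) * this

/-! ### Approximation by Schwartz functions whose Fourier transform has compact support -/

/-- Approximation by Schwartz functions whose inverse Fourier transform is that of `φ`, multiplied
by a smooth cutoff. It is needed because the tempered distribution `ĝ_n(t, ·)` is known to be given
by the integral against the function `ĝ_n(t, ·)` only for test functions with compact support. -/
theorem exists_bandlimited (φ : 𝓢(Space d, ℂ)) : ∃ φ' : ℕ → 𝓢(Space d, ℂ),
    (∀ k, HasCompactSupport (invFourier (φ' k))) ∧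
    (∀ k ξ, ‖invFourier (φ' k) ξ‖ ≤ ‖invFourier φ ξ‖) ∧
    ∀ ξ, ∀ᶠ k in Filter.atTop, invFourier (φ' k) ξ = invFourier φ ξ := by
  let η : ℕ → ContDiffBump (0 : Space d) := fun k => ⟨k + 1, k + 2, by positivity, by linarith⟩
  have hcs : ∀ k, HasCompactSupport fun ξ => ((η k ξ : ℝ) : ℂ) * invFourier φ ξ := fun k =>
    HasCompactSupport.mul_right ((η k).hasCompactSupport.comp_left Complex.ofReal_zero)
  have hsm : ∀ k, ContDiff ℝ (↑(⊤ : ℕ∞)) fun ξ => ((η k ξ : ℝ) : ℂ) * invFourier φ ξ := fun k =>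
    (Complex.ofRealCLM.contDiff.comp (η k).contDiff).mul ((invFourier φ).smooth ⊤)
  choose φ' hφ' using fun k => invFourier_surjective ((hcs k).toSchwartzMap (hsm k))
  have happ : ∀ k ξ, invFourier (φ' k) ξ = ((η k ξ : ℝ) : ℂ) * invFourier φ ξ := fun k ξ => by
    rw [hφ' k]; rfl
  refine ⟨φ', fun k => ?_, fun k ξ => ?_, fun ξ => ?_⟩
  · rw [hφ' k]; exact hcs k
  · rw [happ, norm_mul, Complex.norm_real, Real.norm_of_nonneg (η k).nonneg]
    exact mul_le_of_le_one_left (norm_nonneg _) (η k).le_one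
  · filter_upwards [Filter.eventually_ge_atTop ⌈‖ξ‖⌉₊] with k hk
    rw [happ, (η k).one_of_mem_closedBall, Complex.ofReal_one, one_mul]
    rw [mem_closedBall_zero_iff]
    have : ‖ξ‖ ≤ k := (Nat.le_ceil _).trans (by exact_mod_cast hk)
    change ‖ξ‖ ≤ (k : ℝ) + 1
    linarith

theorem norm_le_of_norm_invFourier_le {φ : 𝓢(Space d, ℂ)} {h : Space d → ℝ}
    (hh : Integrable h) (hle : ∀ ξ, ‖invFourier φ ξ‖ ≤ h ξ) (x : Space d) :
    ‖φ x‖ ≤ ‖fourierConst d‖ * ∫ ξ, h ξ := by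
  rw [eq_integral_invFourier φ x, norm_mul]
  gcongr
  refine norm_integral_le_of_norm_le hh (Filter.Eventually.of_forall fun ξ => ?_)
  rw [norm_mul, show -(Complex.I * ((inner ℝ ξ x : ℝ) : ℂ)) =
    ((-(inner ℝ ξ x) : ℝ) : ℂ) * Complex.I by push_cast; ring, Complex.norm_exp_ofReal_mul_I,
    one_mul]
  exact hle ξ

theorem tendsto_of_invFourier {φ : 𝓢(Space d, ℂ)} {φ' : ℕ → 𝓢(Space d, ℂ)}
    (hle : ∀ k ξ, ‖invFourier (φ' k) ξ‖ ≤ ‖invFourier φ ξ‖)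
    (hev : ∀ ξ, ∀ᶠ k in Filter.atTop, invFourier (φ' k) ξ = invFourier φ ξ) (x : Space d) :
    Filter.Tendsto (fun k => φ' k x) Filter.atTop (𝓝 (φ x)) := by
  rw [eq_integral_invFourier φ x]
  simp only [eq_integral_invFourier (φ' _) x]
  refine Filter.Tendsto.const_mul _ ?_
  refine tendsto_integral_of_dominated_convergence (fun ξ => ‖invFourier φ ξ‖) (fun k => ?_)
    (invFourier φ).integrable.norm (fun k => Filter.Eventually.of_forall fun ξ => ?_)
    (Filter.Eventually.of_forall fun ξ => ?_)
  · refine Continuous.aestronglyMeasurable (Continuous.mul ?_ (invFourier (φ' k)).continuous)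
    fun_prop
  · rw [norm_mul, show -(Complex.I * ((inner ℝ ξ x : ℝ) : ℂ)) =
      ((-(inner ℝ ξ x) : ℝ) : ℂ) * Complex.I by push_cast; ring, Complex.norm_exp_ofReal_mul_I,
      one_mul]
    exact hle k ξ
  · refine tendsto_const_nhds.congr' ?_
    filter_upwards [hev ξ] with k hk
    rw [hk]

end FourierInversion

/-! ### The Volterra equation of the Green functions -/

section GreenVolterra

section SymbolContinuity

attribute [local instance] Matrix.linftyOpNormedRing Matrix.linftyOpNormedAlgebra

theorem symbol_continuous (P : Problem m d) : Continuous P.symbol := by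
  unfold Problem.symbol
  fun_prop

theorem companion_continuous (P : Problem m d) : Continuous P.companion := by
  refine continuous_pi fun i => continuous_pi fun j => ?_
  simp only [companion_entry]
  split_ifs
  · exact continuous_const.add (symbol_continuous P)
  · fun_prop

theorem exp_companion_continuous (P : Problem m d) (i j : Fin (m + 1)) :
    Continuous fun z : ℝ × Space d => NormedSpace.exp ((z.1 : ℂ) • P.companion z.2) i j := by
  let : NormedAlgebra ℚ (Matrix (Fin (m + 1)) (Fin (m + 1)) ℂ) := NormedAlgebra.restrictScalars ℚ ℝ _
  have h1 : Continuous fun z : ℝ × Space d => (z.1 : ℂ) • P.companion z.2 :=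
    (Complex.continuous_ofReal.comp continuous_fst).smul
      ((companion_continuous P).comp continuous_snd)
  have h2 : Continuous fun z : ℝ × Space d => NormedSpace.exp ((z.1 : ℂ) • P.companion z.2) :=
    NormedSpace.exp_continuous.comp h1
  exact (continuous_apply j).comp ((continuous_apply i).comp h2)

end SymbolContinuity

variable {P : Problem m d} {T₀ : EReal} {μ : Fin (m + 1) → Kernel ℝ (Space d)}
  {γ : Fin (m + 1) → ℝ → Space d → ℝ}

/-- The function `ξ ↦ e^{-iξ·x}`. -/
def wave (x ξ : Space d) : ℂ := Complex.exp (-(Complex.I * ((inner ℝ ξ x : ℝ) : ℂ)))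

theorem wave_continuous (x : Space d) : Continuous (wave x) := by
  unfold wave; fun_prop

/-- The defining property of `g_n = 𝔉⁻¹ ĝ_n`, on translates of test functions whose inverse Fourier
transform has compact support, where the distribution `ĝ_n` acts by integration. -/
theorem integral_green_bandlimited (hTempered : TemperedGreen P T₀)
    (hGreen : GreenDensities P T₀ μ γ) (n : Fin (m + 1)) {t : ℝ} (ht : 0 ≤ t)
    (htT : (t : EReal) < T₀) {φ : 𝓢(Space d, ℂ)} (hφ : HasCompactSupport (invFourier φ))
    (x : Space d) :
    ∫ y, φ (x + y) * (γ n t y : ℂ) ∂(μ n t) =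
      ∫ ξ, P.ghat n t ξ * (wave x ξ * invFourier φ ξ) := by
  obtain ⟨G, hG⟩ := hTempered n t ht htT
  have happ : ∀ ξ, invFourier (SchwartzMap.compSubConstCLM ℂ (-x) φ) ξ =
      wave x ξ * invFourier φ ξ := invFourier_comp_add φ x
  have hcs : HasCompactSupport (invFourier (SchwartzMap.compSubConstCLM ℂ (-x) φ)) := by
    have : ⇑(invFourier (SchwartzMap.compSubConstCLM ℂ (-x) φ)) =
      fun ξ => wave x ξ * invFourier φ ξ := funext happ
    rw [this]
    exact hφ.mul_left
  have h1 := hGreen.green n t ht htT G hG (SchwartzMap.compSubConstCLM ℂ (-x) φ)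
  rw [hG _ hcs] at h1
  simp only [happ, SchwartzMap.compSubConstCLM_apply, sub_neg_eq_add] at h1
  rw [h1]
  simp only [add_comm x]

/-- The Volterra equation of the Green functions, on test functions whose inverse Fourier transform
has compact support: there, all integrals can be computed on the Fourier side, where it reduces to
`exp_companion_eq`. -/
theorem green_volterra_bandlimited (hTempered : TemperedGreen P T₀)
    (hGreen : GreenDensities P T₀ μ γ) (n : Fin (m + 1)) {t : ℝ} (ht : 0 ≤ t)
    (htT : (t : EReal) < T₀) {φ : 𝓢(Space d, ℂ)} (hφ : HasCompactSupport (invFourier φ))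
    (x : Space d) :
    ∫ y, φ (x + y) * (γ n t y : ℂ) ∂(μ n t) = (propagator P.a t 0 n : ℂ) * φ x +
      ∫ s in (0 : ℝ)..t, (propagator P.a (t - s) 0 (Fin.last m) : ℂ) *
        ∫ y, adjointOp P φ (x + y) * (γ n s y : ℂ) ∂(μ n s) := by
  have hφ' : HasCompactSupport (invFourier (adjointOp P φ)) := by
    have : ⇑(invFourier (adjointOp P φ)) = fun ξ => P.symbol ξ * invFourier φ ξ :=
      funext (invFourier_adjointOp P φ)
    rw [this]
    exact hφ.mul_left
  -- the integrand on the Fourier side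
  let g : ℝ → Space d → ℂ := fun s ξ => (propagator P.a (t - s) 0 (Fin.last m) : ℂ) *
    (fourierConst d * (P.symbol ξ * NormedSpace.exp ((s : ℂ) • P.companion ξ) 0 n)) *
      (wave x ξ * invFourier φ ξ)
  have hgc : Continuous (Function.uncurry g) := by
    have h1 : Continuous fun z : ℝ × Space d => (propagator P.a (t - z.1) 0 (Fin.last m) : ℂ) :=
      Complex.continuous_ofReal.comp
        ((propagator_continuous P.a _ _).comp (continuous_const.sub continuous_fst))
    exact (h1.mul (continuous_const.mul (((symbol_continuous P).comp continuous_snd).mul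
      (exp_companion_continuous P 0 n)))).mul
      (((wave_continuous x).comp continuous_snd).mul
        ((invFourier φ).continuous.comp continuous_snd))
  have hg0 : ∀ s, ∀ ξ ∉ tsupport (invFourier φ), g s ξ = 0 := fun s ξ hξ => by
    simp [g, image_eq_zero_of_notMem_tsupport hξ]
  have hint : Integrable (Function.uncurry g)
      ((volume.restrict (Ioc 0 t)).prod (volume : Measure (Space d))) := by
    have hK : IntegrableOn (Function.uncurry g) (Icc 0 t ×ˢ tsupport (invFourier φ))
        (volume.prod volume) :=
      hgc.continuousOn.integrableOn_compact (isCompact_Icc.prod hφ)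
    have hK' : IntegrableOn (Function.uncurry g) (Icc 0 t ×ˢ univ) (volume.prod volume) := by
      refine hK.of_forall_sdiff_eq_zero (measurableSet_Icc.prod MeasurableSet.univ) ?_
      rintro ⟨s, ξ⟩ ⟨⟨h1, -⟩, h2⟩
      exact hg0 s ξ fun h => h2 ⟨h1, h⟩
    have := hK'.mono_set (prod_mono_left (Ioc_subset_Icc_self (a := (0 : ℝ)) (b := t)))
    rwa [IntegrableOn, ← Measure.prod_restrict, Measure.restrict_univ] at this
  have hinner : ∀ s ∈ uIoc 0 t, (propagator P.a (t - s) 0 (Fin.last m) : ℂ) *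
      ∫ y, adjointOp P φ (x + y) * (γ n s y : ℂ) ∂(μ n s) = ∫ ξ, g s ξ := by
    intro s hs
    rw [uIoc_of_le ht] at hs
    rw [integral_green_bandlimited hTempered hGreen n hs.1.le
      (lt_of_le_of_lt (by exact_mod_cast hs.2) htT) hφ' x, ← integral_const_mul]
    refine integral_congr_ae (Filter.Eventually.of_forall fun ξ => ?_)
    simp only [ghat_eq, invFourier_adjointOp, g, fourierConst]
    ring
  rw [intervalIntegral.integral_congr_ae (Filter.Eventually.of_forall hinner),
    intervalIntegral.integral_of_le ht, integral_integral_swap hint,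
    integral_green_bandlimited hTempered hGreen n ht htT hφ x]
  -- the Volterra equation of the matrix exponential, for fixed `ξ`
  have hsplit : ∀ ξ, P.ghat n t ξ * (wave x ξ * invFourier φ ξ) =
      (propagator P.a t 0 n : ℂ) * (fourierConst d * (wave x ξ * invFourier φ ξ)) +
        ∫ s in Ioc 0 t, g s ξ := by
    intro ξ
    rw [ghat_eq, exp_companion_eq, intervalIntegral.integral_of_le ht]
    simp only [g]
    rw [integral_mul_const, mul_add, add_mul, ← integral_const_mul]
    congr 1
    · simp only [fourierConst]; ring
    · congr 1
      refine integral_congr_ae (Filter.Eventually.of_forall fun s => ?_)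
      simp only [fourierConst]; ring
  simp only [hsplit]
  have hi2 : Integrable fun ξ => ∫ s in Ioc 0 t, g s ξ := hint.integral_prod_right
  have hi1 : Integrable fun ξ => (propagator P.a t 0 n : ℂ) *
      (fourierConst d * (wave x ξ * invFourier φ ξ)) :=
    ((((wave_continuous x).mul (invFourier φ).continuous).integrable_of_hasCompactSupport
      hφ.mul_left).const_mul _).const_mul _
  rw [integral_add hi1 hi2, integral_const_mul, integral_const_mul, eq_integral_invFourier φ x]
  rfl

/-! ### Signed kernels with bounded densities -/

/-- `γ(t,·) μ(t,·)` is, for the times `t ∈ S`, a finite signed measure, given by a Markov kernel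
and a jointly measurable density which is bounded for each `t`. -/
structure IsSignedKernel (S : Set ℝ) (μ : Kernel ℝ (Space d)) (γ : ℝ → Space d → ℝ) : Prop where
  markov : IsMarkovKernel μ
  measurable : Measurable (Function.uncurry γ)
  bounded : ∀ t ∈ S, ∃ C : ℝ, ∀ x, |γ t x| ≤ C

/-- The total mass `|γ(t,·) μ(t,·)|(ℝ^d)`. -/
def mass (μ : Kernel ℝ (Space d)) (γ : ℝ → Space d → ℝ) (t : ℝ) : ℝ := ∫ x, |γ t x| ∂(μ t)

namespace IsSignedKernel

variable {S : Set ℝ} {μ : Kernel ℝ (Space d)} {γ : ℝ → Space d → ℝ} (h : IsSignedKernel S μ γ)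
include h

theorem measurable_slice (t : ℝ) : Measurable (γ t) := h.measurable.of_uncurry_left

theorem integrable {t : ℝ} (ht : t ∈ S) : Integrable (γ t) (μ t) := by
  have := h.markov
  obtain ⟨C, hC⟩ := h.bounded t ht
  exact Integrable.of_bound (h.measurable_slice t).aestronglyMeasurable C
    (Filter.Eventually.of_forall hC)

omit h in
theorem mass_nonneg (μ : Kernel ℝ (Space d)) (γ : ℝ → Space d → ℝ) (t : ℝ) : 0 ≤ mass μ γ t :=
  integral_nonneg fun _ => abs_nonneg _

theorem norm_integral_mul_le {𝕜 : Type*} [RCLike 𝕜] {t : ℝ} (ht : t ∈ S) {ψ : Space d → 𝕜} {C : ℝ}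
    (hC : ∀ x, ‖ψ x‖ ≤ C) : ‖∫ y, ψ y * (γ t y : 𝕜) ∂(μ t)‖ ≤ C * mass μ γ t := by
  rw [mass, ← integral_const_mul]
  refine norm_integral_le_of_norm_le ((h.integrable ht).abs.const_mul C)
    (Filter.Eventually.of_forall fun y => ?_)
  rw [norm_mul, RCLike.norm_ofReal]
  exact mul_le_mul_of_nonneg_right (hC y) (abs_nonneg _)

theorem measurable_mass : Measurable (mass μ γ) := by
  have := h.markov
  have h1 : StronglyMeasurable fun p : ℝ × Space d => |γ p.1 p.2| :=
    (continuous_abs.measurable.comp h.measurable).stronglyMeasurable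
  exact (MeasureTheory.StronglyMeasurable.integral_kernel_prod_right' (κ := μ) h1).measurable

/-- Measurability of `(t,w) ↦ ∫ ψ(w,t,y) γ(t,y) μ(t,dy)`. -/
theorem measurable_integral {𝕜 : Type*} [RCLike 𝕜] {W : Type*} [MeasurableSpace W]
    {ψ : W → ℝ → Space d → 𝕜} (hψ : Measurable fun p : (W × ℝ) × Space d => ψ p.1.1 p.1.2 p.2) :
    Measurable fun p : W × ℝ => ∫ y, ψ p.1 p.2 y * (γ p.2 y : 𝕜) ∂(μ p.2) := by
  have := h.markov
  have hγ : Measurable fun p : (W × ℝ) × Space d => (γ p.1.2 p.2 : 𝕜) :=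
    RCLike.measurable_ofReal.comp (h.measurable.comp
      ((measurable_snd.comp measurable_fst).prodMk measurable_snd))
  have h1 : StronglyMeasurable fun p : (W × ℝ) × Space d => ψ p.1.1 p.1.2 p.2 * (γ p.1.2 p.2 : 𝕜) :=
    (hψ.mul hγ).stronglyMeasurable
  exact (MeasureTheory.StronglyMeasurable.integral_kernel_prod_right'
    (κ := μ.comap Prod.snd measurable_snd) h1).measurable

end IsSignedKernel

theorem GreenDensities.isSignedKernel (hGreen : GreenDensities P T₀ μ γ) (n : Fin (m + 1)) :
    IsSignedKernel {t : ℝ | 0 ≤ t ∧ (t : EReal) < T₀} (μ n) (γ n) :=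
  ⟨hGreen.markov n, hGreen.measurable n, fun t ht => hGreen.bounded n t ht.1 ht.2⟩

/-- The Volterra equation of the Green functions, for all complex Schwartz functions. -/
theorem green_volterra_complex (hTempered : TemperedGreen P T₀)
    (hGreen : GreenDensities P T₀ μ γ) (n : Fin (m + 1)) {t : ℝ} (ht : 0 ≤ t)
    (htT : (t : EReal) < T₀) (hmass : IntegrableOn (mass (μ n) (γ n)) (Icc 0 t))
    (φ : 𝓢(Space d, ℂ)) (x : Space d) :
    ∫ y, φ (x + y) * (γ n t y : ℂ) ∂(μ n t) = (propagator P.a t 0 n : ℂ) * φ x +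
      ∫ s in (0 : ℝ)..t, (propagator P.a (t - s) 0 (Fin.last m) : ℂ) *
        ∫ y, adjointOp P φ (x + y) * (γ n s y : ℂ) ∂(μ n s) := by
  obtain ⟨φ', hcs, hle, hev⟩ := exists_bandlimited φ
  have hker := hGreen.isSignedKernel n
  have hle' : ∀ k ξ, ‖invFourier (adjointOp P (φ' k)) ξ‖ ≤ ‖invFourier (adjointOp P φ) ξ‖ :=
    fun k ξ => by
      rw [invFourier_adjointOp, invFourier_adjointOp, norm_mul, norm_mul]
      exact mul_le_mul_of_nonneg_left (hle k ξ) (norm_nonneg _)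
  have hev' : ∀ ξ, ∀ᶠ k in Filter.atTop,
      invFourier (adjointOp P (φ' k)) ξ = invFourier (adjointOp P φ) ξ := fun ξ => by
    filter_upwards [hev ξ] with k hk
    rw [invFourier_adjointOp, invFourier_adjointOp, hk]
  -- dominated convergence for the integrals over `ℝ^d`
  have hlim : ∀ (ψ : 𝓢(Space d, ℂ)) (ψ' : ℕ → 𝓢(Space d, ℂ)),
      (∀ k ξ, ‖invFourier (ψ' k) ξ‖ ≤ ‖invFourier ψ ξ‖) →
      (∀ ξ, ∀ᶠ k in Filter.atTop, invFourier (ψ' k) ξ = invFourier ψ ξ) →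
      ∀ s : ℝ, 0 ≤ s → (s : EReal) < T₀ →
      Filter.Tendsto (fun k => ∫ y, ψ' k (x + y) * (γ n s y : ℂ) ∂(μ n s)) Filter.atTop
        (𝓝 (∫ y, ψ (x + y) * (γ n s y : ℂ) ∂(μ n s))) := by
    intro ψ ψ' h1 h2 s hs hsT
    refine tendsto_integral_of_dominated_convergence
      (fun y => (‖fourierConst d‖ * ∫ ξ, ‖invFourier ψ ξ‖) * |γ n s y|) (fun k => ?_)
      ((hker.integrable ⟨hs, hsT⟩).abs.const_mul _)
      (fun k => Filter.Eventually.of_forall fun y => ?_)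
      (Filter.Eventually.of_forall fun y => ?_)
    · exact (((ψ' k).continuous.measurable.comp (measurable_const_add x)).mul
        (Complex.measurable_ofReal.comp (hker.measurable_slice s))).aestronglyMeasurable
    · rw [norm_mul, Complex.norm_real, Real.norm_eq_abs]
      exact mul_le_mul_of_nonneg_right
        (norm_le_of_norm_invFourier_le (invFourier ψ).integrable.norm (h1 k) _) (abs_nonneg _)
    · exact (tendsto_of_invFourier h1 h2 _).mul_const _
  have hprop : Continuous fun s => (propagator P.a (t - s) 0 (Fin.last m) : ℂ) :=
    Complex.continuous_ofReal.comp
      ((propagator_continuous P.a _ _).comp (continuous_const.sub continuous_id))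
  refine tendsto_nhds_unique (hlim φ φ' hle hev t ht htT) ?_
  simp only [fun k => green_volterra_bandlimited hTempered hGreen n ht htT (hcs k) x]
  refine ((tendsto_of_invFourier hle hev x).const_mul _).add ?_
  refine intervalIntegral.tendsto_integral_filter_of_dominated_convergence
    (fun s => ‖(propagator P.a (t - s) 0 (Fin.last m) : ℂ)‖ *
      ((‖fourierConst d‖ * ∫ ξ, ‖invFourier (adjointOp P φ) ξ‖) * mass (μ n) (γ n) s))
    (Filter.Eventually.of_forall fun k => ?_) (Filter.Eventually.of_forall fun k =>
      Filter.Eventually.of_forall fun s hs => ?_) ?_ (Filter.Eventually.of_forall fun s hs => ?_)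
  · refine (hprop.measurable.mul ?_).aestronglyMeasurable
    exact (hker.measurable_integral (𝕜 := ℂ) (W := Unit)
      (ψ := fun _ _ y => adjointOp P (φ' k) (x + y))
      ((adjointOp P (φ' k)).continuous.measurable.comp
        (measurable_const.add measurable_snd))).comp
          (measurable_prodMk_left (x := ()))
  · rw [uIoc_of_le ht] at hs
    rw [norm_mul]
    refine mul_le_mul_of_nonneg_left ?_ (norm_nonneg _)
    exact hker.norm_integral_mul_le (𝕜 := ℂ) ⟨hs.1.le, lt_of_le_of_lt (by exact_mod_cast hs.2) htT⟩
      fun y => norm_le_of_norm_invFourier_le (invFourier (adjointOp P φ)).integrable.norm (hle' k) _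
  · have : IntervalIntegrable (mass (μ n) (γ n)) volume 0 t :=
      (intervalIntegrable_iff_integrableOn_Icc_of_le ht).2 hmass
    exact (this.const_mul _).continuousOn_mul hprop.norm.continuousOn
  · rw [uIoc_of_le ht] at hs
    exact (hlim _ _ hle' hev' s hs.1.le
      (lt_of_le_of_lt (by exact_mod_cast hs.2) htT)).const_mul _

/-- The Volterra equation of the Green functions:
`g_n(t) ∗ φ = e_n(t) φ + ∫_0^t e_N(t-s) (g_n(s) ∗ b̃ φ) ds` (up to a reflection), where
`e_n = (exp(tA))_{1,n}` and `b̃` is the adjoint of the space operator. -/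
theorem green_volterra (hTempered : TemperedGreen P T₀)
    (hGreen : GreenDensities P T₀ μ γ) (n : Fin (m + 1)) {t : ℝ} (ht : 0 ≤ t)
    (htT : (t : EReal) < T₀) (hmass : IntegrableOn (mass (μ n) (γ n)) (Icc 0 t))
    (φ : 𝓢(Space d, ℝ)) (x : Space d) :
    ∫ y, φ (x + y) * γ n t y ∂(μ n t) = propagator P.a t 0 n * φ x +
      ∫ s in (0 : ℝ)..t, propagator P.a (t - s) 0 (Fin.last m) *
        ∫ y, adjointOp P φ (x + y) * γ n s y ∂(μ n s) := by
  let L : 𝓢(Space d, ℝ) →L[ℝ] 𝓢(Space d, ℂ) := SchwartzMap.postcompCLM Complex.ofRealCLM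
  have hL : ∀ ψ y, L ψ y = ((ψ y : ℝ) : ℂ) := fun ψ y => rfl
  have hadj : adjointOp P (L φ) = L (adjointOp P φ) := by
    refine (adjointOp_rel P L.toLinearMap (fun e ψ => ?_) φ).symm
    ext y
    change L (∂_{e} ψ) y = _
    rw [hL, SchwartzMap.lineDerivOp_apply_eq_fderiv, SchwartzMap.lineDerivOp_apply_eq_fderiv]
    have h1 : (⇑(L.toLinearMap ψ) : Space d → ℂ) = ⇑Complex.ofRealCLM ∘ ⇑ψ := rfl
    rw [h1, (Complex.ofRealCLM.hasFDerivAt.comp y (ψ.differentiableAt.hasFDerivAt)).fderiv]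
    rfl
  have := green_volterra_complex hTempered hGreen n ht htT hmass (L φ) x
  simp only [hadj, hL, ← Complex.ofReal_mul, integral_complex_ofReal,
    intervalIntegral.integral_ofReal, ← Complex.ofReal_add] at this
  exact_mod_cast this

end GreenVolterra

/-! ### Convolutions in time -/

section Convolution

/-- Fubini's theorem on the triangle `{r, q ≥ 0, r + q ≤ t}`, in the coordinates `(r, q)` and
`(r, r + q)`. -/
theorem integral_triangle {t : ℝ} (ht : 0 ≤ t) {k : ℝ → ℝ} (hk : Continuous k) {h : ℝ → ℝ → ℝ}
    (hh : Integrable (Function.uncurry h)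
      ((volume.restrict (Ioc 0 t)).prod (volume.restrict (Ioc 0 t)))) :
    IntervalIntegrable (fun q => ∫ r in (0 : ℝ)..(t - q), k (t - q - r) * h r q) volume 0 t ∧
    IntervalIntegrable (fun σ => k (t - σ) * ∫ r in (0 : ℝ)..σ, h r (σ - r)) volume 0 t ∧
    ∫ q in (0 : ℝ)..t, ∫ r in (0 : ℝ)..(t - q), k (t - q - r) * h r q =
      ∫ σ in (0 : ℝ)..t, k (t - σ) * ∫ r in (0 : ℝ)..σ, h r (σ - r) := by
  let D : Set (ℝ × ℝ) := {z | 0 < z.1 ∧ 0 < z.2 ∧ z.1 + z.2 ≤ t}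
  have hD : MeasurableSet D :=
    (measurableSet_lt measurable_const measurable_fst).inter
      ((measurableSet_lt measurable_const measurable_snd).inter
        (measurableSet_le (measurable_fst.add measurable_snd) measurable_const))
  let H : ℝ × ℝ → ℝ := D.indicator fun z => k (t - z.2 - z.1) * h z.1 z.2
  have hHint : Integrable H (volume.prod volume) := by
    rw [integrable_indicator_iff hD]
    have h1 : IntegrableOn (fun z : ℝ × ℝ => h z.1 z.2) D (volume.prod volume) := by
      rw [Measure.prod_restrict] at hh
      exact IntegrableOn.mono_set hh fun z hz =>
        ⟨⟨hz.1, by linarith [hz.2.1, hz.2.2]⟩, ⟨hz.2.1, by linarith [hz.1, hz.2.2]⟩⟩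
    obtain ⟨C, hC⟩ := (isCompact_Icc (a := (0 : ℝ)) (b := t)).exists_bound_of_continuousOn
      hk.continuousOn
    refine Integrable.bdd_mul h1 (c := C) ?_ ?_
    · exact (hk.comp (by fun_prop : Continuous fun z : ℝ × ℝ => t - z.2 - z.1)).aestronglyMeasurable
    · refine (ae_restrict_iff' hD).2 (Filter.Eventually.of_forall fun z hz => hC _ ?_)
      exact ⟨by linarith [hz.2.2], by linarith [hz.1, hz.2.1]⟩
  let G : ℝ × ℝ → ℝ := fun z => H (z.1, z.2 - z.1)
  let e : ℝ × ℝ ≃ᵐ ℝ × ℝ := MeasurableEquiv.shearAddRight ℝ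
  have he : MeasurePreserving e (volume.prod volume) (volume.prod volume) :=
    measurePreserving_prod_add volume volume
  have hGe : G ∘ e = H := by
    funext z
    change H (z.1, z.1 + z.2 - z.1) = H z
    rw [add_sub_cancel_left]
  have hGint : Integrable G (volume.prod volume) := by
    rw [← he.integrable_comp_emb e.measurableEmbedding, hGe]
    exact hHint
  have hGH : ∫ z, G z ∂(volume.prod volume) = ∫ z, H z ∂(volume.prod volume) := by
    rw [← he.integral_comp e.measurableEmbedding, ← hGe]
    rfl
  have hL : (fun q => ∫ r, H (r, q)) = (Ioc 0 t).indicator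
      fun q => ∫ r in (0 : ℝ)..(t - q), k (t - q - r) * h r q := by
    funext q
    by_cases hq : q ∈ Ioc 0 t
    · rw [indicator_of_mem hq, intervalIntegral.integral_of_le (by linarith [hq.2]),
        ← integral_indicator measurableSet_Ioc]
      congr 1
      funext r
      by_cases hr : r ∈ Ioc 0 (t - q)
      · rw [indicator_of_mem hr]
        exact indicator_of_mem (show (r, q) ∈ D from ⟨hr.1, hq.1, by linarith [hr.2]⟩) _
      · rw [indicator_of_notMem hr]
        exact indicator_of_notMem (fun hz : (r, q) ∈ D => hr ⟨hz.1, by linarith [hz.2.2]⟩) _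
    · rw [indicator_of_notMem hq]
      refine integral_eq_zero_of_ae (Filter.Eventually.of_forall fun r => ?_)
      exact indicator_of_notMem
        (fun hz : (r, q) ∈ D => hq ⟨hz.2.1, by linarith [hz.2.2, hz.1]⟩) _
  have hR : (fun σ => ∫ r, G (r, σ)) = (Ioc 0 t).indicator
      fun σ => k (t - σ) * ∫ r in (0 : ℝ)..σ, h r (σ - r) := by
    funext σ
    by_cases hσ : σ ∈ Ioc 0 t
    · rw [indicator_of_mem hσ, intervalIntegral.integral_of_le hσ.1.le, integral_Ioc_eq_integral_Ioo,
        ← integral_const_mul, ← integral_indicator measurableSet_Ioo]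
      congr 1
      funext r
      by_cases hr : r ∈ Ioo 0 σ
      · rw [indicator_of_mem hr]
        refine (indicator_of_mem (show (r, σ - r) ∈ D from
          ⟨hr.1, sub_pos.2 hr.2, by linarith [hσ.2]⟩) _).trans ?_
        simp only
        rw [show t - (σ - r) - r = t - σ by ring]
      · rw [indicator_of_notMem hr]
        exact indicator_of_notMem
          (fun hz : (r, σ - r) ∈ D => hr ⟨hz.1, sub_pos.1 hz.2.1⟩) _
    · rw [indicator_of_notMem hσ]
      refine integral_eq_zero_of_ae (Filter.Eventually.of_forall fun r => ?_)
      refine indicator_of_notMem (fun hz : (r, σ - r) ∈ D => hσ ?_) _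
      obtain ⟨h1, h2, h3⟩ := hz
      simp only at h1 h2 h3
      exact ⟨by linarith, by linarith⟩
  refine ⟨?_, ?_, ?_⟩
  · rw [intervalIntegrable_iff_integrableOn_Ioc_of_le ht, ← integrable_indicator_iff
      measurableSet_Ioc, ← hL]
    exact hHint.integral_prod_right
  · rw [intervalIntegrable_iff_integrableOn_Ioc_of_le ht, ← integrable_indicator_iff
      measurableSet_Ioc, ← hR]
    exact hGint.integral_prod_right
  · rw [intervalIntegral.integral_of_le ht, intervalIntegral.integral_of_le ht,
      ← integral_indicator measurableSet_Ioc, ← integral_indicator measurableSet_Ioc, ← hL, ← hR,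
      ← integral_prod_symm _ hHint, ← integral_prod_symm _ hGint, hGH]

/-! ### Convolutions with a signed kernel and their pairing with Schwartz functions -/

/-- `(γ(s,·)μ(s,·) ∗ f)(x)`. -/
def greenConv (μ : Kernel ℝ (Space d)) (γ : ℝ → Space d → ℝ) (s : ℝ) (f : Space d → ℝ)
    (x : Space d) : ℝ := ∫ y, f (x - y) * γ s y ∂(μ s)

/-- The adjoint of the convolution with `γ(s,·)μ(s,·)`, applied to `φ`. -/
def greenTest (μ : Kernel ℝ (Space d)) (γ : ℝ → Space d → ℝ) (s : ℝ) (φ : Space d → ℝ)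
    (x : Space d) : ℝ := ∫ y, φ (x + y) * γ s y ∂(μ s)

/-- The `L¹`-norm of a Schwartz function. -/
def normOne (φ : 𝓢(Space d, ℝ)) : ℝ := ∫ x, |φ x|

theorem abs_pairing_le {v : Space d → ℝ} {C : ℝ} (hC : ∀ x, |v x| ≤ C) (φ : 𝓢(Space d, ℝ)) :
    |pairing v φ| ≤ C * normOne φ := by
  rw [pairing, normOne, ← integral_const_mul, ← Real.norm_eq_abs]
  refine norm_integral_le_of_norm_le (φ.integrable.abs.const_mul C)
    (Filter.Eventually.of_forall fun x => ?_)
  rw [norm_mul]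
  exact mul_le_mul_of_nonneg_right (hC x) (norm_nonneg _)

theorem integrable_pairing {v : Space d → ℝ} (hv : Measurable v) {C : ℝ} (hC : ∀ x, |v x| ≤ C)
    (φ : 𝓢(Space d, ℝ)) : Integrable fun x => v x * φ x :=
  φ.integrable.bdd_mul hv.aestronglyMeasurable (Filter.Eventually.of_forall hC)

theorem pairing_add {v w : Space d → ℝ} (φ : 𝓢(Space d, ℝ)) (hv : Integrable fun x => v x * φ x)
    (hw : Integrable fun x => w x * φ x) :
    pairing (fun x => v x + w x) φ = pairing v φ + pairing w φ := by
  simp only [pairing, add_mul]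
  exact integral_add hv hw

theorem pairing_sub {v w : Space d → ℝ} (φ : 𝓢(Space d, ℝ)) (hv : Integrable fun x => v x * φ x)
    (hw : Integrable fun x => w x * φ x) :
    pairing (fun x => v x - w x) φ = pairing v φ - pairing w φ := by
  simp only [pairing, sub_mul]
  exact integral_sub hv hw

theorem pairing_const_mul (c : ℝ) (v : Space d → ℝ) (φ : 𝓢(Space d, ℝ)) :
    pairing (fun x => c * v x) φ = c * pairing v φ := by
  simp only [pairing, mul_assoc]
  exact integral_const_mul _ _

theorem pairing_sum {ι : Type*} (s : Finset ι) {v : ι → Space d → ℝ} (φ : 𝓢(Space d, ℝ))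
    (hv : ∀ i ∈ s, Integrable fun x => v i x * φ x) :
    pairing (fun x => ∑ i ∈ s, v i x) φ = ∑ i ∈ s, pairing (v i) φ := by
  simp only [pairing, Finset.sum_mul]
  exact integral_finsetSum s hv

/-- `φ(· + y)`. -/
def shiftTest (y : Space d) (φ : 𝓢(Space d, ℝ)) : 𝓢(Space d, ℝ) :=
  SchwartzMap.compSubConstCLM ℝ (-y) φ

theorem shiftTest_apply (y : Space d) (φ : 𝓢(Space d, ℝ)) (x : Space d) :
    shiftTest y φ x = φ (x + y) := by
  simp [shiftTest]

theorem normOne_shiftTest (y : Space d) (φ : 𝓢(Space d, ℝ)) :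
    normOne (shiftTest y φ) = normOne φ := by
  simp only [normOne, shiftTest_apply]
  exact integral_add_right_eq_self (fun x => |φ x|) y

theorem adjointOp_shiftTest (P : Problem m d) (y : Space d) (φ : 𝓢(Space d, ℝ)) :
    adjointOp P (shiftTest y φ) = shiftTest y (adjointOp P φ) := by
  refine (adjointOp_rel P (SchwartzMap.compSubConstCLM ℝ (-y)).toLinearMap (fun e ψ => ?_) φ).symm
  ext x
  have h2 : (∂_{e} ((SchwartzMap.compSubConstCLM ℝ (-y)).toLinearMap ψ)) x =
      (∂_{e} (shiftTest y ψ)) x := rfl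
  have h3 : ((SchwartzMap.compSubConstCLM ℝ (-y)).toLinearMap (∂_{e} ψ)) x =
      shiftTest y (∂_{e} ψ) x := rfl
  have h1 : (⇑(shiftTest y ψ) : Space d → ℝ) = fun z => ψ (z + y) := funext (shiftTest_apply y ψ)
  rw [h2, h3, shiftTest_apply, SchwartzMap.lineDerivOp_apply_eq_fderiv,
    SchwartzMap.lineDerivOp_apply_eq_fderiv, h1, fderiv_comp_add_right]

namespace IsSignedKernel

variable {S : Set ℝ} {μ : Kernel ℝ (Space d)} {γ : ℝ → Space d → ℝ} (h : IsSignedKernel S μ γ)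
include h

theorem integrable_test_prod {s : ℝ} (hs : s ∈ S) (φ : 𝓢(Space d, ℝ)) :
    Integrable (fun z : Space d × Space d => φ (z.1 + z.2) * γ s z.2) (volume.prod (μ s)) := by
  have := h.markov
  have hm : Measurable fun z : Space d × Space d => φ (z.1 + z.2) * γ s z.2 :=
    (φ.continuous.measurable.comp (measurable_fst.add measurable_snd)).mul
      ((h.measurable_slice s).comp measurable_snd)
  rw [integrable_prod_iff' hm.aestronglyMeasurable]
  refine ⟨Filter.Eventually.of_forall fun y => (φ.integrable.comp_add_right y).mul_const (γ s y), ?_⟩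
  have : (fun y => ∫ x, ‖φ (x + y) * γ s y‖) = fun y => normOne φ * |γ s y| := by
    funext y
    simp only [norm_mul, Real.norm_eq_abs]
    rw [integral_mul_const, integral_add_right_eq_self (fun x => |φ x|) y]
    rfl
  rw [this]
  exact (h.integrable hs).abs.const_mul _

theorem integrable_mul_test_prod {s : ℝ} (hs : s ∈ S) (φ : 𝓢(Space d, ℝ)) {f : Space d → ℝ}
    (hf : Measurable f) {C : ℝ} (hC : ∀ x, |f x| ≤ C) :
    Integrable (fun z : Space d × Space d => f z.1 * (φ (z.1 + z.2) * γ s z.2))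
      (volume.prod (μ s)) :=
  (h.integrable_test_prod hs φ).bdd_mul (hf.comp measurable_fst).aestronglyMeasurable
    (Filter.Eventually.of_forall fun z => hC z.1)

theorem integrable_greenTest {s : ℝ} (hs : s ∈ S) (φ : 𝓢(Space d, ℝ)) :
    Integrable (greenTest μ γ s φ) :=
  have := h.markov
  (h.integrable_test_prod hs φ).integral_prod_left

theorem integral_abs_greenTest_le {s : ℝ} (hs : s ∈ S) (φ : 𝓢(Space d, ℝ)) :
    ∫ x, |greenTest μ γ s φ x| ≤ normOne φ * mass μ γ s := by
  have := h.markov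
  have h1 := (h.integrable_test_prod hs φ).norm
  calc ∫ x, |greenTest μ γ s φ x| ≤ ∫ x, ∫ y, ‖φ (x + y) * γ s y‖ ∂(μ s) :=
        integral_mono (h.integrable_greenTest hs φ).abs h1.integral_prod_left
          fun x => norm_integral_le_integral_norm (fun y => φ (x + y) * γ s y)
    _ = ∫ y, ∫ x, ‖φ (x + y) * γ s y‖ ∂volume ∂(μ s) := integral_integral_swap h1
    _ = ∫ y, normOne φ * |γ s y| ∂(μ s) := by
        congr 1
        funext y
        simp only [norm_mul, Real.norm_eq_abs]
        rw [integral_mul_const, integral_add_right_eq_self (fun x => |φ x|) y]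
        rfl
    _ = normOne φ * mass μ γ s := integral_const_mul _ _

theorem abs_greenConv_le {s : ℝ} (hs : s ∈ S) {f : Space d → ℝ} {C : ℝ} (hC : ∀ x, |f x| ≤ C)
    (x : Space d) : |greenConv μ γ s f x| ≤ C * mass μ γ s :=
  h.norm_integral_mul_le (𝕜 := ℝ) hs fun y => hC (x - y)

/-- The translation in the convolution is moved to the test function. -/
theorem pairing_greenConv' {s : ℝ} (hs : s ∈ S) {f : Space d → ℝ} (hf : Measurable f)
    {C : ℝ} (hC : ∀ x, |f x| ≤ C) (φ : 𝓢(Space d, ℝ)) :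
    pairing (greenConv μ γ s f) φ = ∫ y, pairing f (shiftTest y φ) * γ s y ∂(μ s) := by
  have := h.markov
  have hint : Integrable (Function.uncurry fun x y : Space d => f (x - y) * (φ x * γ s y))
      (volume.prod (μ s)) :=
    (φ.integrable.mul_prod (h.integrable hs)).bdd_mul
      (hf.comp (measurable_fst.sub measurable_snd)).aestronglyMeasurable
      (Filter.Eventually.of_forall fun z => hC (z.1 - z.2))
  calc pairing (greenConv μ γ s f) φ = ∫ x, ∫ y, f (x - y) * (φ x * γ s y) ∂(μ s) := by
        refine integral_congr_ae (Filter.Eventually.of_forall fun x => ?_)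
        simp only [greenConv]
        rw [← integral_mul_const]
        refine integral_congr_ae (Filter.Eventually.of_forall fun y => ?_)
        simp only
        ring
    _ = ∫ y, ∫ x, f (x - y) * (φ x * γ s y) ∂volume ∂(μ s) := integral_integral_swap hint
    _ = _ := by
        refine integral_congr_ae (Filter.Eventually.of_forall fun y => ?_)
        simp only [pairing, shiftTest_apply]
        rw [← integral_mul_const, ← integral_sub_right_eq_self
          (fun x => f x * φ (x + y) * γ s y) y]
        simp only [sub_add_cancel, mul_assoc]

/-- The convolution with the kernel is moved to the test function. -/
theorem pairing_greenConv {s : ℝ} (hs : s ∈ S) {f : Space d → ℝ} (hf : Measurable f)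
    {C : ℝ} (hC : ∀ x, |f x| ≤ C) (φ : 𝓢(Space d, ℝ)) :
    pairing (greenConv μ γ s f) φ = ∫ x, f x * greenTest μ γ s φ x := by
  have := h.markov
  rw [h.pairing_greenConv' hs hf hC]
  have h1 := integral_integral_swap (f := fun x y : Space d => f x * (φ (x + y) * γ s y))
    (h.integrable_mul_test_prod hs φ hf hC)
  simp only [integral_const_mul] at h1
  rw [show (∫ x, f x * greenTest μ γ s φ x) = ∫ x, f x * ∫ y, φ (x + y) * γ s y ∂(μ s) from rfl, h1]
  refine integral_congr_ae (Filter.Eventually.of_forall fun y => ?_)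
  simp only [pairing, shiftTest_apply]
  rw [← integral_mul_const]
  simp only [mul_assoc]

theorem abs_pairing_greenConv_le {s : ℝ} (hs : s ∈ S) {f : Space d → ℝ} {C : ℝ}
    (hC : ∀ x, |f x| ≤ C) (φ : 𝓢(Space d, ℝ)) :
    |pairing (greenConv μ γ s f) φ| ≤ C * mass μ γ s * normOne φ :=
  abs_pairing_le (h.abs_greenConv_le hs hC) φ

/-- Joint measurability of the convolution for functions depending on a parameter. -/
theorem measurable_greenConv {W : Type*} [MeasurableSpace W] {F : W → Space d → ℝ}
    (hF : Measurable (Function.uncurry F)) :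
    Measurable fun p : (W × Space d) × ℝ => greenConv μ γ p.2 (F p.1.1) p.1.2 :=
  h.measurable_integral (𝕜 := ℝ) (W := W × Space d) (ψ := fun w _ y => F w.1 (w.2 - y))
    (hF.comp ((measurable_fst.comp (measurable_fst.comp measurable_fst)).prodMk
      ((measurable_snd.comp (measurable_fst.comp measurable_fst)).sub measurable_snd)))

theorem measurable_greenConv_slice {f : Space d → ℝ} (hf : Measurable f) (s : ℝ) :
    Measurable (greenConv μ γ s f) :=
  (h.measurable_greenConv (W := Unit) (F := fun _ => f) (hf.comp measurable_snd)).comp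
    ((measurable_prodMk_left (x := ())).prodMk measurable_const)

theorem measurable_pairing_greenConv {W : Type*} [MeasurableSpace W] {F : W → Space d → ℝ}
    (hF : Measurable (Function.uncurry F)) (φ : 𝓢(Space d, ℝ)) :
    Measurable fun p : ℝ × W => pairing (greenConv μ γ p.1 (F p.2)) φ := by
  have h1 : Measurable fun q : (ℝ × W) × Space d =>
      greenConv μ γ q.1.1 (F q.1.2) q.2 * φ q.2 := by
    refine Measurable.mul ?_ (φ.continuous.measurable.comp measurable_snd)
    exact (h.measurable_greenConv hF).comp
      (((measurable_snd.comp measurable_fst).prodMk measurable_snd).prodMk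
        (measurable_fst.comp measurable_fst))
  exact (h1.stronglyMeasurable.integral_prod_right' (ν := (volume : Measure (Space d)))).measurable

end IsSignedKernel

variable {P : Problem m d} {T₀ : EReal} {μ : Fin (m + 1) → Kernel ℝ (Space d)}
  {γ : Fin (m + 1) → ℝ → Space d → ℝ}

/-- The Volterra equation for `⟨g_n(t) ∗ f, φ⟩`. -/
theorem pairing_greenConv_volterra (hTempered : TemperedGreen P T₀)
    (hGreen : GreenDensities P T₀ μ γ) (n : Fin (m + 1)) {t : ℝ} (ht : 0 ≤ t)
    (htT : (t : EReal) < T₀) (hmass : IntegrableOn (mass (μ n) (γ n)) (Icc 0 t))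
    {f : Space d → ℝ} (hf : Measurable f) {C : ℝ} (hC : ∀ x, |f x| ≤ C)
    (φ : 𝓢(Space d, ℝ)) :
    pairing (greenConv (μ n) (γ n) t f) φ = propagator P.a t 0 n * pairing f φ +
      ∫ s in (0 : ℝ)..t, propagator P.a (t - s) 0 (Fin.last m) *
        pairing (greenConv (μ n) (γ n) s f) (adjointOp P φ) := by
  have hker := hGreen.isSignedKernel n
  have hC0 : 0 ≤ C := (abs_nonneg _).trans (hC 0)
  have hmem : ∀ s ∈ Ioc 0 t, s ∈ {t : ℝ | 0 ≤ t ∧ (t : EReal) < T₀} := fun s hs =>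
    ⟨hs.1.le, lt_of_le_of_lt (by exact_mod_cast hs.2) htT⟩
  set E : ℝ → ℝ := fun s => propagator P.a (t - s) 0 (Fin.last m) with hE
  have hEc : Continuous E := (propagator_continuous P.a _ _).comp (continuous_const.sub continuous_id)
  set ψ := adjointOp P φ
  -- integrability on `(0,t] × ℝ^d`
  have htestm : Measurable fun z : ℝ × Space d => greenTest (μ n) (γ n) z.1 ψ z.2 := by
    refine (hker.measurable_integral (𝕜 := ℝ) (W := Space d) (ψ := fun x _ y => ψ (x + y)) ?_).comp
      (measurable_snd.prodMk measurable_fst)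
    exact ψ.continuous.measurable.comp
      ((measurable_fst.comp measurable_fst).add measurable_snd)
  have hint : Integrable (Function.uncurry fun (s : ℝ) (x : Space d) =>
      E s * (f x * greenTest (μ n) (γ n) s ψ x)) ((volume.restrict (Ioc 0 t)).prod volume) := by
    have hm : Measurable (Function.uncurry fun (s : ℝ) (x : Space d) =>
        E s * (f x * greenTest (μ n) (γ n) s ψ x)) :=
      (hEc.measurable.comp measurable_fst).mul ((hf.comp measurable_snd).mul htestm)
    rw [integrable_prod_iff hm.aestronglyMeasurable]
    have hbint : ∀ s ∈ Ioc 0 t, Integrable fun x => f x * greenTest (μ n) (γ n) s ψ x :=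
      fun s hs => (hker.integrable_greenTest (hmem s hs) ψ).bdd_mul hf.aestronglyMeasurable
        (Filter.Eventually.of_forall hC)
    refine ⟨(ae_restrict_iff' measurableSet_Ioc).2 (Filter.Eventually.of_forall fun s hs =>
      (hbint s hs).const_mul (E s)), ?_⟩
    have hbound : IntegrableOn (fun s => |E s| * (C * normOne ψ * mass (μ n) (γ n) s)) (Ioc 0 t) := by
      have h1 : IntegrableOn (mass (μ n) (γ n)) (Icc 0 t) := hmass
      have h2 := IntegrableOn.continuousOn_mul (hEc.abs.continuousOn (s := Icc 0 t))
        (h1.const_mul (C * normOne ψ)) isCompact_Icc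
      exact h2.mono_set Ioc_subset_Icc_self
    refine Integrable.mono' hbound ?_ ((ae_restrict_iff' measurableSet_Ioc).2
      (Filter.Eventually.of_forall fun s hs => ?_))
    · exact (hm.norm.stronglyMeasurable.integral_prod_right'
        (ν := (volume : Measure (Space d)))).aestronglyMeasurable
    · rw [Real.norm_of_nonneg (integral_nonneg fun _ => norm_nonneg _)]
      simp only [Function.uncurry_apply_pair, norm_mul, Real.norm_eq_abs]
      rw [integral_const_mul]
      refine mul_le_mul_of_nonneg_left ?_ (abs_nonneg _)
      calc ∫ x, |f x| * |greenTest (μ n) (γ n) s ψ x|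
          ≤ ∫ x, C * |greenTest (μ n) (γ n) s ψ x| := by
            refine integral_mono ?_ ((hker.integrable_greenTest (hmem s hs) ψ).abs.const_mul C)
              fun x => mul_le_mul_of_nonneg_right (hC x) (abs_nonneg _)
            have := (hbint s hs).abs
            simpa only [abs_mul] using this
        _ = C * ∫ x, |greenTest (μ n) (γ n) s ψ x| := integral_const_mul _ _
        _ ≤ C * (normOne ψ * mass (μ n) (γ n) s) :=
            mul_le_mul_of_nonneg_left (hker.integral_abs_greenTest_le (hmem s hs) ψ) hC0
        _ = C * normOne ψ * mass (μ n) (γ n) s := by ring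
  have hright : ∀ s ∈ uIoc 0 t, E s * pairing (greenConv (μ n) (γ n) s f) ψ =
      ∫ x, E s * (f x * greenTest (μ n) (γ n) s ψ x) := by
    intro s hs
    rw [uIoc_of_le ht] at hs
    rw [hker.pairing_greenConv (hmem s hs) hf hC, integral_const_mul]
  rw [intervalIntegral.integral_congr_ae (Filter.Eventually.of_forall hright),
    intervalIntegral.integral_of_le ht, integral_integral_swap hint,
    hker.pairing_greenConv ⟨ht, htT⟩ hf hC]
  have hsplit : ∀ x, f x * greenTest (μ n) (γ n) t φ x =
      propagator P.a t 0 n * (f x * φ x) +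
        ∫ s in Ioc 0 t, E s * (f x * greenTest (μ n) (γ n) s ψ x) := by
    intro x
    have := green_volterra hTempered hGreen n ht htT hmass φ x
    rw [intervalIntegral.integral_of_le ht] at this
    rw [greenTest, this, mul_add, ← integral_const_mul]
    congr 1
    · ring
    · refine integral_congr_ae (Filter.Eventually.of_forall fun s => ?_)
      simp only [hE, greenTest, ψ]
      ring
  simp only [hsplit]
  have hint' : Integrable fun x => ∫ s in Ioc 0 t, E s * (f x * greenTest (μ n) (γ n) s ψ x) :=
    hint.integral_prod_right
  rw [integral_add ((integrable_pairing hf hC φ).const_mul _) hint', integral_const_mul]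
  rfl

end Convolution

/-! ### Mild solutions of the linear problem -/

section MildSolution

/-- A function which is continuous on `𝕀 × ℝ^d` and bounded on `[0,b] × ℝ^d` is extended from
`[0,b]` to all times, constantly on both sides. -/
theorem IsBoundedContinuousOn.exists_extension {𝕀 : Set ℝ} (h𝕀 : IsTimeInterval 𝕀)
    {F : ℝ → Space d → ℝ} (hF : ContinuousOn (Function.uncurry F) (𝕀 ×ˢ univ)) {b C : ℝ}
    (hb : b ∈ 𝕀) (hC : ∀ t ∈ Icc 0 b, ∀ x, |F t x| ≤ C) :
    ∃ F' : ℝ → Space d → ℝ, Continuous (Function.uncurry F') ∧ (∀ t x, |F' t x| ≤ C) ∧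
      ∀ t ∈ Icc 0 b, F' t = F t := by
  have h0b := h𝕀.nonneg b hb
  refine ⟨fun t => F (projIcc 0 b h0b t), ?_, fun t x => hC _ (projIcc 0 b h0b t).2 x,
    fun t ht => by simp [projIcc_of_mem h0b ht]⟩
  have h1 : Continuous fun z : ℝ × Space d => ((projIcc 0 b h0b z.1 : ℝ), z.2) :=
    (continuous_subtype_val.comp (continuous_projIcc.comp continuous_fst)).prodMk continuous_snd
  exact hF.comp_continuous h1 fun z => ⟨h𝕀.Icc_subset hb (projIcc 0 b h0b z.1).2, mem_univ _⟩

/-- The convolution in time and space `∫_0^t g(s) ∗ F(t-s) ds`. -/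
def sourceConv (μ : Kernel ℝ (Space d)) (γ : ℝ → Space d → ℝ) (F : ℝ → Space d → ℝ) (t : ℝ)
    (x : Space d) : ℝ := ∫ s in (0 : ℝ)..t, greenConv μ γ s (F (t - s)) x

theorem sourceConv_congr {μ : Kernel ℝ (Space d)} {γ : ℝ → Space d → ℝ} {F F' : ℝ → Space d → ℝ}
    {t : ℝ} (ht : 0 ≤ t) (hFF' : ∀ s ∈ Icc 0 t, F s = F' s) (x : Space d) :
    sourceConv μ γ F t x = sourceConv μ γ F' t x := by
  refine intervalIntegral.integral_congr fun s hs => ?_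
  rw [uIcc_of_le ht] at hs
  simp only [greenConv]
  rw [hFF' (t - s) ⟨by linarith [hs.2], by linarith [hs.1]⟩]

namespace IsSignedKernel

variable {S : Set ℝ} {μ : Kernel ℝ (Space d)} {γ : ℝ → Space d → ℝ} (h : IsSignedKernel S μ γ)
include h

theorem measurable_sourceConv_integrand {F : ℝ → Space d → ℝ}
    (hF : Measurable (Function.uncurry F)) (t : ℝ) :
    Measurable fun p : ℝ × Space d => greenConv μ γ p.1 (F (t - p.1)) p.2 :=
  (h.measurable_greenConv hF).comp
    (((measurable_const.sub measurable_fst).prodMk measurable_snd).prodMk measurable_fst)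

theorem integrable_sourceConv_prod {F : ℝ → Space d → ℝ} (hF : Measurable (Function.uncurry F))
    {C : ℝ} (hC : ∀ t x, |F t x| ≤ C) {t : ℝ} (hS : Icc 0 t ⊆ S)
    (hmass : IntegrableOn (mass μ γ) (Icc 0 t)) (φ : 𝓢(Space d, ℝ)) :
    Integrable (Function.uncurry fun (s : ℝ) (x : Space d) =>
      greenConv μ γ s (F (t - s)) x * φ x) ((volume.restrict (Ioc 0 t)).prod volume) := by
  have h1 : Integrable (fun p : ℝ × Space d => C * mass μ γ p.1 * φ p.2)
      ((volume.restrict (Ioc 0 t)).prod volume) :=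
    Integrable.mul_prod (f := fun s => C * mass μ γ s)
      ((hmass.mono_set Ioc_subset_Icc_self).const_mul C) φ.integrable
  refine h1.norm.mono' ((h.measurable_sourceConv_integrand hF t).mul
    (φ.continuous.measurable.comp measurable_snd)).aestronglyMeasurable ?_
  have hae : ∀ᵐ p ∂((volume.restrict (Ioc 0 t)).prod (volume : Measure (Space d))),
      p.1 ∈ Ioc 0 t :=
    (Measure.quasiMeasurePreserving_fst (μ := volume.restrict (Ioc 0 t))
      (ν := (volume : Measure (Space d)))).ae (ae_restrict_mem measurableSet_Ioc)
  filter_upwards [hae] with p hp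
  simp only [Function.uncurry, norm_mul, Real.norm_eq_abs]
  refine mul_le_mul_of_nonneg_right ?_ (abs_nonneg _)
  rw [← abs_mul]
  exact (h.abs_greenConv_le (hS (Ioc_subset_Icc_self hp)) (hC _) _).trans (le_abs_self _)

theorem pairing_sourceConv {F : ℝ → Space d → ℝ} (hF : Measurable (Function.uncurry F))
    {C : ℝ} (hC : ∀ t x, |F t x| ≤ C) {t : ℝ} (ht : 0 ≤ t) (hS : Icc 0 t ⊆ S)
    (hmass : IntegrableOn (mass μ γ) (Icc 0 t)) (φ : 𝓢(Space d, ℝ)) :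
    pairing (sourceConv μ γ F t) φ =
      ∫ s in (0 : ℝ)..t, pairing (greenConv μ γ s (F (t - s))) φ := by
  rw [intervalIntegral.integral_of_le ht]
  simp only [pairing]
  rw [integral_integral_swap (h.integrable_sourceConv_prod hF hC hS hmass φ)]
  refine integral_congr_ae (Filter.Eventually.of_forall fun x => ?_)
  simp only [sourceConv]
  rw [intervalIntegral.integral_of_le ht, integral_mul_const]

theorem integrable_sourceConv_mul {F : ℝ → Space d → ℝ} (hF : Measurable (Function.uncurry F))
    {C : ℝ} (hC : ∀ t x, |F t x| ≤ C) {t : ℝ} (ht : 0 ≤ t) (hS : Icc 0 t ⊆ S)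
    (hmass : IntegrableOn (mass μ γ) (Icc 0 t)) (φ : 𝓢(Space d, ℝ)) :
    Integrable fun x => sourceConv μ γ F t x * φ x := by
  have := (h.integrable_sourceConv_prod hF hC hS hmass φ).integral_prod_right
  refine this.congr (Filter.Eventually.of_forall fun x => ?_)
  simp only [Function.uncurry, sourceConv]
  rw [intervalIntegral.integral_of_le ht, integral_mul_const]

theorem abs_sourceConv_le {F : ℝ → Space d → ℝ} {t : ℝ} (ht : 0 ≤ t) (hS : Icc 0 t ⊆ S)
    (hmass : IntegrableOn (mass μ γ) (Icc 0 t)) {C : ℝ}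
    (hC : ∀ s ∈ Icc 0 t, ∀ x, |F s x| ≤ C) (x : Space d) :
    |sourceConv μ γ F t x| ≤ ∫ s in (0 : ℝ)..t, C * mass μ γ s := by
  have hi : IntervalIntegrable (mass μ γ) volume 0 t :=
    (intervalIntegrable_iff_integrableOn_Icc_of_le ht).2 hmass
  rw [← Real.norm_eq_abs]
  refine intervalIntegral.norm_integral_le_of_norm_le ht
    (Filter.Eventually.of_forall fun s hs => ?_) (hi.const_mul C)
  exact h.abs_greenConv_le (hS (Ioc_subset_Icc_self hs))
    (hC _ ⟨by linarith [hs.2], by linarith [hs.1]⟩) x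

theorem continuous_greenConv {F : ℝ → Space d → ℝ} (hF : Continuous (Function.uncurry F))
    {C : ℝ} (hC : ∀ t x, |F t x| ≤ C) {s : ℝ} (hs : s ∈ S) :
    Continuous fun z : ℝ × Space d => greenConv μ γ s (F (z.1 - s)) z.2 := by
  refine continuous_of_dominated (bound := fun y => C * |γ s y|) (fun z => ?_)
    (fun z => Filter.Eventually.of_forall fun y => ?_) ((h.integrable hs).abs.const_mul C)
    (Filter.Eventually.of_forall fun y => ?_)
  · refine (Measurable.mul ?_ (h.measurable_slice s)).aestronglyMeasurable
    exact hF.measurable.comp (measurable_const.prodMk (measurable_const.sub measurable_id))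
  · rw [norm_mul]
    exact mul_le_mul_of_nonneg_right (hC _ _) (norm_nonneg _)
  · exact (hF.comp ((continuous_fst.sub continuous_const).prodMk
      (continuous_snd.sub continuous_const))).mul continuous_const

theorem continuousOn_sourceConv {F : ℝ → Space d → ℝ} (hF : Continuous (Function.uncurry F))
    {C : ℝ} (hC : ∀ t x, |F t x| ≤ C) {b : ℝ} (hS : Icc 0 b ⊆ S)
    (hmass : IntegrableOn (mass μ γ) (Icc 0 b)) :
    ContinuousOn (Function.uncurry (sourceConv μ γ F)) (Icc 0 b ×ˢ univ) := by
  have hC0 : 0 ≤ C := (abs_nonneg _).trans (hC 0 0)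
  have hcont : ContinuousOn (fun z : ℝ × Space d => ∫ s in Icc 0 b,
      (Ioc 0 z.1).indicator (fun s => greenConv μ γ s (F (z.1 - s)) z.2) s) (Icc 0 b ×ˢ univ) := by
    intro z₀ hz₀
    refine continuousWithinAt_of_dominated (bound := fun s => C * mass μ γ s)
      (Filter.Eventually.of_forall fun z => ?_) (Filter.Eventually.of_forall fun z => ?_)
      (hmass.const_mul C) ?_
    · refine (Measurable.indicator ?_ measurableSet_Ioc).aestronglyMeasurable
      exact (h.measurable_sourceConv_integrand hF.measurable z.1).comp
        (measurable_id.prodMk measurable_const)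
    · refine (ae_restrict_iff' measurableSet_Icc).2 (Filter.Eventually.of_forall fun s hs => ?_)
      by_cases hsz : s ∈ Ioc 0 z.1
      · rw [indicator_of_mem hsz]
        exact h.abs_greenConv_le (hS hs) (hC _) _
      · rw [indicator_of_notMem hsz, norm_zero]
        exact mul_nonneg hC0 (mass_nonneg _ _ _)
    · -- off the diagonal `s = t` the indicator is locally constant in `t`
      have hne : ∀ᵐ s ∂(volume.restrict (Icc 0 b)), s ≠ z₀.1 ∧ s ∈ Icc 0 b :=
        ((ae_restrict_of_ae (Measure.ae_ne volume z₀.1)).and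
          (ae_restrict_mem measurableSet_Icc))
      filter_upwards [hne] with s ⟨hs, hsb⟩
      rcases lt_or_gt_of_ne hs with hlt | hgt
      · rcases hsb.1.eq_or_lt with h0 | h0
        · refine (continuousWithinAt_const (b := (0 : ℝ))).congr (fun z _ => ?_) ?_ <;>
          exact indicator_of_notMem (fun hh => hh.1.ne h0) _
        · refine ((h.continuous_greenConv hF hC (hS hsb)).continuousWithinAt).congr_of_eventuallyEq
            ?_ (indicator_of_mem (show s ∈ Ioc 0 z₀.1 from ⟨h0, hlt.le⟩) _)
          have : ∀ᶠ z : ℝ × Space d in 𝓝 z₀, s < z.1 :=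
            continuous_fst.continuousAt.eventually (lt_mem_nhds hlt)
          filter_upwards [mem_nhdsWithin_of_mem_nhds this] with z hz
          exact indicator_of_mem (show s ∈ Ioc 0 z.1 from ⟨h0, le_of_lt hz⟩) _
      · refine (continuousWithinAt_const (b := (0 : ℝ))).congr_of_eventuallyEq
            ?_ (indicator_of_notMem (fun hh => (not_le.2 hgt) hh.2) _)
        have : ∀ᶠ z : ℝ × Space d in 𝓝 z₀, z.1 < s :=
            continuous_fst.continuousAt.eventually (gt_mem_nhds hgt)
        filter_upwards [mem_nhdsWithin_of_mem_nhds this] with z hz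
        exact indicator_of_notMem (fun hh => (not_le.2 hz) hh.2) _
  refine hcont.congr fun z hz => ?_
  simp only [Function.uncurry, sourceConv]
  rw [intervalIntegral.integral_of_le hz.1.1, setIntegral_indicator measurableSet_Ioc,
    inter_eq_right.2 (show Ioc 0 z.1 ⊆ Icc 0 b from
      fun s hs => ⟨hs.1.le, hs.2.trans hz.1.2⟩)]

end IsSignedKernel

variable {P : Problem m d} {T₀ : EReal} {μ : Fin (m + 1) → Kernel ℝ (Space d)}
  {γ : Fin (m + 1) → ℝ → Space d → ℝ}

/-- The mild solution `∑_n p_n g_n(t) ∗ f_n + ∫_0^t g_N(s) ∗ F(t-s) ds`. -/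
def mild (P : Problem m d) (μ : Fin (m + 1) → Kernel ℝ (Space d))
    (γ : Fin (m + 1) → ℝ → Space d → ℝ) (F : ℝ → Space d → ℝ) (t : ℝ) (x : Space d) : ℝ :=
  ∑ n, P.p n * greenConv (μ n) (γ n) t (P.f n) x +
    sourceConv (μ (Fin.last m)) (γ (Fin.last m)) F t x

/-- The masses of the Green functions acting on nonzero initial values are integrable in time. For
`f_n = 0`, the convention `0 · ∞ = 0` in `r₁` leaves the mass of `g_n` without any bound. -/
def InitialMassIntegrable (P : Problem m d) (μ : Fin (m + 1) → Kernel ℝ (Space d))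
    (γ : Fin (m + 1) → ℝ → Space d → ℝ) (t : ℝ) : Prop :=
  ∀ n, P.f n ≠ 0 → IntegrableOn (mass (μ n) (γ n)) (Icc 0 t)

theorem greenConv_zero (μ : Kernel ℝ (Space d)) (γ : ℝ → Space d → ℝ) (s : ℝ) :
    greenConv μ γ s 0 = 0 := by
  funext x
  simp [greenConv]

theorem pairing_zero (φ : 𝓢(Space d, ℝ)) : pairing 0 φ = 0 := by simp [pairing]

theorem abs_bcf_le (f : Space d →ᵇ ℝ) (x : Space d) : |f x| ≤ ‖f‖ := f.norm_coe_le_norm x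

theorem Icc_subset_times {t : ℝ} (htT : (t : EReal) < T₀) :
    Icc 0 t ⊆ {t : ℝ | 0 ≤ t ∧ (t : EReal) < T₀} := fun _ hs =>
  ⟨hs.1, lt_of_le_of_lt (by exact_mod_cast hs.2) htT⟩

theorem pairing_mild (hGreen : GreenDensities P T₀ μ γ) {F : ℝ → Space d → ℝ}
    (hF : Measurable (Function.uncurry F)) {C : ℝ} (hC : ∀ t x, |F t x| ≤ C) {t : ℝ} (ht : 0 ≤ t)
    (htT : (t : EReal) < T₀) (φ : 𝓢(Space d, ℝ)) :
    pairing (mild P μ γ F t) φ = ∑ n, P.p n * pairing (greenConv (μ n) (γ n) t (P.f n)) φ +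
      ∫ s in (0 : ℝ)..t,
        pairing (greenConv (μ (Fin.last m)) (γ (Fin.last m)) s (F (t - s))) φ := by
  have hker := hGreen.isSignedKernel
  have hconv : ∀ n, Integrable fun x => greenConv (μ n) (γ n) t (P.f n) x * φ x := fun n =>
    integrable_pairing ((hker n).measurable_greenConv_slice (P.f n).continuous.measurable t)
      ((hker n).abs_greenConv_le ⟨ht, htT⟩ (abs_bcf_le (P.f n))) φ
  have hconv' : ∀ n ∈ Finset.univ, Integrable
      fun x => P.p n * greenConv (μ n) (γ n) t (P.f n) x * φ x := fun n _ => by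
    simp only [mul_assoc]
    exact (hconv n).const_mul _
  have hsum : Integrable fun x => (∑ n, P.p n * greenConv (μ n) (γ n) t (P.f n) x) * φ x := by
    simp only [Finset.sum_mul]
    exact integrable_finsetSum _ hconv'
  have hs := (hker (Fin.last m)).integrable_sourceConv_mul hF hC ht (Icc_subset_times htT)
    (hGreen.integrable_mass t ht htT) φ
  change pairing (fun x => ∑ n, P.p n * greenConv (μ n) (γ n) t (P.f n) x +
    sourceConv (μ (Fin.last m)) (γ (Fin.last m)) F t x) φ = _
  rw [pairing_add φ hsum hs, pairing_sum _ φ hconv']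
  congr 1
  · exact Finset.sum_congr rfl fun n _ => pairing_const_mul _ _ _
  · exact (hker (Fin.last m)).pairing_sourceConv hF hC ht (Icc_subset_times htT)
      (hGreen.integrable_mass t ht htT) φ

/-- The integrability required for `integral_triangle`. -/
theorem integrable_pairing_greenConv_prod (hGreen : GreenDensities P T₀ μ γ) {F : ℝ → Space d → ℝ}
    (hF : Measurable (Function.uncurry F)) {C : ℝ} (hC : ∀ t x, |F t x| ≤ C) {t : ℝ} (ht : 0 ≤ t)
    (htT : (t : EReal) < T₀) (φ : 𝓢(Space d, ℝ)) :
    Integrable (Function.uncurry fun r q : ℝ =>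
      pairing (greenConv (μ (Fin.last m)) (γ (Fin.last m)) r (F q)) φ)
      ((volume.restrict (Ioc 0 t)).prod (volume.restrict (Ioc 0 t))) := by
  have hker := hGreen.isSignedKernel (Fin.last m)
  have h1 : Integrable (fun p : ℝ × ℝ =>
      C * normOne φ * mass (μ (Fin.last m)) (γ (Fin.last m)) p.1 * (1 : ℝ))
      ((volume.restrict (Ioc 0 t)).prod (volume.restrict (Ioc 0 t))) :=
    Integrable.mul_prod (f := fun s => C * normOne φ * mass (μ (Fin.last m)) (γ (Fin.last m)) s)
      (g := fun _ => (1 : ℝ))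
      (((hGreen.integrable_mass t ht htT).mono_set Ioc_subset_Icc_self).const_mul _)
      (integrable_const 1)
  refine h1.mono' (hker.measurable_pairing_greenConv hF φ).aestronglyMeasurable ?_
  have hae : ∀ᵐ p ∂((volume.restrict (Ioc 0 t)).prod (volume.restrict (Ioc 0 t))),
      p.1 ∈ Ioc 0 t :=
    (Measure.quasiMeasurePreserving_fst (μ := volume.restrict (Ioc 0 t))
      (ν := volume.restrict (Ioc 0 t))).ae (ae_restrict_mem measurableSet_Ioc)
  filter_upwards [hae] with p hp
  have := hker.abs_pairing_greenConv_le (Icc_subset_times htT (Ioc_subset_Icc_self hp))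
    (hC p.2) φ
  simp only [Function.uncurry, Real.norm_eq_abs]
  linarith

/-- The mild solution solves the linear equation in the form given by variation of constants. -/
theorem pairing_mild_eq_duhamel (hTempered : TemperedGreen P T₀) (hGreen : GreenDensities P T₀ μ γ)
    {F : ℝ → Space d → ℝ} (hF : Measurable (Function.uncurry F)) {C : ℝ}
    (hC : ∀ t x, |F t x| ≤ C) {t : ℝ} (ht : 0 ≤ t) (htT : (t : EReal) < T₀)
    (hmass : InitialMassIntegrable P μ γ t) (φ : 𝓢(Space d, ℝ)) :
    pairing (mild P μ γ F t) φ = duhamel P.a (fun n => P.p n * pairing (P.f n) φ)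
      (fun s => pairing (mild P μ γ F s) (adjointOp P φ) + pairing (F s) φ) 0 t := by
  have hker := hGreen.isSignedKernel
  set ψ := adjointOp P φ with hψ
  set k : ℝ → ℝ := fun s => propagator P.a s 0 (Fin.last m) with hkdef
  have hk : Continuous k := propagator_continuous P.a _ _
  have hkt : Continuous fun s => k (t - s) := hk.comp (continuous_const.sub continuous_id)
  have hFm : ∀ q, Measurable (F q) := fun q => hF.of_uncurry_left
  -- the initial values
  have hinit : ∀ n, pairing (greenConv (μ n) (γ n) t (P.f n)) φ =
      propagator P.a t 0 n * pairing (P.f n) φ +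
      ∫ s in (0 : ℝ)..t, k (t - s) * pairing (greenConv (μ n) (γ n) s (P.f n)) ψ := by
    intro n
    by_cases hn : P.f n = 0
    · simp [hn, greenConv_zero, pairing_zero]
    · exact pairing_greenConv_volterra hTempered hGreen n ht htT (hmass n hn)
        (P.f n).continuous.measurable (abs_bcf_le (P.f n)) φ
  have hinitI : ∀ n, IntervalIntegrable
      (fun s => k (t - s) * pairing (greenConv (μ n) (γ n) s (P.f n)) ψ) volume 0 t := by
    intro n
    refine IntervalIntegrable.continuousOn_mul ?_ hkt.continuousOn
    by_cases hn : P.f n = 0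
    · simp [hn, greenConv_zero, pairing_zero]
    · rw [intervalIntegrable_iff_integrableOn_Icc_of_le ht]
      refine Integrable.mono' (((hmass n hn).const_mul ‖P.f n‖).mul_const (normOne ψ))
        (((hker n).measurable_pairing_greenConv (W := Unit) (F := fun _ => P.f n)
          ((P.f n).continuous.measurable.comp measurable_snd) ψ).comp
          (measurable_prodMk_right (y := ()))).aestronglyMeasurable ?_
      refine (ae_restrict_iff' measurableSet_Icc).2 (Filter.Eventually.of_forall fun s hs => ?_)
      exact (hker n).abs_pairing_greenConv_le (Icc_subset_times htT hs) (abs_bcf_le (P.f n)) ψ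
  -- the source
  have hFφm : Measurable fun s => pairing (F s) φ := by
    have : Measurable fun q : ℝ × Space d => F q.1 q.2 * φ q.2 :=
      hF.mul (φ.continuous.measurable.comp measurable_snd)
    exact (this.stronglyMeasurable.integral_prod_right'
      (ν := (volume : Measure (Space d)))).measurable
  have hFφ : IntervalIntegrable (fun s => pairing (F s) φ) volume 0 t := by
    rw [intervalIntegrable_iff_integrableOn_Ioc_of_le ht]
    exact Integrable.of_bound hFφm.aestronglyMeasurable (C * normOne φ)
      (Filter.Eventually.of_forall fun s => abs_pairing_le (hC s) φ)
  have hkF : IntervalIntegrable (fun q => k (t - q) * pairing (F q) φ) volume 0 t :=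
    hFφ.continuousOn_mul hkt.continuousOn
  set h : ℝ → ℝ → ℝ := fun r q =>
    pairing (greenConv (μ (Fin.last m)) (γ (Fin.last m)) r (F q)) ψ with hh
  obtain ⟨hinner, hconvI, htri⟩ := integral_triangle ht hk (h := h)
    (integrable_pairing_greenConv_prod hGreen hF hC ht htT ψ)
  have hsource : ∫ s in (0 : ℝ)..t,
      pairing (greenConv (μ (Fin.last m)) (γ (Fin.last m)) s (F (t - s))) φ =
      ∫ q in (0 : ℝ)..t, (k (t - q) * pairing (F q) φ +
        ∫ r in (0 : ℝ)..(t - q), k (t - q - r) * h r q) := by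
    have h1 := intervalIntegral.integral_comp_sub_left (a := 0) (b := t)
      (fun q => (k (t - q) * pairing (F q) φ +
        ∫ r in (0 : ℝ)..(t - q), k (t - q - r) * h r q)) t
    rw [sub_self, sub_zero] at h1
    rw [← h1]
    refine intervalIntegral.integral_congr fun s hs => ?_
    rw [uIcc_of_le ht] at hs
    have hsT : (s : EReal) < T₀ := (Icc_subset_times htT hs).2
    simp only [sub_sub_cancel]
    exact pairing_greenConv_volterra hTempered hGreen (Fin.last m) hs.1 hsT
      (hGreen.integrable_mass s hs.1 hsT) (hFm _) (hC _) φ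
  rw [pairing_mild hGreen hF hC ht htT, hsource, intervalIntegral.integral_add hkF hinner, htri]
  simp only [hinit, mul_add, Finset.sum_add_distrib, duhamel]
  have hrhs : ∀ s ∈ uIcc 0 t, k (t - s) * (pairing (mild P μ γ F s) ψ) + k (t - s) * pairing (F s) φ =
      (∑ n, P.p n * (k (t - s) * pairing (greenConv (μ n) (γ n) s (P.f n)) ψ)) +
        (k (t - s) * pairing (F s) φ + k (t - s) * ∫ r in (0 : ℝ)..s, h r (s - r)) := by
    intro s hs
    rw [uIcc_of_le ht] at hs
    rw [pairing_mild hGreen hF hC hs.1 (Icc_subset_times htT hs).2, mul_add, Finset.mul_sum]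
    rw [Finset.sum_congr rfl fun n _ => show k (t - s) * (P.p n *
      pairing (greenConv (μ n) (γ n) s (P.f n)) ψ) = P.p n * (k (t - s) *
      pairing (greenConv (μ n) (γ n) s (P.f n)) ψ) by ring]
    ring
  have hsumI : IntervalIntegrable (fun s => ∑ n, P.p n *
      (k (t - s) * pairing (greenConv (μ n) (γ n) s (P.f n)) ψ)) volume 0 t := by
    have := IntervalIntegrable.sum (μ := volume) (a := 0) (b := t) Finset.univ
      fun n _ => (hinitI n).const_mul (P.p n)
    simpa only [Finset.sum_fn] using this
  rw [intervalIntegral.integral_congr hrhs, intervalIntegral.integral_add hsumI (hkF.add hconvI),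
    intervalIntegral.integral_add hkF hconvI,
    intervalIntegral.integral_finsetSum fun n _ => (hinitI n).const_mul _]
  simp only [intervalIntegral.integral_const_mul]
  rw [Finset.sum_congr rfl fun n _ => show P.p n * (propagator P.a t 0 n * pairing (P.f n) φ) =
    propagator P.a t 0 n * (P.p n * pairing (P.f n) φ) by ring]
  ring

end MildSolution

/-! ### Equivalence of weak and mild solutions of the linear problem -/

section LinearProblem

variable {P : Problem m d} {T₀ : EReal} {μ : Fin (m + 1) → Kernel ℝ (Space d)}
  {γ : Fin (m + 1) → ℝ → Space d → ℝ} {𝕀 : Set ℝ}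

theorem pairing_adjointOp {v : Space d → ℝ} (hv : Measurable v) {C : ℝ} (hC : ∀ x, |v x| ≤ C)
    (φ : 𝓢(Space d, ℝ)) : pairing v (adjointOp P φ) =
      ∑ α ∈ multiIdx d P.M, P.b α * ((-1) ^ (∑ i, α i) * pairing v (multiDeriv α φ)) := by
  have h1 : ∀ α ∈ multiIdx d P.M, Integrable
      fun x => v x * ((P.b α * (-1) ^ (∑ i, α i)) * multiDeriv α φ x) := fun α _ => by
    have := (integrable_pairing hv hC (multiDeriv α φ)).const_mul (P.b α * (-1) ^ (∑ i, α i))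
    refine this.congr (Filter.Eventually.of_forall fun x => ?_)
    simp only
    ring
  simp only [pairing, adjointOp_apply, smul_eq_mul, Finset.mul_sum, multiDerivOp_real]
  rw [integral_finsetSum _ h1]
  refine Finset.sum_congr rfl fun α _ => ?_
  rw [← integral_const_mul, ← integral_const_mul]
  refine integral_congr_ae (Filter.Eventually.of_forall fun x => ?_)
  simp only
  ring

theorem measurable_slice_of_continuousOn {v : ℝ → Space d → ℝ}
    (hv : ContinuousOn (Function.uncurry v) (𝕀 ×ˢ univ)) {t : ℝ} (ht : t ∈ 𝕀) :
    Continuous (v t) :=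
  hv.comp_continuous (Continuous.prodMk_right t) fun _ => ⟨ht, mem_univ _⟩

theorem continuousOn_pairing (h𝕀 : IsTimeInterval 𝕀) {v : ℝ → Space d → ℝ}
    (hv : ContinuousOn (Function.uncurry v) (𝕀 ×ˢ univ))
    (hC : ∀ b ∈ 𝕀, ∃ C, ∀ t ∈ Icc 0 b, ∀ x, |v t x| ≤ C) (φ : 𝓢(Space d, ℝ)) :
    ContinuousOn (fun t => pairing (v t) φ) 𝕀 := by
  intro t ht
  obtain ⟨b, hb, -, hnhds⟩ := h𝕀.exists_nhds ht
  obtain ⟨C, hC⟩ := hC b hb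
  have hev : ∀ᶠ s in 𝓝[𝕀] t, s ∈ Icc 0 b := hnhds
  refine continuousWithinAt_of_dominated (bound := fun x => C * |φ x|) ?_ ?_
    (φ.integrable.abs.const_mul C) (Filter.Eventually.of_forall fun x => ?_)
  · filter_upwards [self_mem_nhdsWithin] with s hs
    exact ((measurable_slice_of_continuousOn hv hs).mul φ.continuous).aestronglyMeasurable
  · filter_upwards [hev] with s hs
    refine Filter.Eventually.of_forall fun x => ?_
    rw [norm_mul]
    exact mul_le_mul_of_nonneg_right (hC s hs x) (norm_nonneg _)
  · refine ContinuousWithinAt.mul ?_ continuousWithinAt_const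
    have h2 : ContinuousWithinAt (fun s : ℝ => (s, x)) 𝕀 t :=
      (Continuous.prodMk_left x).continuousWithinAt
    exact ContinuousWithinAt.comp (g := Function.uncurry v) (f := fun s : ℝ => (s, x))
      (t := 𝕀 ×ˢ univ) (hv (t, x) ⟨ht, mem_univ _⟩) h2 fun s hs => ⟨hs, mem_univ _⟩

theorem mild_congr {F F' : ℝ → Space d → ℝ} {t : ℝ} (ht : 0 ≤ t)
    (hFF' : ∀ s ∈ Icc 0 t, F s = F' s) : mild P μ γ F t = mild P μ γ F' t := by
  funext x
  simp only [mild, sourceConv_congr ht hFF']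

theorem continuousOn_mild (hGreen : GreenDensities P T₀ μ γ) (h𝕀 : IsTimeInterval 𝕀)
    (hT₀ : ∀ t ∈ 𝕀, (t : EReal) < T₀) {F : ℝ → Space d → ℝ}
    (hF : ContinuousOn (Function.uncurry F) (𝕀 ×ˢ univ))
    (hC : ∀ b ∈ 𝕀, ∃ C, ∀ t ∈ Icc 0 b, ∀ x, |F t x| ≤ C) :
    ContinuousOn (Function.uncurry (mild P μ γ F)) (𝕀 ×ˢ univ) := by
  refine ContinuousOn.add ?_ ?_
  · refine continuousOn_finsetSum _ fun n _ => continuousOn_const.mul ?_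
    exact (hGreen.continuous_conv n (P.f n)).mono
      (prod_mono (fun t ht => ⟨h𝕀.nonneg t ht, hT₀ t ht⟩) subset_rfl)
  · rintro ⟨t, x⟩ ⟨ht, -⟩
    obtain ⟨b, hb, htb, hnhds⟩ := h𝕀.exists_nhds ht
    obtain ⟨C, hC⟩ := hC b hb
    obtain ⟨F', hF', hC', heq⟩ := IsBoundedContinuousOn.exists_extension h𝕀 hF hb hC
    have hcont := (hGreen.isSignedKernel (Fin.last m)).continuousOn_sourceConv hF' hC'
      (Icc_subset_times (hT₀ b hb)) (hGreen.integrable_mass b (h𝕀.nonneg b hb) (hT₀ b hb))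
    have hcont' : ContinuousOn (fun z : ℝ × Space d =>
        sourceConv (μ (Fin.last m)) (γ (Fin.last m)) F z.1 z.2) (Icc 0 b ×ˢ univ) :=
      hcont.congr fun z hz => sourceConv_congr hz.1.1
        (fun s hs => (heq s ⟨hs.1, hs.2.trans hz.1.2⟩).symm) z.2
    refine (hcont' (t, x) ⟨⟨h𝕀.nonneg t ht, htb⟩, mem_univ _⟩).mono_of_mem_nhdsWithin ?_
    rw [nhdsWithin_prod_eq]
    exact Filter.prod_mem_prod hnhds self_mem_nhdsWithin

/-- The variation of constants formula for mild solutions whose source is only given on `𝕀`. -/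
theorem pairing_mild_eq_duhamel_on (hTempered : TemperedGreen P T₀)
    (hGreen : GreenDensities P T₀ μ γ)
    (h𝕀 : IsTimeInterval 𝕀) (hT₀ : ∀ t ∈ 𝕀, (t : EReal) < T₀)
    (hmass : ∀ t ∈ 𝕀, InitialMassIntegrable P μ γ t) {F : ℝ → Space d → ℝ}
    (hF : ContinuousOn (Function.uncurry F) (𝕀 ×ˢ univ))
    (hC : ∀ b ∈ 𝕀, ∃ C, ∀ t ∈ Icc 0 b, ∀ x, |F t x| ≤ C) (φ : 𝓢(Space d, ℝ)) {t : ℝ}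
    (ht : t ∈ 𝕀) : pairing (mild P μ γ F t) φ =
      duhamel P.a (fun n => P.p n * pairing (P.f n) φ)
      (fun s => pairing (mild P μ γ F s) (adjointOp P φ) + pairing (F s) φ) 0 t := by
  have ht0 := h𝕀.nonneg t ht
  obtain ⟨C, hC⟩ := hC t ht
  obtain ⟨F', hF', hC', heq⟩ := IsBoundedContinuousOn.exists_extension h𝕀 hF ht hC
  have hmeq : ∀ s ∈ Icc 0 t, mild P μ γ F' s = mild P μ γ F s := fun s hs =>
    mild_congr hs.1 fun r hr => heq r ⟨hr.1, hr.2.trans hs.2⟩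
  have := pairing_mild_eq_duhamel hTempered hGreen hF'.measurable hC' ht0 (hT₀ t ht)
    (hmass t ht) φ
  rw [← hmeq t ⟨ht0, le_rfl⟩, this]
  simp only [duhamel]
  congr 1
  refine intervalIntegral.integral_congr fun s hs => ?_
  rw [uIcc_of_le ht0] at hs
  simp only [hmeq s hs, heq s hs]

/-- The mild solution is a weak solution. -/
theorem isLinearSolution_mild (hTempered : TemperedGreen P T₀) (hGreen : GreenDensities P T₀ μ γ)
    (h𝕀 : IsTimeInterval 𝕀) (hT₀ : ∀ t ∈ 𝕀, (t : EReal) < T₀)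
    (hmass : ∀ t ∈ 𝕀, InitialMassIntegrable P μ γ t) {F : ℝ → Space d → ℝ}
    (hF : IsBoundedContinuousOn 𝕀 F) {R : ℝ} (hR : ∀ t ∈ 𝕀, ∀ x, |mild P μ γ F t x| ≤ R) :
    IsLinearSolution P 𝕀 F (mild P μ γ F) := by
  obtain ⟨hFc, C, hC⟩ := hF
  have hC1 : ∀ b ∈ 𝕀, ∃ C, ∀ t ∈ Icc 0 b, ∀ x, |F t x| ≤ C := fun b hb =>
    ⟨C, fun t ht => hC t (h𝕀.Icc_subset hb ht)⟩
  have hcont := continuousOn_mild (P := P) hGreen h𝕀 hT₀ hFc hC1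
  have hcp : ∀ φ : 𝓢(Space d, ℝ), ContinuousOn
      (fun s => pairing (mild P μ γ F s) (adjointOp P φ) + pairing (F s) φ) 𝕀 := fun φ =>
    (continuousOn_pairing h𝕀 hcont
      (fun b hb => ⟨R, fun t ht => hR t (h𝕀.Icc_subset hb ht)⟩) _).add
      (continuousOn_pairing h𝕀 hFc hC1 φ)
  have hduh : ∀ φ : 𝓢(Space d, ℝ), ∀ t ∈ 𝕀, pairing (mild P μ γ F t) φ =
      duhamel P.a (fun n => P.p n * pairing (P.f n) φ)
      (fun s => pairing (mild P μ γ F s) (adjointOp P φ) + pairing (F s) φ) 0 t := fun φ t ht =>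
    pairing_mild_eq_duhamel_on hTempered hGreen h𝕀 hT₀ hmass hFc hC1 φ ht
  refine ⟨⟨hcont, R, hR⟩, fun φ => duhamel_contDiffOn _ _ h𝕀 (hcp φ) (hduh φ),
    fun φ t ht => ?_, fun φ n => duhamel_initial _ _ h𝕀 (hcp φ) (hduh φ) n⟩
  rw [duhamel_equation _ _ h𝕀 P.a_last (hcp φ) (hduh φ) ht,
    pairing_adjointOp (measurable_slice_of_continuousOn hcont ht).measurable (hR t ht)]
  ring

/-- Schwartz functions separate continuous functions. -/
theorem eq_zero_of_pairing {v : Space d → ℝ} (hv : Continuous v)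
    (h0 : ∀ φ : 𝓢(Space d, ℝ), pairing v φ = 0) (x : Space d) : v x = 0 := by
  have hae : ∀ᵐ x ∂(volume : Measure (Space d)), v x = 0 :=
    ae_eq_zero_of_integral_contDiff_smul_eq_zero hv.locallyIntegrable fun g hg hgs => by
      have := h0 (hgs.toSchwartzMap hg)
      rw [pairing] at this
      simpa [mul_comm] using this
  exact congrFun (Continuous.ae_eq_iff_eq volume hv continuous_const |>.1 hae) x

/-- The weak homogeneous problem has only the trivial solution: the convolution of
`⟨g_N(s) ∗ v(τ), φ⟩` along `s + τ = t` is computed with the Volterra equation of `g_N` and with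
the one of `v`, and the difference of the results is the convolution of the propagator with
`⟨v, φ⟩`. -/
theorem eq_zero_of_pairing_volterra (hTempered : TemperedGreen P T₀)
    (hGreen : GreenDensities P T₀ μ γ) (h𝕀 : IsTimeInterval 𝕀) (hT₀ : ∀ t ∈ 𝕀, (t : EReal) < T₀)
    {v : ℝ → Space d → ℝ} (hv : ContinuousOn (Function.uncurry v) (𝕀 ×ˢ univ))
    (hC : ∀ b ∈ 𝕀, ∃ C, ∀ t ∈ Icc 0 b, ∀ x, |v t x| ≤ C)
    (hvol : ∀ φ : 𝓢(Space d, ℝ), ∀ t ∈ 𝕀, pairing (v t) φ =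
      ∫ s in (0 : ℝ)..t, propagator P.a (t - s) 0 (Fin.last m) * pairing (v s) (adjointOp P φ))
    {t : ℝ} (ht : t ∈ 𝕀) (x : Space d) : v t x = 0 := by
  have hker := hGreen.isSignedKernel (Fin.last m)
  set k : ℝ → ℝ := fun s => propagator P.a s 0 (Fin.last m) with hkdef
  have hk : Continuous k := propagator_continuous P.a _ _
  have hconv : ∀ φ : 𝓢(Space d, ℝ), ∀ t ∈ 𝕀,
      ∫ q in (0 : ℝ)..t, k (t - q) * pairing (v q) φ = 0 := by
    intro φ t ht
    have ht0 := h𝕀.nonneg t ht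
    obtain ⟨C, hC⟩ := hC t ht
    obtain ⟨w, hw, hwC, hwv⟩ := IsBoundedContinuousOn.exists_extension h𝕀 hv ht hC
    have hwm : ∀ q, Measurable (w q) := fun q => hw.measurable.of_uncurry_left
    set ψ := adjointOp P φ with hψ
    set h : ℝ → ℝ → ℝ := fun r q =>
      pairing (greenConv (μ (Fin.last m)) (γ (Fin.last m)) r (w q)) ψ with hh
    have hint := integrable_pairing_greenConv_prod hGreen hw.measurable hwC ht0 (hT₀ t ht) ψ
    obtain ⟨hI1, -, htri1⟩ := integral_triangle ht0 hk (h := h) hint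
    obtain ⟨hI2, -, htri2⟩ := integral_triangle ht0 hk (h := fun r q => h q r) hint.swap
    -- the Volterra equation of `v`
    have hone : ∀ s ∈ Icc 0 t, ∀ τ ∈ Icc 0 t,
        pairing (greenConv (μ (Fin.last m)) (γ (Fin.last m)) s (w τ)) φ =
          ∫ r in (0 : ℝ)..τ, k (τ - r) * h s r := by
      intro s hs τ hτ
      have hsS := Icc_subset_times (hT₀ t ht) hs
      have hmk := hker.markov
      have hmeas : Measurable fun z : ℝ × Space d => pairing (w z.1) (shiftTest z.2 ψ) := by
        simp only [pairing, shiftTest_apply]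
        have : Measurable fun z : (ℝ × Space d) × Space d => w z.1.1 z.2 * ψ (z.2 + z.1.2) :=
          (hw.measurable.comp ((measurable_fst.comp measurable_fst).prodMk measurable_snd)).mul
            (ψ.continuous.measurable.comp (measurable_snd.add (measurable_snd.comp measurable_fst)))
        exact (this.stronglyMeasurable.integral_prod_right'
          (ν := (volume : Measure (Space d)))).measurable
      have hkτ : Continuous fun r => k (τ - r) := hk.comp (continuous_const.sub continuous_id)
      have hfub : Integrable (Function.uncurry fun (y : Space d) (r : ℝ) =>
          k (τ - r) * (pairing (w r) (shiftTest y ψ) * γ (Fin.last m) s y))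
          ((μ (Fin.last m) s).prod (volume.restrict (Ioc 0 τ))) := by
        have hkI : IntegrableOn (fun r => k (τ - r)) (Ioc 0 τ) :=
          (hkτ.continuousOn.integrableOn_Icc (a := 0) (b := τ)).mono_set Ioc_subset_Icc_self
        have h1 := ((hker.integrable hsS).mul_prod hkI).bdd_mul
          (hmeas.comp measurable_swap).aestronglyMeasurable (c := C * normOne ψ)
          (Filter.Eventually.of_forall fun z => by
            have := abs_pairing_le (hwC z.2) (shiftTest z.1 ψ)
            rw [normOne_shiftTest] at this
            exact this)
        refine h1.congr (Filter.Eventually.of_forall fun z => ?_)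
        simp only [Function.uncurry, Function.comp_apply, Prod.swap]
        ring
      rw [hker.pairing_greenConv' hsS (hwm τ) (hwC τ), intervalIntegral.integral_of_le hτ.1]
      have h2 := integral_integral_swap hfub
      simp only [integral_const_mul] at h2
      rw [show (∫ r in Ioc 0 τ, k (τ - r) * h s r) = ∫ r in Ioc 0 τ, k (τ - r) *
        ∫ y, pairing (w r) (shiftTest y ψ) * γ (Fin.last m) s y ∂(μ (Fin.last m) s) from
        integral_congr_ae (Filter.Eventually.of_forall fun r => by
          simp only [hh]
          rw [hker.pairing_greenConv' hsS (hwm r) (hwC r)]), ← h2]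
      refine integral_congr_ae (Filter.Eventually.of_forall fun y => ?_)
      simp only
      rw [hwv τ hτ, hvol (shiftTest y φ) τ (h𝕀.Icc_subset ht hτ),
        intervalIntegral.integral_of_le hτ.1, adjointOp_shiftTest, ← integral_mul_const]
      refine integral_congr_ae ((ae_restrict_iff' measurableSet_Ioc).2
        (Filter.Eventually.of_forall fun r hr => ?_))
      simp only
      rw [hwv r ⟨hr.1.le, hr.2.trans hτ.2⟩]
      ring
    -- the Volterra equation of the Green function
    have htwo : ∀ s ∈ Icc 0 t, ∀ τ,
        pairing (greenConv (μ (Fin.last m)) (γ (Fin.last m)) s (w τ)) φ =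
          k s * pairing (w τ) φ + ∫ r in (0 : ℝ)..s, k (s - r) * h r τ := by
      intro s hs τ
      have hsT := (Icc_subset_times (hT₀ t ht) hs).2
      exact pairing_greenConv_volterra hTempered hGreen (Fin.last m) hs.1 hsT
        (hGreen.integrable_mass s hs.1 hsT) (hwm τ) (hwC τ) φ
    -- the convolution of `⟨g_N(s) ∗ v(q), φ⟩` along `s + q = t`, computed in two ways
    have hQ1 : ∫ q in (0 : ℝ)..t,
        pairing (greenConv (μ (Fin.last m)) (γ (Fin.last m)) (t - q) (w q)) φ =
        ∫ σ in (0 : ℝ)..t, k (t - σ) * ∫ r in (0 : ℝ)..σ, h r (σ - r) := by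
      have h1 := intervalIntegral.integral_comp_sub_left (a := 0) (b := t) (fun q =>
        pairing (greenConv (μ (Fin.last m)) (γ (Fin.last m)) (t - q) (w q)) φ) t
      rw [sub_self, sub_zero] at h1
      rw [← h1, intervalIntegral.integral_congr (g := fun q => ∫ r in (0 : ℝ)..(t - q),
        k (t - q - r) * h q r), htri2]
      · refine intervalIntegral.integral_congr fun σ _ => ?_
        have h3 := intervalIntegral.integral_comp_sub_left (a := 0) (b := σ)
          (fun r => h r (σ - r)) σ
        rw [sub_self, sub_zero] at h3
        simp only [sub_sub_cancel] at h3
        exact congrArg (k (t - σ) * ·) h3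
      · intro q hq
        rw [uIcc_of_le ht0] at hq
        simp only [sub_sub_cancel]
        exact hone q hq (t - q) ⟨by linarith [hq.2], by linarith [hq.1]⟩
    have hwφ : ContinuousOn (fun q => pairing (w q) φ) (Icc 0 t) := by
      have hv' := (continuousOn_pairing h𝕀 hv (fun b hb => by
        exact ‹∀ b ∈ 𝕀, ∃ C, ∀ t ∈ Icc 0 b, ∀ x, |v t x| ≤ C› b hb) φ).mono (h𝕀.Icc_subset ht)
      exact hv'.congr fun q hq => by simp only [hwv q hq]
    have hkI : IntervalIntegrable (fun q => k (t - q) * pairing (w q) φ) volume 0 t := by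
      apply ContinuousOn.intervalIntegrable
      rw [uIcc_of_le ht0]
      exact (hk.comp (continuous_const.sub continuous_id)).continuousOn.mul hwφ
    have hQ2 : ∫ q in (0 : ℝ)..t,
        pairing (greenConv (μ (Fin.last m)) (γ (Fin.last m)) (t - q) (w q)) φ =
        (∫ q in (0 : ℝ)..t, k (t - q) * pairing (w q) φ) +
        ∫ σ in (0 : ℝ)..t, k (t - σ) * ∫ r in (0 : ℝ)..σ, h r (σ - r) := by
      rw [← htri1, ← intervalIntegral.integral_add hkI hI1]
      refine intervalIntegral.integral_congr fun q hq => ?_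
      rw [uIcc_of_le ht0] at hq
      exact htwo (t - q) ⟨by linarith [hq.2], by linarith [hq.1]⟩ q
    have hfin : ∫ q in (0 : ℝ)..t, k (t - q) * pairing (w q) φ = 0 := by linarith
    refine Eq.trans (intervalIntegral.integral_congr fun q hq => ?_) hfin
    rw [uIcc_of_le ht0] at hq
    simp only [hwv q hq]
  refine eq_zero_of_pairing (measurable_slice_of_continuousOn hv ht) (fun φ => ?_) x
  -- the convolution of the propagator with `⟨v, φ⟩` is the solution of `∑_n a_n y^{(n)} = ⟨v, φ⟩` with
  -- vanishing initial values; as it is `0`, so is the right-hand side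
  have := duhamel_equation P.a (fun _ => 0) h𝕀 P.a_last (continuousOn_pairing h𝕀 hv hC φ)
    (y := fun _ => 0) (fun s hs => by
      simp only [duhamel, mul_zero, Finset.sum_const_zero, zero_add]
      exact (hconv φ s hs).symm) ht
  rw [← this]
  simp

/-- The bound on `‖f_n‖ |g_n|(t, ℝ^d)` gives no control of the mass of `g_n` if `f_n = 0`; such `n`
are excluded in `InitialMassIntegrable`. -/
theorem initialMassIntegrable_of_le (hGreen : GreenDensities P T₀ μ γ)
    (h𝕀 : IsTimeInterval 𝕀) {r : ℝ} (hmass : ∀ n, ∀ t ∈ 𝕀, ‖P.f n‖ * mass (μ n) (γ n) t ≤ r) {t : ℝ}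
    (ht : t ∈ 𝕀) : InitialMassIntegrable P μ γ t := by
  intro n hn
  have hpos : 0 < ‖P.f n‖ := norm_pos_iff.2 hn
  refine Integrable.mono' (g := fun _ => r / ‖P.f n‖) (integrableOn_const (by simp))
    (hGreen.isSignedKernel n).measurable_mass.aestronglyMeasurable
    ((ae_restrict_iff' measurableSet_Icc).2 (Filter.Eventually.of_forall fun s hs => ?_))
  rw [Real.norm_of_nonneg (IsSignedKernel.mass_nonneg _ _ _), le_div_iff₀ hpos, mul_comm]
  exact hmass n s (h𝕀.Icc_subset ht hs)

theorem abs_initial_le (hGreen : GreenDensities P T₀ μ γ)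
    {r : ℝ} {t : ℝ} (ht : 0 ≤ t) (htT : (t : EReal) < T₀)
    (hmass : ∀ n, ‖P.f n‖ * mass (μ n) (γ n) t ≤ r) (x : Space d) :
    |∑ n, P.p n * greenConv (μ n) (γ n) t (P.f n) x| ≤ r :=
  calc |∑ n, P.p n * greenConv (μ n) (γ n) t (P.f n) x|
      ≤ ∑ n, |P.p n * greenConv (μ n) (γ n) t (P.f n) x| := Finset.abs_sum_le_sum_abs _ _
    _ ≤ ∑ n, P.p n * r := by
        refine Finset.sum_le_sum fun n _ => ?_
        rw [abs_mul, abs_of_pos (P.p_pos n)]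
        exact mul_le_mul_of_nonneg_left (((hGreen.isSignedKernel n).abs_greenConv_le ⟨ht, htT⟩
          (abs_bcf_le (P.f n)) x).trans (hmass n)) (P.p_pos n).le
    _ = r := by rw [← Finset.sum_mul, P.p_sum, one_mul]

theorem abs_mild_le (hGreen : GreenDensities P T₀ μ γ)
    {r : ℝ} {t : ℝ} (ht : 0 ≤ t) (htT : (t : EReal) < T₀)
    (hmass : ∀ n, ‖P.f n‖ * mass (μ n) (γ n) t ≤ r) {F : ℝ → Space d → ℝ} {C : ℝ}
    (hC : ∀ s ∈ Icc 0 t, ∀ x, |F s x| ≤ C) (x : Space d) :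
    |mild P μ γ F t x| ≤ r + ∫ s in (0 : ℝ)..t, C * mass (μ (Fin.last m)) (γ (Fin.last m)) s :=
  (abs_add_le _ _).trans (add_le_add (abs_initial_le hGreen ht htT hmass x)
    ((hGreen.isSignedKernel (Fin.last m)).abs_sourceConv_le ht (Icc_subset_times htT)
      (hGreen.integrable_mass t ht htT) hC x))

/-- A weak solution of the linear problem is given by the mild formula. -/
theorem IsLinearSolution.eq_mild (hTempered : TemperedGreen P T₀)
    (hGreen : GreenDensities P T₀ μ γ) (h𝕀 : IsTimeInterval 𝕀) (hT₀ : ∀ t ∈ 𝕀, (t : EReal) < T₀)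
    {r : ℝ} (hmass : ∀ n, ∀ t ∈ 𝕀, ‖P.f n‖ * mass (μ n) (γ n) t ≤ r) {F u : ℝ → Space d → ℝ}
    (hF : IsBoundedContinuousOn 𝕀 F)
    (hu : IsLinearSolution P 𝕀 F u) {t : ℝ} (ht : t ∈ 𝕀) (x : Space d) :
    u t x = mild P μ γ F t x := by
  obtain ⟨hFc, C, hC⟩ := hF
  obtain ⟨huc, Cu, hCu⟩ := hu.boundedContinuous
  have hC1 : ∀ b ∈ 𝕀, ∃ C, ∀ t ∈ Icc 0 b, ∀ x, |F t x| ≤ C := fun b hb =>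
    ⟨C, fun t ht => hC t (h𝕀.Icc_subset hb ht)⟩
  have hCu1 : ∀ b ∈ 𝕀, ∃ C, ∀ t ∈ Icc 0 b, ∀ x, |u t x| ≤ C := fun b hb =>
    ⟨Cu, fun t ht => hCu t (h𝕀.Icc_subset hb ht)⟩
  have hmc := continuousOn_mild (P := P) hGreen h𝕀 hT₀ hFc hC1
  have hC0 : 0 ≤ C := (abs_nonneg _).trans (hC t ht 0)
  have hmb : ∀ b ∈ 𝕀, ∃ C', ∀ t ∈ Icc 0 b, ∀ x, |mild P μ γ F t x| ≤ C' := by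
    intro b hb
    refine ⟨r + ∫ s in (0 : ℝ)..b, C * mass (μ (Fin.last m)) (γ (Fin.last m)) s,
      fun t ht x => ?_⟩
    have htI := h𝕀.Icc_subset hb ht
    refine (abs_mild_le hGreen ht.1 (hT₀ t htI) (fun n => hmass n t htI)
      (fun s hs => hC s (h𝕀.Icc_subset htI hs)) x).trans (add_le_add_right ?_ r)
    refine intervalIntegral.integral_mono_interval le_rfl ht.1 ht.2
      (Filter.Eventually.of_forall fun s =>
        mul_nonneg hC0 (IsSignedKernel.mass_nonneg _ _ _)) ?_
    rw [intervalIntegrable_iff_integrableOn_Icc_of_le (h𝕀.nonneg b hb)]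
    exact (hGreen.integrable_mass b (h𝕀.nonneg b hb) (hT₀ b hb)).const_mul C
  have hmass' : ∀ t ∈ 𝕀, InitialMassIntegrable P μ γ t := fun t ht =>
    initialMassIntegrable_of_le hGreen h𝕀 hmass ht
  have hint : ∀ (φ : 𝓢(Space d, ℝ)), ∀ t ∈ 𝕀, pairing (fun x => u t x - mild P μ γ F t x) φ =
      pairing (u t) φ - pairing (mild P μ γ F t) φ := by
    intro φ t ht
    obtain ⟨C', hC'⟩ := hmb t ht
    exact pairing_sub φ
      (integrable_pairing (measurable_slice_of_continuousOn huc ht).measurable (hCu t ht) φ)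
      (integrable_pairing (measurable_slice_of_continuousOn hmc ht).measurable
        (hC' t ⟨h𝕀.nonneg t ht, le_rfl⟩) φ)
  refine sub_eq_zero.1 (eq_zero_of_pairing_volterra (v := fun t x => u t x - mild P μ γ F t x)
    hTempered hGreen h𝕀 hT₀ (huc.sub hmc) (fun b hb => ?_) (fun φ t ht => ?_) ht x)
  · obtain ⟨C', hC'⟩ := hmb b hb
    exact ⟨Cu + C', fun t ht x => (abs_sub _ _).trans
      (add_le_add (hCu t (h𝕀.Icc_subset hb ht) x) (hC' t ht x))⟩
  · have ht0 := h𝕀.nonneg t ht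
    have hch : ContinuousOn (fun s => pairing (u s) (adjointOp P φ) + pairing (F s) φ) 𝕀 :=
      (continuousOn_pairing h𝕀 huc hCu1 _).add (continuousOn_pairing h𝕀 hFc hC1 φ)
    have hch' : ContinuousOn
        (fun s => pairing (mild P μ γ F s) (adjointOp P φ) + pairing (F s) φ) 𝕀 :=
      (continuousOn_pairing h𝕀 hmc hmb _).add (continuousOn_pairing h𝕀 hFc hC1 φ)
    have hk : ContinuousOn (fun s => propagator P.a (t - s) 0 (Fin.last m)) 𝕀 :=
      ((propagator_continuous P.a _ _).comp (continuous_const.sub continuous_id)).continuousOn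
    have h1 := eq_duhamel P.a (fun n => P.p n * pairing (P.f n) φ) h𝕀 P.a_last hch
      (hu.smooth φ) (fun s hs => by
        have := hu.equation φ s hs
        rw [pairing_adjointOp (measurable_slice_of_continuousOn huc hs).measurable (hCu s hs)]
        linarith) (hu.initial φ) ht
    rw [hint φ t ht, h1, pairing_mild_eq_duhamel_on hTempered hGreen h𝕀 hT₀ hmass' hFc hC1 φ ht,
      duhamel, duhamel, add_sub_add_left_eq_sub]
    refine (intervalIntegral.integral_sub
      (h𝕀.intervalIntegrable (hk.mul hch) ht) (h𝕀.intervalIntegrable (hk.mul hch') ht)).symm.trans ?_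
    refine intervalIntegral.integral_congr fun s hs => ?_
    rw [uIcc_of_le ht0] at hs
    simp only [Pi.mul_apply]
    rw [hint _ s (h𝕀.Icc_subset ht hs)]
    ring

end LinearProblem

/-! ### The nonlinearity as a power series -/

section PowerSeries

/-- The nonlinearity `∑_j q_j c_j(z) s^j` at the point `z = (t, x)`. -/
def nonlin (P : Problem m d) (z : ℝ≥0 × Space d) (s : ℝ) : ℝ := ∑' j, P.q j * P.c j z * s ^ j

variable {P : Problem m d}

theorem coeff_nonneg (P : Problem m d) (j : ℕ) : 0 ≤ P.q j * ‖P.c j‖ :=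
  mul_nonneg (P.q_nonneg j) (norm_nonneg _)

theorem summable_coeff {s : ℝ} (hs0 : 0 ≤ s) (hs : ENNReal.ofReal s < R₁ P) :
    Summable fun j => P.q j * ‖P.c j‖ * s ^ j := by
  have h := FormalMultilinearSeries.summable_norm_mul_pow _ (r := s.toNNReal) hs
  simp only [FormalMultilinearSeries.ofScalars_norm, Real.coe_toNNReal s hs0] at h
  refine h.congr fun j => ?_
  rw [Real.norm_of_nonneg (coeff_nonneg P j)]

theorem abs_term_le (z : ℝ≥0 × Space d) {s s₁ : ℝ} (hs : |s| ≤ s₁) (j : ℕ) :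
    |P.q j * P.c j z * s ^ j| ≤ P.q j * ‖P.c j‖ * s₁ ^ j := by
  rw [abs_mul, abs_mul, abs_of_nonneg (P.q_nonneg j), abs_pow]
  gcongr
  · exact coeff_nonneg P j
  · exact P.q_nonneg j
  · exact (P.c j).norm_coe_le_norm z

theorem summable_nonlin (z : ℝ≥0 × Space d) {s s₁ : ℝ} (hs : |s| ≤ s₁)
    (hs₁ : ENNReal.ofReal s₁ < R₁ P) : Summable fun j => P.q j * P.c j z * s ^ j :=
  Summable.of_norm_bounded (summable_coeff ((abs_nonneg s).trans hs) hs₁) (abs_term_le z hs)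

theorem abs_nonlin_le (z : ℝ≥0 × Space d) {s s₁ : ℝ} (hs : |s| ≤ s₁)
    (hs₁ : ENNReal.ofReal s₁ < R₁ P) : |nonlin P z s| ≤ H₁ P s₁ := by
  rw [← Real.norm_eq_abs]
  exact tsum_of_norm_bounded (summable_coeff ((abs_nonneg s).trans hs) hs₁).hasSum
    (abs_term_le z hs)

theorem H₁_nonneg {s : ℝ} (hs : 0 ≤ s) : 0 ≤ H₁ P s :=
  tsum_nonneg fun j => mul_nonneg (coeff_nonneg P j) (pow_nonneg hs j)

theorem H₁_mono {s s' : ℝ} (hs : 0 ≤ s) (hss' : s ≤ s') (hs' : ENNReal.ofReal s' < R₁ P) :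
    H₁ P s ≤ H₁ P s' := by
  refine Summable.tsum_le_tsum (fun j => ?_)
    (summable_coeff hs ((ENNReal.ofReal_le_ofReal hss').trans_lt hs'))
    (summable_coeff (hs.trans hss') hs')
  have := coeff_nonneg P j
  gcongr

theorem continuousOn_H₁ {s₁ : ℝ} (hs₁ : ENNReal.ofReal s₁ < R₁ P) :
    ContinuousOn (H₁ P) (Icc 0 s₁) := by
  by_cases h0 : 0 ≤ s₁
  · refine continuousOn_tsum (fun j => (continuous_const.mul (continuous_pow j)).continuousOn)
      (summable_coeff h0 hs₁) fun j s hs => ?_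
    have := coeff_nonneg P j
    have := hs.1
    rw [Real.norm_of_nonneg (by positivity)]
    gcongr
    exact hs.2
  · rw [Icc_eq_empty h0]
    exact continuousOn_empty _

theorem continuousOn_nonlin {s₁ : ℝ} (hs₁ : ENNReal.ofReal s₁ < R₁ P) :
    ContinuousOn (fun p : (ℝ≥0 × Space d) × ℝ => nonlin P p.1 p.2) {p | |p.2| ≤ s₁} := by
  by_cases h0 : 0 ≤ s₁
  · refine continuousOn_tsum (fun j => ?_) (summable_coeff h0 hs₁)
      fun j p hp => abs_term_le p.1 hp j
    exact ((continuous_const.mul ((P.c j).continuous.comp continuous_fst)).mul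
      (continuous_snd.pow j)).continuousOn
  · rw [show {p : (ℝ≥0 × Space d) × ℝ | |p.2| ≤ s₁} = ∅ from
      eq_empty_of_forall_notMem fun p hp => h0 ((abs_nonneg _).trans hp)]
    exact continuousOn_empty _

theorem exists_between_ofReal {s : ℝ} {R : ℝ≥0∞} (hs0 : 0 ≤ s) (hs : ENNReal.ofReal s < R) :
    ∃ s' : ℝ, s < s' ∧ ENNReal.ofReal s' < R := by
  obtain ⟨b, hb1, hb2⟩ := exists_between hs
  have hb : b ≠ ∞ := ne_top_of_lt hb2
  refine ⟨b.toReal, (ENNReal.ofReal_lt_iff_lt_toReal hs0 hb).1 hb1, ?_⟩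
  rwa [ENNReal.ofReal_toReal hb]

/-- Inside the disc of convergence the nonlinearity is Lipschitz, uniformly in `(t, x)`. -/
theorem exists_lipschitz_nonlin (P : Problem m d) {s₁ : ℝ} (hs0 : 0 ≤ s₁)
    (hs₁ : ENNReal.ofReal s₁ < R₁ P) :
    ∃ L : ℝ, 0 ≤ L ∧ ∀ z : ℝ≥0 × Space d, ∀ s s' : ℝ, |s| ≤ s₁ → |s'| ≤ s₁ →
      |nonlin P z s - nonlin P z s'| ≤ L * |s - s'| := by
  obtain ⟨s₂, h12, h2⟩ := exists_between_ofReal hs0 hs₁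
  have hd : 0 < s₂ - s₁ := sub_pos.2 h12
  have h20 : 0 ≤ s₂ := hs0.trans h12.le
  refine ⟨H₁ P s₂ / (s₂ - s₁), div_nonneg (H₁_nonneg h20) hd.le, fun z s s' hs hs' => ?_⟩
  have hsum := summable_coeff h20 h2
  have hterm : ∀ j, |P.q j * P.c j z * s ^ j - P.q j * P.c j z * s' ^ j| ≤
      P.q j * ‖P.c j‖ * s₂ ^ j * (|s - s'| / (s₂ - s₁)) := by
    intro j
    -- a term of the binomial expansion of `(s₁ + (s₂ - s₁)) ^ j`
    have hB : j * s₁ ^ (j - 1) * (s₂ - s₁) ≤ s₂ ^ j := by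
      have := pow_add_mul_le_add_pow hs0 (show 0 ≤ 2 * s₁ + (s₂ - s₁) by linarith) j
      rw [show s₁ + (s₂ - s₁) = s₂ by ring] at this
      have h3 := pow_nonneg hs0 j
      linarith
    have hpow : |s ^ j - s' ^ j| ≤ s₂ ^ j * (|s - s'| / (s₂ - s₁)) := by
      calc |s ^ j - s' ^ j| ≤ |s - s'| * j * max |s| |s'| ^ (j - 1) := abs_pow_sub_pow_le ..
        _ ≤ |s - s'| * j * s₁ ^ (j - 1) := by
          gcongr
          exact max_le hs hs'
        _ = (j * s₁ ^ (j - 1) * (s₂ - s₁)) * (|s - s'| / (s₂ - s₁)) := by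
          field_simp
        _ ≤ _ := by gcongr
    rw [← mul_sub, abs_mul, abs_mul, abs_of_nonneg (P.q_nonneg j), mul_assoc (P.q j * ‖P.c j‖)]
    have hc : |P.c j z| ≤ ‖P.c j‖ := (P.c j).norm_coe_le_norm z
    have := P.q_nonneg j
    gcongr
  rw [nonlin, nonlin, ← (summable_nonlin z hs hs₁).tsum_sub (summable_nonlin z hs' hs₁),
    ← Real.norm_eq_abs]
  refine (tsum_of_norm_bounded (hsum.mul_right _).hasSum hterm).trans_eq ?_
  rw [tsum_mul_right, H₁]
  ring

/-! ### The majorant -/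

variable {T₀ : EReal} {μ : Fin (m + 1) → Kernel ℝ (Space d)}
  {γ : Fin (m + 1) → ℝ → Space d → ℝ} {𝕀 : Set ℝ}

/-- Since `μ_n(t, ·)` is a probability measure, `|g_n|(t, ℝ^d) ≤ ‖γ_n‖_∞`; stated with a factor `c`,
and in `[0, ∞]`, to cover the case `c = 0` and `‖γ_n‖_∞ = ∞`. -/
theorem mul_mass_le (hGreen : GreenDensities P T₀ μ γ) (hT₀ : ∀ t ∈ 𝕀, 0 ≤ t ∧ (t : EReal) < T₀)
    (n : Fin (m + 1)) {t : ℝ} (ht : t ∈ 𝕀) {c : ℝ} (hc : 0 ≤ c) :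
    ENNReal.ofReal (c * mass (μ n) (γ n) t) ≤ ENNReal.ofReal c * supNorm 𝕀 (γ n) := by
  have hker := hGreen.isSignedKernel n
  have := hker.markov
  rw [ENNReal.ofReal_mul hc, mass, ofReal_integral_eq_lintegral_ofReal (hker.integrable (hT₀ t ht)).abs
    (Filter.Eventually.of_forall fun _ => abs_nonneg _)]
  gcongr
  calc ∫⁻ x, ENNReal.ofReal |γ n t x| ∂(μ n t) ≤ ∫⁻ _, supNorm 𝕀 (γ n) ∂(μ n t) := by
        refine lintegral_mono fun x => ?_
        rw [← Real.norm_eq_abs, ofReal_norm]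
        exact (le_iSup (fun x => ‖γ n t x‖ₑ) x).trans
          (le_iSup₂ (f := fun t _ => ⨆ x, ‖γ n t x‖ₑ) t ht)
    _ = supNorm 𝕀 (γ n) := by simp

theorem norm_mul_mass_le_r₁ (hGreen : GreenDensities P T₀ μ γ)
    (hT₀ : ∀ t ∈ 𝕀, 0 ≤ t ∧ (t : EReal) < T₀) (hr : r₁ P 𝕀 γ ≠ ∞) (n : Fin (m + 1)) {t : ℝ}
    (ht : t ∈ 𝕀) : ‖P.f n‖ * mass (μ n) (γ n) t ≤ (r₁ P 𝕀 γ).toReal := by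
  rw [← ENNReal.ofReal_le_iff_le_toReal hr]
  refine (mul_mass_le hGreen hT₀ n ht (norm_nonneg _)).trans ?_
  rw [ofReal_norm]
  exact le_iSup (fun n => ‖P.f n‖ₑ * supNorm 𝕀 (γ n)) n

/-- The solution of `w' = G h(w)`, `w(0) = r`, for a positive bounded continuous `h`, is defined for
all times; it is obtained by separation of variables. -/
theorem exists_solution_autonomous {h : ℝ → ℝ} (hh : Continuous h) {c C : ℝ} (hc : 0 < c)
    (hch : ∀ s, c ≤ h s) (hhC : ∀ s, h s ≤ C) (G r : ℝ) :
    ∃ w : ℝ → ℝ, w 0 = r ∧ (∀ t, HasDerivAt w (G * h (w t)) t) ∧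
      ∀ t s, G * t ≤ ∫ y in r..s, (h y)⁻¹ → w t ≤ s := by
  have hpos : ∀ s, 0 < h s := fun s => hc.trans_le (hch s)
  have hC : 0 < C := (hpos 0).trans_le (hhC 0)
  have hinv : Continuous fun y => (h y)⁻¹ := hh.inv₀ fun s => (hpos s).ne'
  -- the solution is `t ↦ Φ⁻¹(G t)`
  set Φ : ℝ → ℝ := fun s => ∫ y in r..s, (h y)⁻¹ with hΦ
  have hderiv : ∀ s, HasDerivAt Φ (h s)⁻¹ s := fun s =>
    intervalIntegral.integral_hasDerivAt_right (hinv.intervalIntegrable _ _)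
      (hinv.stronglyMeasurableAtFilter _ _) hinv.continuousAt
  have hmono : StrictMono Φ := strictMono_of_hasDerivAt_pos hderiv fun s => inv_pos.2 (hpos s)
  have hcont : Continuous Φ := continuous_iff_continuousAt.2 fun s => (hderiv s).continuousAt
  -- `Φ(s) - s / C` is monotone, so that `Φ` is onto
  have hmono' : Monotone fun s => Φ s - C⁻¹ * s := by
    refine monotone_of_hasDerivAt_nonneg (f' := fun s => (h s)⁻¹ - C⁻¹ * 1)
      (fun s => (hderiv s).sub ((hasDerivAt_id s).const_mul _)) fun s => ?_
    simpa using inv_anti₀ (hpos s) (hhC s)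
  have hsurj : Function.Surjective Φ := by
    refine hcont.surjective ?_ ?_
    · have h1 : Filter.Tendsto (fun s : ℝ => C⁻¹ * s + (Φ 0)) Filter.atTop Filter.atTop :=
        Filter.tendsto_atTop_add_const_right _ _
          (Filter.tendsto_id.const_mul_atTop (inv_pos.2 hC))
      refine Filter.tendsto_atTop_mono' _ ?_ h1
      filter_upwards [Filter.eventually_ge_atTop 0] with s hs
      have := hmono' hs
      simp only [mul_zero, sub_zero] at this
      linarith
    · have h1 : Filter.Tendsto (fun s : ℝ => C⁻¹ * s + (Φ 0)) Filter.atBot Filter.atBot :=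
        Filter.tendsto_atBot_add_const_right _ _
          (Filter.tendsto_id.const_mul_atBot (inv_pos.2 hC))
      refine Filter.tendsto_atBot_mono' _ ?_ h1
      filter_upwards [Filter.eventually_le_atBot 0] with s hs
      have := hmono' hs
      simp only [mul_zero, sub_zero] at this
      linarith
  set e := hmono.orderIsoOfSurjective Φ hsurj with he
  have hright : ∀ y, Φ (e.symm y) = y := fun y => e.apply_symm_apply y
  refine ⟨fun t => e.symm (G * t), ?_, fun t => ?_, fun t s hts => ?_⟩
  · simp only [mul_zero]
    rw [OrderIso.symm_apply_eq]
    exact (intervalIntegral.integral_same).symm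
  · have h1 : HasDerivAt e.symm ((h (e.symm (G * t)))⁻¹)⁻¹ (G * t) :=
      HasDerivAt.of_local_left_inverse e.symm.continuous.continuousAt (hderiv _)
        (inv_ne_zero (hpos _).ne') (Filter.Eventually.of_forall hright)
    have h2 := h1.comp t ((hasDerivAt_id t).const_mul G)
    rw [inv_inv] at h2
    refine h2.congr_deriv ?_
    ring
  · exact (e.symm.monotone hts).trans_eq (e.symm_apply_apply s)

/-- The non-explosion condition provides a bounded supersolution of the renewal equation
`w(t) = r₁ + ∫_0^t |g_N|(s, ℝ^d) H₁(w(t-s)) ds`: the solution of `w' = ‖γ_N‖_∞ H₁(w)`,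
`w(0) = r₁`, if `H₁(r₁) > 0`, and the constant `r₁` otherwise. -/
theorem NonExplosion.exists_majorant (hGreen : GreenDensities P T₀ μ γ) {T : ℝ} (hT : 0 < T)
    (hT₀ : ∀ t ∈ 𝕀, 0 ≤ t ∧ (t : EReal) < T₀) (hIT : ∀ t ∈ 𝕀, t ≤ T)
    (hord : ∀ t ∈ 𝕀, Icc 0 t ⊆ 𝕀) (hODE : NonExplosion P T 𝕀 γ) :
    ∃ (s₁ : ℝ) (w : ℝ → ℝ), ENNReal.ofReal s₁ < R₁ P ∧ (r₁ P 𝕀 γ).toReal ≤ s₁ ∧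
      (∀ t ∈ Icc 0 T, 0 ≤ w t ∧ w t ≤ s₁) ∧
      ∀ t ∈ 𝕀, ENNReal.ofReal (r₁ P 𝕀 γ).toReal + ∫⁻ s in Ioc 0 t,
        ENNReal.ofReal (mass (μ (Fin.last m)) (γ (Fin.last m)) s * H₁ P (w (t - s))) ≤
          ENNReal.ofReal (w t) := by
  obtain ⟨hr, s₁, hrs, hs₁, hint⟩ := hODE
  set r := (r₁ P 𝕀 γ).toReal with hrdef
  have hr0 : 0 ≤ r := ENNReal.toReal_nonneg
  have hs0 : 0 ≤ s₁ := hr0.trans hrs.le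
  -- if `H₁(r₁) = 0`, there is no source, and `‖γ_N‖_∞` may be infinite
  by_cases hH : H₁ P r = 0
  · exact ⟨s₁, fun _ => r, hs₁, hrs.le, fun t _ => ⟨hr0, hrs.le⟩, fun t _ => by simp [hH]⟩
  have hHr : 0 < H₁ P r := (H₁_nonneg hr0).lt_of_ne' hH
  -- outside the disc of convergence `H₁` has a junk value; extend it constantly from `[r₁, s₁]`
  set h : ℝ → ℝ := fun y => H₁ P (projIcc r s₁ hrs.le y) with hh
  have hproj : ∀ y, r ≤ (projIcc r s₁ hrs.le y : ℝ) ∧ (projIcc r s₁ hrs.le y : ℝ) ≤ s₁ :=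
    fun y => (projIcc r s₁ hrs.le y).2
  have hhc : Continuous h := (continuousOn_H₁ hs₁).comp_continuous
    (continuous_subtype_val.comp continuous_projIcc) fun y => ⟨hr0.trans (hproj y).1, (hproj y).2⟩
  have hlow : ∀ y, H₁ P r ≤ h y := fun y => H₁_mono hr0 (hproj y).1
    ((ENNReal.ofReal_le_ofReal (hproj y).2).trans_lt hs₁)
  have hupp : ∀ y, h y ≤ H₁ P s₁ := fun y => H₁_mono (hr0.trans (hproj y).1) (hproj y).2 hs₁
  have hhinv : Continuous fun y => (h y)⁻¹ := hhc.inv₀ fun y => (hHr.trans_le (hlow y)).ne'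
  have hlint : ∫⁻ s in Icc r s₁, (ENNReal.ofReal (H₁ P s))⁻¹ =
      ENNReal.ofReal (∫ y in r..s₁, (h y)⁻¹) := by
    rw [intervalIntegral.integral_of_le hrs.le, ← integral_Icc_eq_integral_Ioc,
      ofReal_integral_eq_lintegral_ofReal hhinv.continuousOn.integrableOn_Icc
        (Filter.Eventually.of_forall fun y => inv_nonneg.2 (hHr.le.trans (hlow y)))]
    refine setLIntegral_congr_fun measurableSet_Icc fun y hy => ?_
    have hy' : h y = H₁ P y := by simp only [hh, projIcc_of_mem hrs.le hy]
    rw [ENNReal.ofReal_inv_of_pos (hHr.trans_le (hlow y)), hy']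
  rw [hlint] at hint
  have hGtop : supNorm 𝕀 (γ (Fin.last m)) ≠ ∞ := by
    intro htop
    rw [htop, ENNReal.mul_top (by simpa using hT)] at hint
    exact absurd hint (by simp)
  set G := (supNorm 𝕀 (γ (Fin.last m))).toReal with hG
  have hG0 : 0 ≤ G := ENNReal.toReal_nonneg
  have hGT : G * T ≤ ∫ y in r..s₁, (h y)⁻¹ := by
    have h0 : 0 ≤ ∫ y in r..s₁, (h y)⁻¹ :=
      intervalIntegral.integral_nonneg hrs.le fun y _ => inv_nonneg.2 (hHr.le.trans (hlow y))
    rw [← ENNReal.ofReal_toReal hGtop, ← ENNReal.ofReal_mul hT.le,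
      ENNReal.ofReal_le_ofReal_iff h0] at hint
    linarith
  obtain ⟨w, hw0, hwd, hwle⟩ := exists_solution_autonomous hhc hHr hlow hupp G r
  have hd0 : ∀ t, 0 ≤ G * h (w t) := fun t => mul_nonneg hG0 (hHr.le.trans (hlow _))
  have hwmono : Monotone w := monotone_of_hasDerivAt_nonneg hwd hd0
  have hwc : Continuous w := continuous_iff_continuousAt.2 fun t => (hwd t).continuousAt
  have hwr : ∀ t ∈ Icc 0 T, r ≤ w t ∧ w t ≤ s₁ := fun t ht =>
    ⟨hw0 ▸ hwmono ht.1, hwle t s₁ ((mul_le_mul_of_nonneg_left ht.2 hG0).trans hGT)⟩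
  refine ⟨s₁, w, hs₁, hrs.le, fun t ht => ⟨hr0.trans (hwr t ht).1, (hwr t ht).2⟩, fun t ht => ?_⟩
  have ht0 := (hT₀ t ht).1
  have hbound : ∫⁻ s in Ioc 0 t,
      ENNReal.ofReal (mass (μ (Fin.last m)) (γ (Fin.last m)) s * H₁ P (w (t - s))) ≤
      ENNReal.ofReal (w t - r) := by
    have hcont : Continuous fun s => G * h (w (t - s)) :=
      continuous_const.mul (hhc.comp (hwc.comp (continuous_const.sub continuous_id)))
    have h1 : w t - r = ∫ s in Ioc 0 t, G * h (w (t - s)) := by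
      have h2 := intervalIntegral.integral_comp_sub_left (a := 0) (b := t)
        (fun s => G * h (w s)) t
      rw [sub_self, sub_zero, intervalIntegral.integral_of_le ht0] at h2
      rw [h2, intervalIntegral.integral_eq_sub_of_hasDerivAt (fun s _ => hwd s)
        ((continuous_const.mul (hhc.comp hwc)).intervalIntegrable _ _), hw0]
    rw [h1, ofReal_integral_eq_lintegral_ofReal
      (hcont.continuousOn.integrableOn_Icc.mono_set Ioc_subset_Icc_self)
      (Filter.Eventually.of_forall fun s => hd0 _)]
    refine setLIntegral_mono' measurableSet_Ioc fun s hs => ENNReal.ofReal_le_ofReal ?_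
    have hmem : w (t - s) ∈ Icc r s₁ := hwr _ ⟨by linarith [hs.2], by linarith [hs.1, hIT t ht]⟩
    have hheq : h (w (t - s)) = H₁ P (w (t - s)) := by
      simp only [hh, projIcc_of_mem hrs.le hmem]
    rw [hheq]
    refine mul_le_mul_of_nonneg_right ?_ (H₁_nonneg (hr0.trans hmem.1))
    have := mul_mass_le hGreen hT₀ (Fin.last m) (hord t ht ⟨hs.1.le, hs.2⟩) zero_le_one
    rw [one_mul, ENNReal.ofReal_one, one_mul] at this
    exact (ENNReal.ofReal_le_iff_le_toReal hGtop).1 this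
  refine (add_le_add_right hbound _).trans ?_
  rw [← ENNReal.ofReal_add hr0 (sub_nonneg.2 (hwr t ⟨ht0, hIT t ht⟩).1)]
  simp

end PowerSeries

/-! ### The density of the life times -/

section Functional

/-- Values of the density at negative times play no role. -/
theorem IsLifeDensity.indicator {ρ : ℝ → ℝ} (hρ : IsLifeDensity ρ) :
    IsLifeDensity ((Ici 0).indicator ρ) where
  continuousOn := hρ.continuousOn.congr fun t ht => indicator_of_mem ht ρ
  pos t ht := by rw [indicator_of_mem (show t ∈ Ici 0 from ht.le)]; exact hρ.pos t ht
  mass := by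
    rw [← hρ.mass]
    refine setLIntegral_congr_fun measurableSet_Ici fun t ht => ?_
    rw [indicator_of_mem ht]

theorem IsLifeDensity.measurable_indicator {ρ : ℝ → ℝ} (hρ : IsLifeDensity ρ) :
    Measurable ((Ici 0).indicator ρ) := by
  classical
  have := hρ.continuousOn.measurable_piecewise (g := (0 : ℝ → ℝ)) continuousOn_const measurableSet_Ici
  rwa [piecewise_eq_indicator] at this

theorem IsLifeDensity.nonneg {ρ : ℝ → ℝ} (hρ : IsLifeDensity ρ) {t : ℝ} (ht : 0 ≤ t) : 0 ≤ ρ t := by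
  have hcl : t ∈ closure (Ioi (0 : ℝ)) := by rw [closure_Ioi]; exact ht
  have h1 : Filter.NeBot (𝓝[Ioi 0] t) := mem_closure_iff_nhdsWithin_neBot.1 hcl
  exact ge_of_tendsto ((hρ.continuousOn t ht).mono Ioi_subset_Ici_self)
    (Filter.eventually_of_mem self_mem_nhdsWithin fun s hs => (hρ.pos s hs).le)

theorem IsLifeDensity.integrableOn {ρ : ℝ → ℝ} (hρ : IsLifeDensity ρ) :
    IntegrableOn ρ (Ici 0) := by
  refine ⟨hρ.continuousOn.aestronglyMeasurable measurableSet_Ici, ?_⟩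
  rw [hasFiniteIntegral_iff_ofReal ((ae_restrict_iff' measurableSet_Ici).2
    (Filter.Eventually.of_forall fun t ht => hρ.nonneg ht)), hρ.mass]
  exact ENNReal.one_lt_top

theorem IsLifeDensity.ofReal_tail {ρ : ℝ → ℝ} (hρ : IsLifeDensity ρ) {t : ℝ} (ht : 0 ≤ t) :
    ENNReal.ofReal (tail ρ t) = ∫⁻ s in Ioi t, ENNReal.ofReal (ρ s) :=
  ofReal_integral_eq_lintegral_ofReal (hρ.integrableOn.mono_set fun _ hs => ht.trans (le_of_lt hs))
    ((ae_restrict_iff' measurableSet_Ioi).2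
      (Filter.Eventually.of_forall fun _ hs => hρ.nonneg (ht.trans (le_of_lt hs))))

theorem IsLifeDensity.tail_pos {ρ : ℝ → ℝ} (hρ : IsLifeDensity ρ) {t : ℝ} (ht : 0 ≤ t) :
    0 < tail ρ t := by
  rw [← ENNReal.ofReal_pos, hρ.ofReal_tail ht, pos_iff_ne_zero, Ne,
    lintegral_eq_zero_iff' ?_]
  · intro h0
    have h1 := (ae_restrict_iff' measurableSet_Ioi).1 h0
    have h2 : volume (Ioi t) = 0 := by
      refine measure_mono_null (fun s hs => ?_) h1
      have hpos := hρ.pos s (lt_of_le_of_lt ht hs)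
      intro h3
      have := h3 hs
      simp only [Pi.zero_apply, ENNReal.ofReal_eq_zero] at this
      linarith
    simp at h2
  · exact ((hρ.integrableOn.mono_set fun _ hs => ht.trans (le_of_lt hs)).aemeasurable).ennreal_ofReal

theorem IsLifeDensity.measurable_tail {ρ : ℝ → ℝ} (hρ : IsLifeDensity ρ) :
    Measurable (tail ((Ici 0).indicator ρ)) := by
  have hint : Integrable ((Ici 0).indicator ρ) :=
    (integrable_indicator_iff measurableSet_Ici).2 hρ.integrableOn
  have h0 : ∀ s, 0 ≤ (Ici 0).indicator ρ s := indicator_nonneg fun s hs => hρ.nonneg hs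
  have : Antitone (tail ((Ici 0).indicator ρ)) := fun s t hst =>
    setIntegral_mono_set hint.integrableOn (Filter.Eventually.of_forall h0)
      (Ioi_subset_Ioi hst).eventuallyLE
  exact this.measurable

/-! ### Functoriality and measurability of the branching functional -/

section Comp

variable {Ω Ω' : Type*} (g : Ω → Ω') (τ : Particle → Ω' → ℝ) (I : Particle → Ω' → Fin (m + 1))
  (J : Particle → Ω' → ℕ) (Z : ℝ → Particle → Ω' → Space d) (t : ℝ)

theorem branchTime_comp (k : Particle) (ω : Ω) :
    branchTime (fun k ω => τ k (g ω)) t k ω = branchTime τ t k (g ω) := by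
  induction k with
  | nil => rfl
  | cons j k ih => simp only [branchTime, ih]

theorem lifeTime_comp (k : Particle) (ω : Ω) :
    lifeTime (fun k ω => τ k (g ω)) t k ω = lifeTime τ t k (g ω) := by
  cases k <;> simp only [lifeTime, branchTime_comp g τ]

theorem isBorn_comp (k : Particle) (ω : Ω) :
    IsBorn (fun k ω => τ k (g ω)) (fun k ω => J k (g ω)) t k ω ↔ IsBorn τ J t k (g ω) := by
  induction k with
  | nil => rfl
  | cons j k ih => simp only [IsBorn, ih, branchTime_comp g τ]

theorem population_comp (ω : Ω) :
    population (fun k ω => τ k (g ω)) (fun k ω => J k (g ω)) t ω = population τ J t (g ω) :=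
  Set.ext fun k => isBorn_comp g τ J t k ω

theorem alive_comp (ω : Ω) :
    alive (fun k ω => τ k (g ω)) (fun k ω => J k (g ω)) t ω = alive τ J t (g ω) := by
  simp only [alive, population_comp g τ J, branchTime_comp g τ]

theorem particleType_comp (k : Particle) (ω : Ω) :
    particleType (fun k ω => τ k (g ω)) (fun k ω => I k (g ω)) (fun k ω => J k (g ω)) t k ω =
      particleType τ I J t k (g ω) := by
  classical
  unfold particleType
  exact if_congr (by rw [alive_comp g τ J]) rfl rfl

theorem position_comp (x : Space d) (k : Particle) (ω : Ω) :
    position (fun t k ω => Z t k (g ω)) t x k ω = position Z t x k (g ω) := by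
  induction k with
  | nil => rfl
  | cons j k ih => simp only [position, ih]

theorem factor_comp (P : Problem m d) (γ : Fin (m + 1) → ℝ → Space d → ℝ) (ρ : ℝ → ℝ)
    (x : Space d) (k : Particle) (ω : Ω) :
    factor P γ ρ (fun k ω => τ k (g ω)) (fun k ω => I k (g ω)) (fun k ω => J k (g ω))
      (fun t k ω => Z t k (g ω)) t x k ω = factor P γ ρ τ I J Z t x k (g ω) := by
  classical
  unfold factor
  rw [particleType_comp g τ I J, lifeTime_comp g τ, position_comp g Z, branchTime_comp g τ]
  exact if_congr (by rw [alive_comp g τ J]) rfl rfl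

/-- The branching functional commutes with the pullback of the marks and displacements along a map
of probability spaces. -/
theorem xi_comp (P : Problem m d) (γ : Fin (m + 1) → ℝ → Space d → ℝ) (ρ : ℝ → ℝ) (x : Space d)
    (ω : Ω) :
    xi P γ ρ (fun k ω => τ k (g ω)) (fun k ω => I k (g ω)) (fun k ω => J k (g ω))
      (fun t k ω => Z t k (g ω)) t x ω = xi P γ ρ τ I J Z t x (g ω) := by
  have hpop := population_comp g τ J t ω
  by_cases h : (population τ J t (g ω)).Finite
  · have h' := h
    rw [← hpop] at h'
    rw [xi, xi, dif_pos h', dif_pos h]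
    refine Finset.prod_congr (by simp only [hpop]) fun k _ => factor_comp g τ I J Z t P γ ρ x k ω
  · have h' := h
    rw [← hpop] at h'
    rw [xi, xi, dif_neg h', dif_neg h]

end Comp

section Congr

variable {Ω : Type*} {τ : Particle → Ω → ℝ} {I : Particle → Ω → Fin (m + 1)}
  {J : Particle → Ω → ℕ} {Z Z' : ℝ → Particle → Ω → Space d} {t : ℝ}

theorem position_congr {ω : Ω} (h : ∀ k ∈ population τ J t ω, Z t k ω = Z' t k ω) (x : Space d)
    {k : Particle} (hk : k ∈ population τ J t ω) : position Z t x k ω = position Z' t x k ω := by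
  induction k with
  | nil => simp only [position, h [] hk]
  | cons j k ih => simp only [position, h _ hk, ih hk.1]

/-- The branching functional depends only on the displacements of the particles that are born. -/
theorem xi_congr (P : Problem m d) (γ : Fin (m + 1) → ℝ → Space d → ℝ) (ρ : ℝ → ℝ) (x : Space d)
    {ω : Ω} (h : ∀ k ∈ population τ J t ω, Z t k ω = Z' t k ω) :
    xi P γ ρ τ I J Z t x ω = xi P γ ρ τ I J Z' t x ω := by
  unfold xi
  split_ifs with hfin
  · refine Finset.prod_congr rfl fun k hk => ?_
    rw [Set.Finite.mem_toFinset] at hk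
    simp only [factor, h k hk, position_congr h x hk]
  · rfl

theorem branchTime_le (t : ℝ) (k : Particle) (ω : Ω) : branchTime τ t k ω ≤ t := by
  cases k <;> exact min_le_left _ _

theorem lifeTime_nonneg (ht : 0 ≤ t) {ω : Ω} (hτ : ∀ k, 0 ≤ τ k ω) (k : Particle) :
    0 ≤ lifeTime τ t k ω := by
  cases k with
  | nil => exact sub_nonneg.2 (le_min ht (by simpa using hτ []))
  | cons j k =>
    exact sub_nonneg.2 (le_min (branchTime_le t k ω) (le_add_of_nonneg_right (hτ _)))

theorem tail_indicator {ρ : ℝ → ℝ} {t : ℝ} (ht : 0 ≤ t) : tail ((Ici 0).indicator ρ) t = tail ρ t :=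
  setIntegral_congr_fun measurableSet_Ioi fun _ hs =>
    indicator_of_mem (show _ ∈ Ici (0 : ℝ) from ht.trans (le_of_lt hs)) ρ

/-- The branching functional evaluates the density only at life times, which are nonnegative. -/
theorem xi_indicator (P : Problem m d) (γ : Fin (m + 1) → ℝ → Space d → ℝ) (ρ : ℝ → ℝ)
    (x : Space d) (ht : 0 ≤ t) {ω : Ω} (hτ : ∀ k, 0 ≤ τ k ω) :
    xi P γ ((Ici 0).indicator ρ) τ I J Z t x ω = xi P γ ρ τ I J Z t x ω := by
  have hl := lifeTime_nonneg ht hτ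
  have hf : ∀ k, factor P γ ((Ici 0).indicator ρ) τ I J Z t x k ω =
      factor P γ ρ τ I J Z t x k ω := fun k => by
    simp only [factor, tail_indicator (hl k),
      indicator_of_mem (show lifeTime τ t k ω ∈ Ici 0 from hl k)]
  simp only [xi, hf]

end Congr

section Measurability

variable {Ω : Type*} [MeasurableSpace Ω] {τ : Particle → Ω → ℝ} {I : Particle → Ω → Fin (m + 1)}
  {J : Particle → Ω → ℕ} {Z : ℝ → Particle → Ω → Space d}

theorem measurable_branchTime (hτ : ∀ k, Measurable (τ k)) (t : ℝ) (k : Particle) :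
    Measurable (branchTime τ t k) := by
  induction k with
  | nil => exact measurable_const.min (measurable_const.add (hτ _))
  | cons j k ih => exact measurable_const.min (ih.add (hτ _))

theorem measurable_lifeTime (hτ : ∀ k, Measurable (τ k)) (t : ℝ) (k : Particle) :
    Measurable (lifeTime τ t k) := by
  cases k with
  | nil => exact (measurable_branchTime hτ t _).sub measurable_const
  | cons j k => exact (measurable_branchTime hτ t _).sub (measurable_branchTime hτ t _)

theorem measurableSet_isBorn (hτ : ∀ k, Measurable (τ k)) (hJ : ∀ k, Measurable (J k)) (t : ℝ)
    (k : Particle) : MeasurableSet {ω | k ∈ population τ J t ω} := by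
  induction k with
  | nil => exact MeasurableSet.univ
  | cons j k ih =>
    refine ih.inter ((measurableSet_lt (measurable_branchTime hτ t k) measurable_const).inter
      ((MeasurableSet.const _).inter (measurableSet_le measurable_const (hJ k))))

theorem measurableSet_alive (hτ : ∀ k, Measurable (τ k)) (hJ : ∀ k, Measurable (J k)) (t : ℝ)
    (k : Particle) : MeasurableSet {ω | k ∈ alive τ J t ω} :=
  (measurableSet_isBorn hτ hJ t k).inter
    (measurableSet_eq_fun (measurable_branchTime hτ t k) measurable_const)

theorem measurable_particleType (hτ : ∀ k, Measurable (τ k)) (hI : ∀ k, Measurable (I k))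
    (hJ : ∀ k, Measurable (J k)) (t : ℝ) (k : Particle) :
    Measurable (particleType τ I J t k) := by
  classical
  exact Measurable.ite (measurableSet_alive hτ hJ t k) (hI k) measurable_const

theorem measurableSet_population_eq (hτ : ∀ k, Measurable (τ k)) (hJ : ∀ k, Measurable (J k))
    (t : ℝ) (S : Set Particle) : MeasurableSet {ω | population τ J t ω = S} := by
  have : {ω | population τ J t ω = S} = ⋂ k, {ω | k ∈ population τ J t ω ↔ k ∈ S} := by
    ext ω
    simp [Set.ext_iff]
  rw [this]
  exact MeasurableSet.iInter fun k =>
    (measurableSet_isBorn hτ hJ t k).iff (MeasurableSet.const _)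

theorem measurable_position (hZ : ∀ k, Measurable (Z t k)) (x : Space d) (k : Particle) :
    Measurable (position Z t x k) := by
  induction k with
  | nil => exact measurable_const.sub (hZ _)
  | cons j k ih => exact ih.sub (hZ _)

theorem measurable_factor {P : Problem m d} {γ : Fin (m + 1) → ℝ → Space d → ℝ}
    (hγ : ∀ n, Measurable (Function.uncurry (γ n))) {ρ : ℝ → ℝ} (hρ : Measurable ρ)
    (hρ' : Measurable (tail ρ))
    (hτ : ∀ k, Measurable (τ k)) (hI : ∀ k, Measurable (I k)) (hJ : ∀ k, Measurable (J k))
    {t : ℝ} (hZ : ∀ k, Measurable (Z t k)) (x : Space d) (k : Particle) :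
    Measurable (factor P γ ρ τ I J Z t x k) := by
  classical
  have hγ' : Measurable fun z : Fin (m + 1) × ℝ × Space d => γ z.1 z.2.1 z.2.2 :=
    measurable_from_prod_countable_right fun n => hγ n
  have hc : Measurable fun z : ℕ × (ℝ≥0 × Space d) => P.c z.1 z.2 :=
    measurable_from_prod_countable_right fun j => (P.c j).continuous.measurable
  have hf : Measurable fun z : Fin (m + 1) × Space d => P.f z.1 z.2 :=
    measurable_from_prod_countable_right fun j => (P.f j).continuous.measurable
  have hl := measurable_lifeTime hτ t k
  have hty := measurable_particleType hτ hI hJ t k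
  have hpos := measurable_position hZ x k
  refine Measurable.ite (measurableSet_alive hτ hJ t k) ?_ ?_
  · exact ((hγ'.comp (hty.prodMk (hl.prodMk (hZ k)))).div (hρ'.comp hl)).mul
      (hf.comp (hty.prodMk hpos))
  · exact ((hγ'.comp (measurable_const.prodMk (hl.prodMk (hZ k)))).div (hρ.comp hl)).mul
      (hc.comp ((hJ k).prodMk (((measurable_const.sub
        (measurable_branchTime hτ t k)).real_toNNReal).prodMk hpos)))

/-- The branching functional is measurable, since there are only countably many finite
populations. -/
theorem measurable_xi {P : Problem m d} {γ : Fin (m + 1) → ℝ → Space d → ℝ}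
    (hγ : ∀ n, Measurable (Function.uncurry (γ n))) {ρ : ℝ → ℝ} (hρ : Measurable ρ)
    (hρ' : Measurable (tail ρ))
    (hτ : ∀ k, Measurable (τ k)) (hI : ∀ k, Measurable (I k)) (hJ : ∀ k, Measurable (J k))
    {t : ℝ} (hZ : ∀ k, Measurable (Z t k)) (x : Space d) :
    Measurable (xi P γ ρ τ I J Z t x) := by
  classical
  intro A hA
  -- decompose the event according to the population, if it is finite
  have hrep : xi P γ ρ τ I J Z t x ⁻¹' A =
      (⋃ S : Finset Particle, {ω | population τ J t ω = (S : Set Particle)} ∩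
        (fun ω => ∏ k ∈ S, factor P γ ρ τ I J Z t x k ω) ⁻¹' A) ∪
      ((⋂ S : Finset Particle, {ω | population τ J t ω = (S : Set Particle)}ᶜ) ∩
        {_ω | (0 : ℝ) ∈ A}) := by
    ext ω
    simp only [mem_preimage, mem_union, mem_iUnion, mem_inter_iff, Set.mem_ofPred_eq, mem_iInter,
      mem_compl_iff]
    by_cases h : (population τ J t ω).Finite
    · have hxi : xi P γ ρ τ I J Z t x ω = ∏ k ∈ h.toFinset, factor P γ ρ τ I J Z t x k ω := by
        rw [xi, dif_pos h]
      constructor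
      · intro hA
        exact Or.inl ⟨h.toFinset, by simp, hxi ▸ hA⟩
      · rintro (⟨S, hS, hSA⟩ | ⟨hno, -⟩)
        · have : h.toFinset = S := by
            rw [← Finset.coe_inj, ← hS]
            simp
          rw [hxi, this]
          exact hSA
        · exact absurd (by simp) (hno h.toFinset)
    · have hxi : xi P γ ρ τ I J Z t x ω = 0 := by rw [xi, dif_neg h]
      have hno : ∀ S : Finset Particle, ¬ population τ J t ω = (S : Set Particle) := fun S hS =>
        h (hS ▸ S.finite_toSet)
      rw [hxi]
      constructor
      · exact fun h0 => Or.inr ⟨hno, h0⟩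
      · rintro (⟨S, hS, -⟩ | ⟨-, h0⟩)
        · exact absurd hS (hno S)
        · exact h0
  rw [hrep]
  refine MeasurableSet.union (MeasurableSet.iUnion fun S => ?_)
    ((MeasurableSet.iInter fun S => ?_).inter (MeasurableSet.const _))
  · exact (measurableSet_population_eq hτ hJ t _).inter
      ((Finset.measurable_fun_prod S fun k _ => measurable_factor hγ hρ hρ' hτ hI hJ hZ x k) hA)
  · exact (measurableSet_population_eq hτ hJ t _).compl

end Measurability

end Functional

/-! ### The law of the branching mechanism -/

section Law

/-- The marks `(τ_k, I^0_k, J_k)` of a particle. -/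
abbrev Mark (m : ℕ) := ℝ × Fin (m + 1) × ℕ

/-- The law `ρ(t) 1_{t ≥ 0} dt` of the life times. -/
def lifeLaw (ρ : ℝ → ℝ) : Measure ℝ :=
  (volume.restrict (Ici (0 : ℝ))).withDensity fun t => ENNReal.ofReal (ρ t)

/-- The law `∑_n p_n δ_n` of the types. -/
def typeLaw (P : Problem m d) : Measure (Fin (m + 1)) :=
  Measure.sum fun n => ENNReal.ofReal (P.p n) • Measure.dirac n

/-- The law `∑_j q_j δ_j` of the numbers of children. -/
def offspringLaw (P : Problem m d) : Measure ℕ :=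
  Measure.sum fun j => ENNReal.ofReal (P.q j) • Measure.dirac j

/-- The law of the marks of a particle. -/
def markLaw (P : Problem m d) (ρ : ℝ → ℝ) : Measure (Mark m) :=
  (lifeLaw ρ).prod ((typeLaw P).prod (offspringLaw P))

theorem IsLifeDensity.isProbabilityMeasure {ρ : ℝ → ℝ} (hρ : IsLifeDensity ρ) :
    IsProbabilityMeasure (lifeLaw ρ) :=
  ⟨by rw [lifeLaw, withDensity_apply _ MeasurableSet.univ, Measure.restrict_univ, hρ.mass]⟩

instance (P : Problem m d) : IsProbabilityMeasure (typeLaw P) := by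
  refine ⟨?_⟩
  simp only [typeLaw, Measure.sum_apply _ MeasurableSet.univ, Measure.smul_apply, measure_univ,
    smul_eq_mul, mul_one]
  rw [tsum_fintype, ← ENNReal.ofReal_sum_of_nonneg fun n _ => (P.p_pos n).le, P.p_sum,
    ENNReal.ofReal_one]

instance (P : Problem m d) : IsProbabilityMeasure (offspringLaw P) := by
  refine ⟨?_⟩
  simp only [offspringLaw, Measure.sum_apply _ MeasurableSet.univ, Measure.smul_apply, measure_univ,
    smul_eq_mul, mul_one]
  rw [← ENNReal.ofReal_tsum_of_nonneg P.q_nonneg P.q_sum.summable, P.q_sum.tsum_eq,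
    ENNReal.ofReal_one]

theorem typeLaw_singleton (P : Problem m d) (n : Fin (m + 1)) :
    typeLaw P {n} = ENNReal.ofReal (P.p n) := by
  classical
  simp only [typeLaw, Measure.sum_apply _ (measurableSet_singleton n), Measure.smul_apply,
    smul_eq_mul]
  rw [tsum_eq_single n]
  · simp
  · intro b hb
    simp [hb]

theorem offspringLaw_singleton (P : Problem m d) (j : ℕ) :
    offspringLaw P {j} = ENNReal.ofReal (P.q j) := by
  simp only [offspringLaw, Measure.sum_apply _ (measurableSet_singleton j), Measure.smul_apply,
    smul_eq_mul]
  rw [tsum_eq_single j]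
  · simp
  · intro b hb
    simp [hb]

variable {P : Problem m d} {𝕀 : Set ℝ} {μ : Fin (m + 1) → Kernel ℝ (Space d)} {ρ : ℝ → ℝ}

namespace BranchingMechanism

variable {Ω : Type*} [MeasurableSpace Ω] {Pr : Measure Ω} [IsProbabilityMeasure Pr]
  {τ : Particle → Ω → ℝ} {I : Particle → Ω → Fin (m + 1)} {J : Particle → Ω → ℕ}
  {Z : ℝ → Particle → Ω → Space d}

theorem map_mark (h : BranchingMechanism P 𝕀 μ ρ Pr τ I J Z) (k : Particle) :
    Pr.map (fun ω => (τ k ω, I k ω, J k ω)) = markLaw P ρ := by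
  have h1 := (indepFun_iff_map_prod_eq_prod_map_map (h.measurable_τ k).aemeasurable
    ((h.measurable_I k).prodMk (h.measurable_J k)).aemeasurable).1 (h.indep_marks k).1
  have h2 := (indepFun_iff_map_prod_eq_prod_map_map (h.measurable_I k).aemeasurable
    (h.measurable_J k).aemeasurable).1 (h.indep_marks k).2
  have hI : Pr.map (I k) = typeLaw P := Measure.ext_of_singleton fun n => by
    rw [Measure.map_apply (h.measurable_I k) (measurableSet_singleton n), h.law_I,
      typeLaw_singleton]
  have hJ : Pr.map (J k) = offspringLaw P := Measure.ext_of_singleton fun n => by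
    rw [Measure.map_apply (h.measurable_J k) (measurableSet_singleton n), h.law_J,
      offspringLaw_singleton]
  rw [h1, h2, hI, hJ, h.law_τ k]
  rfl

theorem map_marks (h : BranchingMechanism P 𝕀 μ ρ Pr τ I J Z) :
    Pr.map (fun ω k => (τ k ω, I k ω, J k ω)) = Measure.infinitePi fun _ => markLaw P ρ := by
  rw [h.indep_particles.map_fun_eq_infinitePi_map fun k =>
    (h.measurable_τ k).prodMk ((h.measurable_I k).prodMk (h.measurable_J k))]
  simp only [h.map_mark]

end BranchingMechanism

/-! ### The law of marks and displacements -/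

section PathLaw

/-- The paths: the marks of all particles and their displacements. -/
abbrev PathSpace (m d : ℕ) := (Particle → Mark m) × (Particle → Space d)

variable {Ω : Type*} [MeasurableSpace Ω]

open Classical in
/-- The path of a branching process, where the displacements of the particles that are not born
before `t` are replaced by `0`. -/
def path (τ : Particle → Ω → ℝ) (I : Particle → Ω → Fin (m + 1)) (J : Particle → Ω → ℕ)
    (Z : ℝ → Particle → Ω → Space d) (t : ℝ) (ω : Ω) : PathSpace m d :=
  (fun k => (τ k ω, I k ω, J k ω), fun k => if k ∈ population τ J t ω then Z t k ω else 0)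

omit [MeasurableSpace Ω] in
theorem path_snd_of_mem {τ : Particle → Ω → ℝ} {I : Particle → Ω → Fin (m + 1)}
    {J : Particle → Ω → ℕ} {Z : ℝ → Particle → Ω → Space d} {t : ℝ} {ω : Ω} {k : Particle}
    (hk : k ∈ population τ J t ω) : (path τ I J Z t ω).2 k = Z t k ω := if_pos hk

omit [MeasurableSpace Ω] in
theorem path_snd_of_notMem {τ : Particle → Ω → ℝ} {I : Particle → Ω → Fin (m + 1)}
    {J : Particle → Ω → ℕ} {Z : ℝ → Particle → Ω → Space d} {t : ℝ} {ω : Ω} {k : Particle}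
    (hk : k ∉ population τ J t ω) : (path τ I J Z t ω).2 k = 0 := if_neg hk

/-- The branching functional on the space of paths. -/
def pathXi (P : Problem m d) (γ : Fin (m + 1) → ℝ → Space d → ℝ) (ρ : ℝ → ℝ) (t : ℝ)
    (x : Space d) : PathSpace m d → ℝ :=
  xi P γ ρ (fun k w => (w.1 k).1) (fun k w => (w.1 k).2.1) (fun k w => (w.1 k).2.2)
    (fun _ k w => w.2 k) t x

omit [MeasurableSpace Ω] in
theorem xi_eq_pathXi (P : Problem m d) (γ : Fin (m + 1) → ℝ → Space d → ℝ) (ρ : ℝ → ℝ)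
    (τ : Particle → Ω → ℝ) (I : Particle → Ω → Fin (m + 1))
    (J : Particle → Ω → ℕ) (Z : ℝ → Particle → Ω → Space d) (t : ℝ) (x : Space d) :
    xi P γ ρ τ I J Z t x = pathXi P γ ρ t x ∘ path τ I J Z t := by
  funext ω
  rw [Function.comp_apply, pathXi, ← xi_comp (path τ I J Z t)]
  exact xi_congr P γ ρ x fun k hk => (path_snd_of_mem hk).symm

/-- What the law of the paths up to time `t` depends on: the marks are i.i.d., and, given the
marks, the displacements of the particles born before `t` are independent with laws
`μ_{I^t_k}(ΔT^t_k, ·)`. -/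
structure HasPathLaw (P : Problem m d) (μ : Fin (m + 1) → Kernel ℝ (Space d)) (ρ : ℝ → ℝ)
    (Pr : Measure Ω) (τ : Particle → Ω → ℝ) (I : Particle → Ω → Fin (m + 1))
    (J : Particle → Ω → ℕ) (Z : ℝ → Particle → Ω → Space d) (t : ℝ) : Prop where
  measurable_τ : ∀ k, Measurable (τ k)
  measurable_I : ∀ k, Measurable (I k)
  measurable_J : ∀ k, Measurable (J k)
  measurable_Z : ∀ k, Measurable (Z t k)
  map_marks : Pr.map (fun ω k => (τ k ω, I k ω, J k ω)) = Measure.infinitePi fun _ => markLaw P ρ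
  law_Z : ∀ S : Finset Particle, ∀ A : Particle → Set (Space d), (∀ k, MeasurableSet (A k)) →
    ∀ B : Set (Particle → Mark m), MeasurableSet B →
      (∀ ω, (fun k => (τ k ω, I k ω, J k ω)) ∈ B → ∀ k ∈ S, k ∈ population τ J t ω) →
      Pr ((fun ω k => (τ k ω, I k ω, J k ω)) ⁻¹' B ∩ ⋂ k ∈ S, Z t k ⁻¹' A k) =
        ∫⁻ ω in (fun ω k => (τ k ω, I k ω, J k ω)) ⁻¹' B,
          ∏ k ∈ S, μ (particleType τ I J t k ω) (lifeTime τ t k ω) (A k) ∂Pr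

theorem BranchingMechanism.hasPathLaw {Pr : Measure Ω} [IsProbabilityMeasure Pr]
    {τ : Particle → Ω → ℝ} {I : Particle → Ω → Fin (m + 1)} {J : Particle → Ω → ℕ}
    {Z : ℝ → Particle → Ω → Space d} (h : BranchingMechanism P 𝕀 μ ρ Pr τ I J Z) {t : ℝ}
    (ht : t ∈ 𝕀) : HasPathLaw P μ ρ Pr τ I J Z t where
  measurable_τ := h.measurable_τ
  measurable_I := h.measurable_I
  measurable_J := h.measurable_J
  measurable_Z := h.measurable_Z t ht
  map_marks := h.map_marks
  law_Z S A hA B hB hBS := h.law_Z t ht S A hA _ ⟨B, hB, rfl⟩ hBS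

/-- The life times on the space of marks. -/
def markτ (k : Particle) (w : Particle → Mark m) : ℝ := (w k).1
/-- The types on the space of marks. -/
def markI (k : Particle) (w : Particle → Mark m) : Fin (m + 1) := (w k).2.1
/-- The numbers of children on the space of marks. -/
def markJ (k : Particle) (w : Particle → Mark m) : ℕ := (w k).2.2

theorem measurable_markτ (k : Particle) : Measurable (markτ (m := m) k) :=
  measurable_fst.comp (measurable_pi_apply k)
theorem measurable_markI (k : Particle) : Measurable (markI (m := m) k) :=
  measurable_fst.comp (measurable_snd.comp (measurable_pi_apply k))
theorem measurable_markJ (k : Particle) : Measurable (markJ (m := m) k) :=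
  measurable_snd.comp (measurable_snd.comp (measurable_pi_apply k))

namespace HasPathLaw

variable {Pr : Measure Ω} {τ : Particle → Ω → ℝ} {I : Particle → Ω → Fin (m + 1)}
  {J : Particle → Ω → ℕ} {Z : ℝ → Particle → Ω → Space d} {t : ℝ}

theorem measurable_marks (h : HasPathLaw P μ ρ Pr τ I J Z t) :
    Measurable fun ω k => (τ k ω, I k ω, J k ω) :=
  measurable_pi_lambda _ fun k =>
    (h.measurable_τ k).prodMk ((h.measurable_I k).prodMk (h.measurable_J k))

theorem measurable_path (h : HasPathLaw P μ ρ Pr τ I J Z t) : Measurable (path τ I J Z t) := by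
  classical
  exact h.measurable_marks.prodMk (measurable_pi_lambda _ fun k =>
    Measurable.ite (measurableSet_isBorn h.measurable_τ h.measurable_J t k) (h.measurable_Z k)
      measurable_const)

open Classical in
/-- The particles of `S` which are born before `t`. -/
def bornIn (t : ℝ) (S : Finset Particle) (w : Particle → Mark m) : Finset Particle :=
  S.filter fun k => k ∈ population markτ markJ t w

theorem measurableSet_bornIn (t : ℝ) (S S' : Finset Particle) :
    MeasurableSet {w : Particle → Mark m | bornIn t S w = S'} := by
  have : {w : Particle → Mark m | bornIn t S w = S'} =
      ⋂ k, {w | (k ∈ S ∧ k ∈ population markτ markJ t w) ↔ k ∈ S'} := by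
    ext w
    simp [bornIn, Finset.ext_iff]
  rw [this]
  exact MeasurableSet.iInter fun k => ((MeasurableSet.const _).inter
    (measurableSet_isBorn measurable_markτ measurable_markJ t k)).iff (MeasurableSet.const _)

/-- On the event that `S'` is the set of the particles of `S` born before `t`, the displacements of
the particles in `S'` have their conditional laws, and the other ones are `0`. -/
theorem measure_cylinder [∀ n, IsMarkovKernel (μ n)] (h : HasPathLaw P μ ρ Pr τ I J Z t) {B : Set (Particle → Mark m)}
    (hB : MeasurableSet B) (S S' : Finset Particle) (hS' : S' ⊆ S) {A : Particle → Set (Space d)}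
    (hA : ∀ k, MeasurableSet (A k)) :
    Pr (path τ I J Z t ⁻¹' ((B ×ˢ (S : Set Particle).pi A) ∩ {w | bornIn t S w.1 = S'})) =
      (∏ k ∈ S \ S', Measure.dirac 0 (A k)) * ∫⁻ w in B ∩ {w | bornIn t S w = S'},
        ∏ k ∈ S', μ (particleType markτ markI markJ t k w) (lifeTime markτ t k w) (A k)
          ∂(Measure.infinitePi fun _ => markLaw P ρ) := by
  classical
  set B' := B ∩ {w : Particle → Mark m | bornIn t S w = S'} with hB'def
  have hB' : MeasurableSet B' := hB.inter (measurableSet_bornIn t S S')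
  set mk : Ω → Particle → Mark m := fun ω k => (τ k ω, I k ω, J k ω) with hmk
  have hpop : ∀ ω, population τ J t ω = population markτ markJ t (mk ω) := fun ω =>
    population_comp mk markτ markJ t ω
  have hmem : ∀ ω, mk ω ∈ B' → ∀ k ∈ S, (k ∈ population τ J t ω ↔ k ∈ S') := by
    intro ω hω k hk
    have := hω.2
    simp only [Set.mem_ofPred_eq, bornIn] at this
    rw [← this, Finset.mem_filter, hpop]
    exact ⟨fun h => ⟨hk, h⟩, fun h => h.2⟩
  have hset : path τ I J Z t ⁻¹' ((B ×ˢ (S : Set Particle).pi A) ∩ {w | bornIn t S w.1 = S'}) =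
      {ω | ∀ k ∈ S \ S', (0 : Space d) ∈ A k} ∩ (mk ⁻¹' B' ∩ ⋂ k ∈ S', Z t k ⁻¹' A k) := by
    ext ω
    simp only [mem_preimage, mem_inter_iff, mem_prod, Set.mem_ofPred_eq, mem_iInter]
    constructor
    · rintro ⟨⟨h1, h2⟩, h3⟩
      have hωB' : mk ω ∈ B' := ⟨h1, h3⟩
      refine ⟨fun k hk => ?_, hωB', fun k hk => ?_⟩
      · have hk' := Finset.mem_sdiff.1 hk
        have := h2 k hk'.1
        rwa [path_snd_of_notMem (fun hh => hk'.2 ((hmem ω hωB' k hk'.1).1 hh))] at this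
      · have := h2 k (hS' hk)
        rwa [path_snd_of_mem ((hmem ω hωB' k (hS' hk)).2 hk)] at this
    · rintro ⟨h1, hωB', h2⟩
      refine ⟨⟨hωB'.1, fun k hk => ?_⟩, hωB'.2⟩
      by_cases hk' : k ∈ S'
      · rw [path_snd_of_mem ((hmem ω hωB' k hk).2 hk')]
        exact h2 k hk'
      · rw [path_snd_of_notMem (fun hh => hk' ((hmem ω hωB' k hk).1 hh))]
        exact h1 k (Finset.mem_sdiff.2 ⟨hk, hk'⟩)
  rw [hset]
  by_cases h0 : ∀ k ∈ S \ S', (0 : Space d) ∈ A k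
  · have h1 : ∏ k ∈ S \ S', Measure.dirac (0 : Space d) (A k) = 1 :=
      Finset.prod_eq_one fun k hk => by
        rw [Measure.dirac_apply' _ (hA k), indicator_of_mem (h0 k hk)]
        rfl
    rw [h1, one_mul, show {ω : Ω | ∀ k ∈ S \ S', (0 : Space d) ∈ A k} = univ from
      eq_univ_of_forall fun _ => h0, univ_inter,
      h.law_Z S' A hA B' hB' fun ω hω k hk => (hmem ω hω k (hS' hk)).2 hk, ← h.map_marks,
      setLIntegral_map hB' ?_ h.measurable_marks]
    · refine lintegral_congr fun ω => Finset.prod_congr rfl fun k _ => ?_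
      rw [← particleType_comp mk markτ markI markJ, ← lifeTime_comp mk markτ]
      rfl
    · refine Finset.measurable_fun_prod _ fun k _ => ?_
      have hker : Measurable fun z : Fin (m + 1) × ℝ => μ z.1 z.2 (A k) :=
        measurable_from_prod_countable_right fun n => (μ n).measurable_coe (hA k)
      exact hker.comp ((measurable_particleType measurable_markτ measurable_markI measurable_markJ
        t k).prodMk (measurable_lifeTime measurable_markτ t k))
  · have h1 : ∏ k ∈ S \ S', Measure.dirac (0 : Space d) (A k) = 0 := by
      push Not at h0
      obtain ⟨k, hk, hk0⟩ := h0
      refine Finset.prod_eq_zero hk ?_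
      rw [Measure.dirac_apply' _ (hA k), indicator_of_notMem hk0]
    rw [h1, zero_mul, show {ω : Ω | ∀ k ∈ S \ S', (0 : Space d) ∈ A k} = ∅ from
      eq_empty_of_forall_notMem fun _ hh => h0 hh, empty_inter, measure_empty]

/-- The law of the path is determined by the conditions in `HasPathLaw`. -/
theorem map_path_eq [∀ n, IsMarkovKernel (μ n)] [IsProbabilityMeasure Pr]
    (h : HasPathLaw P μ ρ Pr τ I J Z t) {Ω' : Type*} [MeasurableSpace Ω'] {Pr' : Measure Ω'}
    {τ' : Particle → Ω' → ℝ} {I' : Particle → Ω' → Fin (m + 1)} {J' : Particle → Ω' → ℕ}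
    {Z' : ℝ → Particle → Ω' → Space d} (h' : HasPathLaw P μ ρ Pr' τ' I' J' Z' t) :
    Pr.map (path τ I J Z t) = Pr'.map (path τ' I' J' Z' t) := by
  have hcyl : ∀ (B : Set (Particle → Mark m)) (S : Finset Particle) (A : Particle → Set (Space d)),
      MeasurableSet B → (∀ k, MeasurableSet (A k)) →
      Pr.map (path τ I J Z t) (B ×ˢ (S : Set Particle).pi A) =
        Pr'.map (path τ' I' J' Z' t) (B ×ˢ (S : Set Particle).pi A) := by
    intro B S A hB hA
    have hR : MeasurableSet (B ×ˢ (S : Set Particle).pi A) :=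
      hB.prod (MeasurableSet.pi S.countable_toSet fun k _ => hA k)
    have hf : ∀ S' ∈ S.powerset, MeasurableSet
        ((fun w : PathSpace m d => bornIn t S w.1) ⁻¹' {S'}) := fun S' _ =>
      measurable_fst (measurableSet_bornIn t S S')
    have huniv : (fun w : PathSpace m d => bornIn t S w.1) ⁻¹' ↑S.powerset = univ :=
      eq_univ_of_forall fun w => by
        classical
        simp only [mem_preimage, Finset.mem_coe, Finset.mem_powerset]
        exact Finset.filter_subset _ _
    -- decompose according to the set of the particles of `S` which are born before `t`
    have key : ∀ ν : Measure (PathSpace m d), ν (B ×ˢ (S : Set Particle).pi A) =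
        ∑ S' ∈ S.powerset, ν ((B ×ˢ (S : Set Particle).pi A) ∩ {w | bornIn t S w.1 = S'}) := by
      intro ν
      have := sum_measure_preimage_singleton (μ := ν.restrict (B ×ˢ (S : Set Particle).pi A))
        S.powerset hf
      rw [huniv, Measure.restrict_apply MeasurableSet.univ, univ_inter] at this
      rw [← this]
      refine Finset.sum_congr rfl fun S' hS' => ?_
      rw [Measure.restrict_apply (hf S' hS'), inter_comm]
      rfl
    rw [key, key]
    refine Finset.sum_congr rfl fun S' hS' => ?_
    have hm : MeasurableSet ((B ×ˢ (S : Set Particle).pi A) ∩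
        {w : PathSpace m d | bornIn t S w.1 = S'}) := hR.inter (hf S' hS')
    have hsub := Finset.mem_powerset.1 hS'
    rw [Measure.map_apply h.measurable_path hm, Measure.map_apply h'.measurable_path hm]
    exact (h.measure_cylinder hB S S' hsub hA).trans (h'.measure_cylinder hB S S' hsub hA).symm
  have hfin : IsFiniteMeasure (Pr.map (path τ I J Z t)) := inferInstance
  refine Measure.ext_prod fun {B A} hB hA => ?_
  -- for fixed `B`, both sides are finite measures in `A`, which agree on square cylinders
  set ν := ((Pr.map (path τ I J Z t)).restrict (B ×ˢ univ)).map Prod.snd with hν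
  set ν' := ((Pr'.map (path τ' I' J' Z' t)).restrict (B ×ˢ univ)).map Prod.snd with hν'
  have hval : ∀ (Q : Measure (PathSpace m d)) (A : Set (Particle → Space d)), MeasurableSet A →
      ((Q.restrict (B ×ˢ univ)).map Prod.snd) A = Q (B ×ˢ A) := by
    intro Q A hA
    rw [Measure.map_apply measurable_snd hA, Measure.restrict_apply (measurable_snd hA)]
    congr 1
    ext w
    simp [and_comm]
  rw [← hval _ A hA, ← hval _ A hA]
  suffices ν = ν' by rw [← hν, ← hν', this]
  refine ext_of_generate_finite _ (generateFrom_squareCylinders (ι := Particle)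
    (α := fun _ => Space d)).symm (isPiSystem_squareCylinders (fun _ =>
      MeasurableSpace.isPiSystem_measurableSet) fun _ => by simp) ?_ ?_
  · rintro _ ⟨S, A, hA, rfl⟩
    have hA' : ∀ k, MeasurableSet (A k) := fun k => hA k (mem_univ k)
    rw [hν, hν', hval _ _ (MeasurableSet.pi S.countable_toSet fun k _ => hA' k),
      hval _ _ (MeasurableSet.pi S.countable_toSet fun k _ => hA' k)]
    exact hcyl B S A hB hA'
  · have := hcyl B ∅ (fun _ => univ) hB fun _ => MeasurableSet.univ
    rw [hν, hν', hval _ _ MeasurableSet.univ, hval _ _ MeasurableSet.univ]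
    simpa using this

/-- Integrals of the branching functional depend only on the law of the path. -/
theorem xi_transfer [∀ n, IsMarkovKernel (μ n)] [IsProbabilityMeasure Pr]
    (h : HasPathLaw P μ ρ Pr τ I J Z t) {Ω' : Type*} [MeasurableSpace Ω'] {Pr' : Measure Ω'}
    {τ' : Particle → Ω' → ℝ} {I' : Particle → Ω' → Fin (m + 1)} {J' : Particle → Ω' → ℕ}
    {Z' : ℝ → Particle → Ω' → Space d} (h' : HasPathLaw P μ ρ Pr' τ' I' J' Z' t)
    {γ : Fin (m + 1) → ℝ → Space d → ℝ} (hγ : ∀ n, Measurable (Function.uncurry (γ n)))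
    (hρ : Measurable ρ) (hρ' : Measurable (tail ρ)) (x : Space d) :
    (Integrable (xi P γ ρ τ I J Z t x) Pr ↔ Integrable (xi P γ ρ τ' I' J' Z' t x) Pr') ∧
      ∫ ω, xi P γ ρ τ I J Z t x ω ∂Pr = ∫ ω, xi P γ ρ τ' I' J' Z' t x ω ∂Pr' := by
  have hXm : Measurable (pathXi P γ ρ t x) :=
    measurable_xi hγ hρ hρ' (fun k => (measurable_markτ k).comp measurable_fst)
      (fun k => (measurable_markI k).comp measurable_fst)
      (fun k => (measurable_markJ k).comp measurable_fst)
      (fun k => (measurable_pi_apply k).comp measurable_snd) x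
  have hlaw := h.map_path_eq h'
  rw [xi_eq_pathXi, xi_eq_pathXi P γ ρ τ' I' J' Z' t x]
  refine ⟨?_, ?_⟩
  · rw [← integrable_map_measure hXm.aestronglyMeasurable h.measurable_path.aemeasurable,
      ← integrable_map_measure hXm.aestronglyMeasurable h'.measurable_path.aemeasurable, hlaw]
  · simp only [Function.comp_apply]
    rw [← integral_map h.measurable_path.aemeasurable hXm.aestronglyMeasurable,
      ← integral_map h'.measurable_path.aemeasurable hXm.aestronglyMeasurable, hlaw]

end HasPathLaw

end PathLaw

end Law

/-! ### The canonical branching process -/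

section Canonical

/-- A product of two infinite products of probability measures is an infinite product. -/
theorem infinitePi_prod_map_zip {ι X Y : Type*} [MeasurableSpace X] [MeasurableSpace Y]
    (ν₁ : Measure X) (ν₂ : Measure Y) [IsProbabilityMeasure ν₁] [IsProbabilityMeasure ν₂] :
    ((Measure.infinitePi fun _ : ι => ν₁).prod (Measure.infinitePi fun _ : ι => ν₂)).map
      (fun z k => (z.1 k, z.2 k)) = Measure.infinitePi fun _ => ν₁.prod ν₂ := by
  have hzip : Measurable fun (z : (ι → X) × (ι → Y)) (k : ι) => (z.1 k, z.2 k) :=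
    measurable_pi_lambda _ fun k => ((measurable_pi_apply k).comp measurable_fst).prodMk
      ((measurable_pi_apply k).comp measurable_snd)
  refine Measure.eq_infinitePi _ fun s A hA => ?_
  have hbox : MeasurableSet ((s : Set ι).pi A) :=
    MeasurableSet.pi s.countable_toSet fun k _ => hA k
  rw [Measure.map_apply hzip hbox, Measure.prod_apply (hzip hbox)]
  have hslice : ∀ a : ι → X, (Measure.infinitePi fun _ : ι => ν₂)
      (Prod.mk a ⁻¹' ((fun (z : (ι → X) × (ι → Y)) (k : ι) => (z.1 k, z.2 k)) ⁻¹'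
        (s : Set ι).pi A)) = ∏ k ∈ s, ν₂ (Prod.mk (a k) ⁻¹' A k) := by
    intro a
    rw [← Measure.infinitePi_pi (μ := fun _ : ι => ν₂) fun k _ => measurable_prodMk_left (hA k)]
    rfl
  simp only [hslice]
  have hind := iIndepFun_infinitePi (P := fun _ : ι => ν₁)
    (X := fun k x => ν₂ (Prod.mk x ⁻¹' A k)) fun k => measurable_measure_prodMk_left (hA k)
  rw [lintegral_prod_eq_prod_lintegral_of_indepFun s _ hind fun k =>
    (measurable_measure_prodMk_left (hA k)).comp (measurable_pi_apply k)]
  refine Finset.prod_congr rfl fun k _ => ?_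
  rw [Measure.prod_apply (hA k), ← Measure.infinitePi_map_eval (fun _ : ι => ν₁) k,
    lintegral_map (measurable_measure_prodMk_left (hA k)) (measurable_pi_apply k),
    Measure.infinitePi_map_eval]

/-- The marks of a particle together with a random number which generates its displacement. -/
abbrev Cell (m : ℕ) := Mark m × unitInterval

/-- The law of a cell. -/
def cellLaw (P : Problem m d) (ρ : ℝ → ℝ) : Measure (Cell m) := (markLaw P ρ).prod volume

/-- The law of independent cells for all particles. -/
def canonLaw (P : Problem m d) (ρ : ℝ → ℝ) : Measure (Particle → Cell m) :=
  Measure.infinitePi fun _ => cellLaw P ρ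

/-- The life times on the canonical space. -/
def canonτ (k : Particle) (ω : Particle → Cell m) : ℝ := (ω k).1.1
/-- The types on the canonical space. -/
def canonI (k : Particle) (ω : Particle → Cell m) : Fin (m + 1) := (ω k).1.2.1
/-- The numbers of children on the canonical space. -/
def canonJ (k : Particle) (ω : Particle → Cell m) : ℕ := (ω k).1.2.2

/-- The displacements on the canonical space, where `Θ n s` transforms the uniform distribution
into `μ_n(s,·)`. -/
def canonZ (Θ : Fin (m + 1) → ℝ → unitInterval → Space d) (t : ℝ) (k : Particle)
    (ω : Particle → Cell m) : Space d :=
  Θ (particleType canonτ canonI canonJ t k ω) (lifeTime canonτ t k ω) (ω k).2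

theorem measurable_canonτ (k : Particle) : Measurable (canonτ (m := m) k) :=
  measurable_fst.comp (measurable_fst.comp (measurable_pi_apply k))
theorem measurable_canonI (k : Particle) : Measurable (canonI (m := m) k) :=
  measurable_fst.comp (measurable_snd.comp (measurable_fst.comp (measurable_pi_apply k)))
theorem measurable_canonJ (k : Particle) : Measurable (canonJ (m := m) k) :=
  measurable_snd.comp (measurable_snd.comp (measurable_fst.comp (measurable_pi_apply k)))

variable {P : Problem m d} {μ : Fin (m + 1) → Kernel ℝ (Space d)} {ρ : ℝ → ℝ}
  {Θ : Fin (m + 1) → ℝ → unitInterval → Space d}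

theorem measurable_uncurry_types {E : Type*} [MeasurableSpace E]
    {Θ : Fin (m + 1) → ℝ → E → Space d} (hΘ : ∀ n, Measurable (Function.uncurry (Θ n))) :
    Measurable fun z : Fin (m + 1) × ℝ × E => Θ z.1 z.2.1 z.2.2 :=
  measurable_from_prod_countable_right fun n => hΘ n

theorem measurable_canonZ (hΘ : ∀ n, Measurable (Function.uncurry (Θ n))) (t : ℝ) (k : Particle) :
    Measurable (canonZ Θ t k) :=
  (measurable_uncurry_types hΘ).comp ((measurable_particleType measurable_canonτ measurable_canonI
    measurable_canonJ t k).prodMk ((measurable_lifeTime measurable_canonτ t k).prodMk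
      (measurable_snd.comp (measurable_pi_apply k))))

/-- The canonical process satisfies the conditions on the law of the paths. -/
theorem hasPathLaw_canon [IsProbabilityMeasure (lifeLaw ρ)]
    (hΘ : ∀ n, Measurable (Function.uncurry (Θ n)))
    (hΘμ : ∀ n s, (volume : Measure unitInterval).map (Θ n s) = μ n s) (t : ℝ) :
    HasPathLaw P μ ρ (canonLaw P ρ) canonτ canonI canonJ (canonZ Θ) t := by
  have hprob : IsProbabilityMeasure (markLaw P ρ) := by unfold markLaw; infer_instance
  set ν₁ := Measure.infinitePi fun _ : Particle => markLaw P ρ with hν₁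
  set ν₂ := Measure.infinitePi fun _ : Particle => (volume : Measure unitInterval) with hν₂
  set zip : (Particle → Mark m) × (Particle → unitInterval) → Particle → Cell m :=
    fun z k => (z.1 k, z.2 k) with hzipdef
  have hzip : Measurable zip :=
    measurable_pi_lambda _ fun k => ((measurable_pi_apply k).comp measurable_fst).prodMk
      ((measurable_pi_apply k).comp measurable_snd)
  have hlaw : canonLaw P ρ = (ν₁.prod ν₂).map zip := (infinitePi_prod_map_zip _ _).symm
  have hmk : Measurable fun (ω : Particle → Cell m) k => (canonτ k ω, canonI k ω, canonJ k ω) :=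
    measurable_pi_lambda _ fun k =>
      (measurable_canonτ k).prodMk ((measurable_canonI k).prodMk (measurable_canonJ k))
  refine ⟨measurable_canonτ, measurable_canonI, measurable_canonJ, measurable_canonZ hΘ t, ?_, ?_⟩
  · rw [hlaw, Measure.map_map hmk hzip]
    exact Measure.map_fst_prod.trans (by rw [measure_univ, one_smul])
  · intro S A hA B hB _
    have hB' := hmk hB
    have hty : ∀ k, Measurable (particleType (markτ (m := m)) markI markJ t k) := fun k =>
      measurable_particleType measurable_markτ measurable_markI measurable_markJ t k
    have hlt : ∀ k, Measurable (lifeTime (markτ (m := m)) t k) := fun k =>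
      measurable_lifeTime measurable_markτ t k
    have hprodm : Measurable fun w : Particle → Mark m =>
        ∏ k ∈ S, μ (particleType markτ markI markJ t k w) (lifeTime markτ t k w) (A k) := by
      refine Finset.measurable_fun_prod _ fun k _ => ?_
      have hker : Measurable fun z : Fin (m + 1) × ℝ => μ z.1 z.2 (A k) :=
        measurable_from_prod_countable_right fun n => (μ n).measurable_coe (hA k)
      exact hker.comp ((hty k).prodMk (hlt k))
    have hcomp : ∀ z : (Particle → Mark m) × (Particle → unitInterval), ∀ k,
        particleType canonτ canonI canonJ t k (zip z) = particleType markτ markI markJ t k z.1 ∧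
        lifeTime canonτ t k (zip z) = lifeTime markτ t k z.1 := fun z k =>
      ⟨(particleType_comp (fun ω : Particle → Cell m => fun k => (ω k).1) markτ markI markJ t k
        (zip z)), (lifeTime_comp (fun ω : Particle → Cell m => fun k => (ω k).1) markτ t k (zip z))⟩
    have hset : MeasurableSet ((fun (ω : Particle → Cell m) k =>
        (canonτ k ω, canonI k ω, canonJ k ω)) ⁻¹' B ∩ ⋂ k ∈ S, canonZ Θ t k ⁻¹' A k) :=
      hB'.inter (Finset.measurableSet_biInter S fun k _ => measurable_canonZ hΘ t k (hA k))
    rw [hlaw, Measure.map_apply hzip hset, Measure.prod_apply (hzip hset)]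
    have hslice : ∀ w : Particle → Mark m, ν₂ (Prod.mk w ⁻¹' (zip ⁻¹' ((fun ω k =>
        (canonτ k ω, canonI k ω, canonJ k ω)) ⁻¹' B ∩ ⋂ k ∈ S, canonZ Θ t k ⁻¹' A k))) =
        B.indicator (fun w => ∏ k ∈ S, μ (particleType markτ markI markJ t k w)
          (lifeTime markτ t k w) (A k)) w := by
      intro w
      by_cases hw : w ∈ B
      · rw [indicator_of_mem hw]
        have : Prod.mk w ⁻¹' (zip ⁻¹' ((fun ω k =>
            (canonτ k ω, canonI k ω, canonJ k ω)) ⁻¹' B ∩ ⋂ k ∈ S, canonZ Θ t k ⁻¹' A k)) =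
            (S : Set Particle).pi fun k => Θ (particleType markτ markI markJ t k w)
              (lifeTime markτ t k w) ⁻¹' A k := by
          ext u
          simp only [mem_preimage, mem_inter_iff, mem_iInter, Set.mem_pi, Finset.mem_coe]
          constructor
          · rintro ⟨-, h⟩ k hk
            have := h k hk
            rwa [canonZ, (hcomp (w, u) k).1, (hcomp (w, u) k).2] at this
          · intro h
            refine ⟨hw, fun k hk => ?_⟩
            rw [canonZ, (hcomp (w, u) k).1, (hcomp (w, u) k).2]
            exact h k hk
        rw [this, hν₂, Measure.infinitePi_pi (μ := fun _ : Particle => (volume : Measure unitInterval))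
          fun k _ => (hΘ _).of_uncurry_left (hA k)]
        refine Finset.prod_congr rfl fun k _ => ?_
        rw [← hΘμ, Measure.map_apply (hΘ _).of_uncurry_left (hA k)]
      · rw [indicator_of_notMem hw]
        refine measure_mono_null (fun u hu => hw ?_) measure_empty
        exact hu.1
    simp only [hslice]
    rw [lintegral_indicator hB, setLIntegral_map hB' ?_ hzip]
    · rw [show zip ⁻¹' ((fun ω k => (canonτ k ω, canonI k ω, canonJ k ω)) ⁻¹' B) =
        B ×ˢ (univ : Set (Particle → unitInterval)) from by ext z; simp; rfl]
      have hcongr : ∀ z : (Particle → Mark m) × (Particle → unitInterval),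
          ∏ k ∈ S, μ (particleType canonτ canonI canonJ t k (zip z)) (lifeTime canonτ t k (zip z)) (A k)
          = ∏ k ∈ S, μ (particleType markτ markI markJ t k z.1) (lifeTime markτ t k z.1) (A k) :=
        fun z => Finset.prod_congr rfl fun k _ => by rw [(hcomp z k).1, (hcomp z k).2]
      simp only [hcongr]
      rw [← Measure.prod_restrict, Measure.restrict_univ]
      refine Eq.trans ?_ (lintegral_prod _ (hprodm.comp measurable_fst).aemeasurable).symm
      simp
    · refine Finset.measurable_fun_prod _ fun k _ => ?_
      have hker : Measurable fun z : Fin (m + 1) × ℝ => μ z.1 z.2 (A k) :=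
        measurable_from_prod_countable_right fun n => (μ n).measurable_coe (hA k)
      exact hker.comp ((measurable_particleType measurable_canonτ measurable_canonI
        measurable_canonJ t k).prodMk (measurable_lifeTime measurable_canonτ t k))

end Canonical

/-! ### The branching property -/

section Branching

/-- The configuration of the descendants of the `j`-th child of the ancestor. -/
def shift (j : ℕ) (ω : Particle → Cell m) : Particle → Cell m := fun k => ω (k ++ [j])

section Shift

variable {Θ : Fin (m + 1) → ℝ → unitInterval → Space d} {t : ℝ} {ω : Particle → Cell m}

theorem branchTime_nil (h0 : canonτ [] ω < t) : branchTime canonτ t [] ω = canonτ [] ω := by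
  simp only [branchTime, zero_add]
  exact min_eq_right h0.le

theorem branchTime_append (h0 : canonτ [] ω < t) (j : ℕ) (k : Particle) :
    branchTime canonτ t (k ++ [j]) ω =
      canonτ [] ω + branchTime canonτ (t - canonτ [] ω) k (shift j ω) := by
  have h1 : ∀ s : ℝ, min t (canonτ [] ω + s) = canonτ [] ω + min (t - canonτ [] ω) s := fun s => by
    rw [← min_add_add_left]
    congr 1
    ring
  induction k with
  | nil =>
    simp only [List.nil_append, branchTime, zero_add]
    rw [min_eq_right h0.le, h1]
    rfl
  | cons i k ih =>
    simp only [List.cons_append, branchTime]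
    rw [ih, add_assoc, h1]
    rfl

theorem lifeTime_append (h0 : canonτ [] ω < t) (j : ℕ) (k : Particle) :
    lifeTime canonτ t (k ++ [j]) ω = lifeTime canonτ (t - canonτ [] ω) k (shift j ω) := by
  cases k with
  | nil =>
    have := branchTime_append h0 j []
    simp only [List.nil_append] at this ⊢
    simp only [lifeTime, this, branchTime_nil h0]
    ring
  | cons i k =>
    have h1 := branchTime_append h0 j k
    have h2 := branchTime_append h0 j (i :: k)
    simp only [List.cons_append] at h2 ⊢
    simp only [lifeTime, h1, h2]
    ring

/-- A particle is born before `t` if and only if it descends from a child of the ancestor and is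
born in the subtree of that child before the time which remains after the death of the ancestor. -/
theorem isBorn_append (h0 : canonτ [] ω < t) (j : ℕ) (k : Particle) :
    k ++ [j] ∈ population canonτ canonJ t ω ↔
      (1 ≤ j ∧ j ≤ canonJ [] ω) ∧
        k ∈ population canonτ canonJ (t - canonτ [] ω) (shift j ω) := by
  simp only [population, Set.mem_ofPred_eq]
  induction k with
  | nil =>
    simp only [List.nil_append, IsBorn, branchTime_nil h0, true_and, and_true, h0]
  | cons i k ih =>
    simp only [List.cons_append, IsBorn, ih, branchTime_append h0 j k]
    have h3 : canonτ [] ω + branchTime canonτ (t - canonτ [] ω) k (shift j ω) < t ↔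
        branchTime canonτ (t - canonτ [] ω) k (shift j ω) < t - canonτ [] ω := by
      constructor <;> intro h <;> linarith
    rw [h3, and_assoc]
    rfl

theorem alive_append (h0 : canonτ [] ω < t) {j : ℕ} (hj : 1 ≤ j ∧ j ≤ canonJ [] ω) (k : Particle) :
    k ++ [j] ∈ alive canonτ canonJ t ω ↔
      k ∈ alive canonτ canonJ (t - canonτ [] ω) (shift j ω) := by
  simp only [alive, Set.mem_ofPred_eq, isBorn_append h0, hj, true_and, branchTime_append h0 j k, and_self]
  refine and_congr_right fun _ => ?_
  constructor <;> intro h <;> linarith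

theorem particleType_append (h0 : canonτ [] ω < t) {j : ℕ} (hj : 1 ≤ j ∧ j ≤ canonJ [] ω)
    (k : Particle) : particleType canonτ canonI canonJ t (k ++ [j]) ω =
      particleType canonτ canonI canonJ (t - canonτ [] ω) k (shift j ω) := by
  classical
  unfold particleType
  exact if_congr (alive_append h0 hj k) rfl rfl

theorem canonZ_append (h0 : canonτ [] ω < t) {j : ℕ} (hj : 1 ≤ j ∧ j ≤ canonJ [] ω)
    (k : Particle) : canonZ Θ t (k ++ [j]) ω = canonZ Θ (t - canonτ [] ω) k (shift j ω) := by
  rw [canonZ, canonZ, particleType_append h0 hj, lifeTime_append h0]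
  rfl

theorem position_append (h0 : canonτ [] ω < t) {j : ℕ} (hj : 1 ≤ j ∧ j ≤ canonJ [] ω) (x : Space d)
    (k : Particle) : position (canonZ Θ) t x (k ++ [j]) ω =
      position (canonZ Θ) (t - canonτ [] ω) (x - canonZ Θ t [] ω) k (shift j ω) := by
  induction k with
  | nil =>
    have := canonZ_append (Θ := Θ) h0 hj []
    simp only [List.nil_append] at this
    simp only [List.nil_append, position, this]
  | cons i k ih =>
    have := canonZ_append (Θ := Θ) h0 hj (i :: k)
    simp only [List.cons_append] at this ⊢
    simp only [position, this, ih]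

theorem factor_append (P : Problem m d) (γ : Fin (m + 1) → ℝ → Space d → ℝ) (ρ : ℝ → ℝ)
    (h0 : canonτ [] ω < t) {j : ℕ} (hj : 1 ≤ j ∧ j ≤ canonJ [] ω) (x : Space d) (k : Particle) :
    factor P γ ρ canonτ canonI canonJ (canonZ Θ) t x (k ++ [j]) ω =
      factor P γ ρ canonτ canonI canonJ (canonZ Θ) (t - canonτ [] ω) (x - canonZ Θ t [] ω) k
        (shift j ω) := by
  classical
  unfold factor
  rw [particleType_append h0 hj, lifeTime_append h0, canonZ_append h0 hj, position_append h0 hj,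
    branchTime_append h0, sub_add_eq_sub_sub]
  exact if_congr (alive_append h0 hj k) rfl rfl

theorem nil_mem_population : ([] : Particle) ∈ population canonτ canonJ t ω := trivial

/-- If the ancestor survives, it is the only particle. -/
theorem population_of_le (h0 : t ≤ canonτ [] ω) : population canonτ canonJ t ω = {[]} := by
  have hb : branchTime canonτ t [] ω = t := by
    simp only [branchTime, zero_add]
    exact min_eq_left h0
  ext k
  simp only [population, Set.mem_ofPred_eq, mem_singleton_iff]
  induction k with
  | nil => simp [IsBorn]
  | cons j k ih =>
    simp only [IsBorn, reduceCtorEq, iff_false]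
    rintro ⟨h1, h2, -⟩
    rw [ih.1 h1, hb] at h2
    exact lt_irrefl _ h2

/-- If the ancestor branches before `t`, the population consists of the ancestor and of the
populations of the subtrees. -/
theorem population_of_lt (h0 : canonτ [] ω < t) : population canonτ canonJ t ω =
    insert [] (⋃ j ∈ Finset.Icc 1 (canonJ [] ω),
      (fun k => k ++ [j]) '' population canonτ canonJ (t - canonτ [] ω) (shift j ω)) := by
  ext k
  simp only [mem_insert_iff, mem_iUnion, Finset.mem_Icc, mem_image, exists_prop]
  rcases List.eq_nil_or_concat k with rfl | ⟨k', j, rfl⟩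
  · simp [nil_mem_population]
  · rw [List.concat_eq_append, isBorn_append h0]
    constructor
    · exact fun h => Or.inr ⟨j, h.1, k', h.2, rfl⟩
    · rintro (h | ⟨i, hi, k'', hk'', h⟩)
      · simp at h
      · obtain ⟨rfl, h2⟩ := List.append_inj' h rfl
        simp only [List.cons.injEq, and_true] at h2
        subst h2
        exact ⟨hi, hk''⟩

variable (P : Problem m d) (γ : Fin (m + 1) → ℝ → Space d → ℝ) (ρ : ℝ → ℝ)

/-- The branching functional if the ancestor survives. -/
theorem xi_of_le (x : Space d) (h0 : t ≤ canonτ [] ω) :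
    xi P γ ρ canonτ canonI canonJ (canonZ Θ) t x ω =
      γ (canonI [] ω) t (Θ (canonI [] ω) t (ω []).2) / tail ρ t *
        P.f (canonI [] ω) (x - Θ (canonI [] ω) t (ω []).2) := by
  classical
  have hpop := population_of_le (ω := ω) h0
  have hfin : (population canonτ canonJ t ω).Finite := hpop ▸ finite_singleton []
  have hb : branchTime canonτ t [] ω = t := by
    simp only [branchTime, zero_add]
    exact min_eq_left h0
  have hl : lifeTime canonτ t [] ω = t := by simp only [lifeTime, hb, sub_zero]
  have halive : [] ∈ alive canonτ canonJ t ω := ⟨nil_mem_population, hb⟩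
  have hty : particleType canonτ canonI canonJ t [] ω = canonI [] ω := by
    unfold particleType
    exact if_pos halive
  have hset : hfin.toFinset = {[]} := by
    ext k
    rw [Set.Finite.mem_toFinset, hpop]
    simp
  rw [xi, dif_pos hfin, hset, Finset.prod_singleton]
  unfold factor
  rw [if_pos halive, hl, position, canonZ, hty, hl]

/-- The branching property of the functional. Both sides are `0` if the population is infinite,
since then one of the subtrees is infinite. -/
theorem xi_of_lt (x : Space d) (h0 : canonτ [] ω < t) :
    xi P γ ρ canonτ canonI canonJ (canonZ Θ) t x ω =
      γ (Fin.last m) (canonτ [] ω) (Θ (Fin.last m) (canonτ [] ω) (ω []).2) / ρ (canonτ [] ω) *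
        P.c (canonJ [] ω) ((t - canonτ [] ω).toNNReal,
          x - Θ (Fin.last m) (canonτ [] ω) (ω []).2) *
        ∏ j ∈ Finset.Icc 1 (canonJ [] ω), xi P γ ρ canonτ canonI canonJ (canonZ Θ)
          (t - canonτ [] ω) (x - Θ (Fin.last m) (canonτ [] ω) (ω []).2) (shift j ω) := by
  classical
  have hb := branchTime_nil (ω := ω) h0
  have hl : lifeTime canonτ t [] ω = canonτ [] ω := by simp only [lifeTime, hb, sub_zero]
  have halive : [] ∉ alive canonτ canonJ t ω := fun h => by
    have := h.2
    rw [hb] at this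
    exact h0.ne this
  have hty : particleType canonτ canonI canonJ t [] ω = Fin.last m := by
    unfold particleType
    exact if_neg halive
  have hZ : canonZ Θ t [] ω = Θ (Fin.last m) (canonτ [] ω) (ω []).2 := by rw [canonZ, hty, hl]
  have hpop := population_of_lt (ω := ω) h0
  have hinj : ∀ j : ℕ, Function.Injective fun k : Particle => k ++ [j] := fun j a b h =>
    (List.append_inj' h rfl).1
  by_cases hfin : ∀ j ∈ Finset.Icc 1 (canonJ [] ω),
      (population canonτ canonJ (t - canonτ [] ω) (shift j ω)).Finite
  · have hfin' : (population canonτ canonJ t ω).Finite := by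
      rw [hpop]
      exact (Set.Finite.biUnion (Finset.finite_toSet _) fun j hj => (hfin j hj).image _).insert _
    rw [xi, dif_pos hfin']
    set S : ℕ → Finset Particle := fun j =>
      if h : (population canonτ canonJ (t - canonτ [] ω) (shift j ω)).Finite then h.toFinset else ∅
      with hS
    have hSmem : ∀ j ∈ Finset.Icc 1 (canonJ [] ω), ∀ k, k ∈ S j ↔
        k ∈ population canonτ canonJ (t - canonτ [] ω) (shift j ω) := fun j hj k => by
      simp only [hS, dif_pos (hfin j hj), Set.Finite.mem_toFinset]
    have hset : hfin'.toFinset = insert [] ((Finset.Icc 1 (canonJ [] ω)).biUnion fun j =>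
        (S j).image fun k => k ++ [j]) := by
      ext k
      rw [Set.Finite.mem_toFinset, hpop]
      simp only [mem_insert_iff, mem_iUnion, mem_image, Finset.mem_insert, Finset.mem_biUnion,
        Finset.mem_image, exists_prop]
      refine or_congr_right (exists_congr fun j => and_congr_right fun hj =>
        exists_congr fun k' => and_congr_left fun _ => (hSmem j hj k').symm)
    rw [hset, Finset.prod_insert (by simp), Finset.prod_biUnion]
    · congr 1
      · unfold factor
        rw [if_neg halive, hl, hb, position, hZ]
      · refine Finset.prod_congr rfl fun j hj => ?_
        rw [Finset.prod_image fun a _ b _ h => hinj j h, xi, dif_pos (hfin j hj)]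
        have hSj : S j = (hfin j hj).toFinset := by simp only [hS, dif_pos (hfin j hj)]
        rw [hSj]
        refine Finset.prod_congr rfl fun k _ => ?_
        rw [factor_append P γ ρ h0 (Finset.mem_Icc.1 hj), hZ]
    · intro i _ j _ hij
      rw [Function.onFun, Finset.disjoint_left]
      rintro k hk hk'
      obtain ⟨a, -, rfl⟩ := Finset.mem_image.1 hk
      obtain ⟨b, -, h⟩ := Finset.mem_image.1 hk'
      have := (List.append_inj' h rfl).2
      simp only [List.cons.injEq, and_true] at this
      exact hij this.symm
  · push Not at hfin
    obtain ⟨j, hj, hinf⟩ := hfin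
    have hinf' : ¬ (population canonτ canonJ t ω).Finite := by
      intro hf
      rw [hpop] at hf
      have h1 : ((fun k : Particle => k ++ [j]) ''
          population canonτ canonJ (t - canonτ [] ω) (shift j ω)).Finite :=
        hf.subset ((subset_biUnion_of_mem (u := fun j => (fun k : Particle => k ++ [j]) ''
          population canonτ canonJ (t - canonτ [] ω) (shift j ω)) hj).trans (subset_insert _ _))
      exact hinf (h1.of_finite_image (hinj j).injOn)
    rw [xi, dif_neg hinf', Finset.prod_eq_zero hj, mul_zero]
    rw [xi, dif_neg hinf]

end Shift

/-! ### Truncation at a given generation -/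

/-- The branching functional restricted to the event that all particles born before `t` belong to
the generations `0, …, n - 1`, defined by the branching property. -/
def truncXi (P : Problem m d) (γ : Fin (m + 1) → ℝ → Space d → ℝ) (ρ : ℝ → ℝ)
    (Θ : Fin (m + 1) → ℝ → unitInterval → Space d) :
    ℕ → ℝ → Space d → (Particle → Cell m) → ℝ
  | 0, _, _, _ => 0
  | n + 1, t, x, ω =>
    if t ≤ canonτ [] ω then
      γ (canonI [] ω) t (Θ (canonI [] ω) t (ω []).2) / tail ρ t *
        P.f (canonI [] ω) (x - Θ (canonI [] ω) t (ω []).2)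
    else
      γ (Fin.last m) (canonτ [] ω) (Θ (Fin.last m) (canonτ [] ω) (ω []).2) / ρ (canonτ [] ω) *
        P.c (canonJ [] ω) ((t - canonτ [] ω).toNNReal,
          x - Θ (Fin.last m) (canonτ [] ω) (ω []).2) *
        ∏ j ∈ Finset.Icc 1 (canonJ [] ω), truncXi P γ ρ Θ n
          (t - canonτ [] ω) (x - Θ (Fin.last m) (canonτ [] ω) (ω []).2) (shift j ω)

variable (P : Problem m d) (γ : Fin (m + 1) → ℝ → Space d → ℝ) (ρ : ℝ → ℝ)
  (Θ : Fin (m + 1) → ℝ → unitInterval → Space d)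

open Classical in
/-- The recursive definition agrees with the description: if some particle belongs to generation `n`
or later, one of the factors is `0`. -/
theorem truncXi_eq (n : ℕ) (t : ℝ) (x : Space d) (ω : Particle → Cell m) :
    truncXi P γ ρ Θ n t x ω =
      if ∀ k ∈ population canonτ canonJ t ω, k.length < n then
        xi P γ ρ canonτ canonI canonJ (canonZ Θ) t x ω else 0 := by
  induction n generalizing t x ω with
  | zero =>
    rw [if_neg fun h => absurd (h [] nil_mem_population) (by simp)]
    rfl
  | succ n ih =>
    by_cases h0 : t ≤ canonτ [] ω
    · rw [truncXi, if_pos h0, if_pos, xi_of_le P γ ρ x h0]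
      intro k hk
      rw [population_of_le h0, mem_singleton_iff] at hk
      simp [hk]
    · rw [truncXi, if_neg h0]
      push Not at h0
      have hiff : (∀ k ∈ population canonτ canonJ t ω, k.length < n + 1) ↔
          ∀ j ∈ Finset.Icc 1 (canonJ [] ω),
            ∀ k ∈ population canonτ canonJ (t - canonτ [] ω) (shift j ω), k.length < n := by
        constructor
        · intro h j hj k hk
          have := h (k ++ [j]) ((isBorn_append h0 j k).2 ⟨Finset.mem_Icc.1 hj, hk⟩)
          simpa using this
        · intro h k hk
          rcases List.eq_nil_or_concat k with rfl | ⟨k', j, rfl⟩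
          · simp
          · rw [List.concat_eq_append, isBorn_append h0] at hk
            simpa using h j (Finset.mem_Icc.2 hk.1) k' hk.2
      split_ifs with h
      · rw [xi_of_lt P γ ρ x h0]
        congr 1
        refine Finset.prod_congr rfl fun j hj => ?_
        rw [ih, if_pos (hiff.1 h j hj)]
      · rw [hiff] at h
        push Not at h
        obtain ⟨j, hj, k, hk, hkn⟩ := h
        rw [Finset.prod_eq_zero hj, mul_zero]
        rw [ih, if_neg fun hh => absurd (hh k hk) (by simpa using hkn)]

theorem truncXi_eventually_eq (t : ℝ) (x : Space d) (ω : Particle → Cell m) :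
    ∀ᶠ n in Filter.atTop, truncXi P γ ρ Θ n t x ω =
      xi P γ ρ canonτ canonI canonJ (canonZ Θ) t x ω := by
  classical
  by_cases hfin : (population canonτ canonJ t ω).Finite
  · obtain ⟨N, hN⟩ := (hfin.image List.length).bddAbove
    filter_upwards [Filter.eventually_gt_atTop N] with n hn
    rw [truncXi_eq, if_pos fun k hk => (hN (mem_image_of_mem _ hk)).trans_lt hn]
  · refine Filter.Eventually.of_forall fun n => ?_
    have : xi P γ ρ canonτ canonI canonJ (canonZ Θ) t x ω = 0 := by rw [xi, dif_neg hfin]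
    rw [truncXi_eq, this, ite_self]

end Branching

/-! ### Independence of the subtrees -/

section Split

variable {X : Type*} [MeasurableSpace X] (ν : Measure X) [IsProbabilityMeasure ν]

/-- The ancestor and the subtrees of its children are independent, and the subtrees are
independent copies of the tree. -/
theorem infinitePi_list_split :
    (Measure.infinitePi fun _ : List ℕ => ν).map
      (fun ω => (ω [], fun (j : ℕ) (k : List ℕ) => ω (k ++ [j]))) =
      ν.prod (Measure.infinitePi fun _ : ℕ => Measure.infinitePi fun _ : List ℕ => ν) := by
  set Q := Measure.infinitePi fun _ : List ℕ => ν with hQ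
  have hrest : Measurable fun (ω : List ℕ → X) (j : ℕ) (k : List ℕ) => ω (k ++ [j]) :=
    measurable_pi_lambda _ fun _ => measurable_pi_lambda _ fun _ => measurable_pi_apply _
  have hlaw : Q.map (fun ω (j : ℕ) (k : List ℕ) => ω (k ++ [j])) =
      Measure.infinitePi fun _ : ℕ => Measure.infinitePi fun _ : List ℕ => ν := by
    have hinj : Function.Injective fun p : ℕ × List ℕ => p.2 ++ [p.1] := by
      rintro ⟨j, k⟩ ⟨j', k'⟩ h
      obtain ⟨h1, h2⟩ := List.append_inj' h rfl
      simp only [List.cons.injEq, and_true] at h1 h2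
      rw [h1, h2]
    have h1 := Measure.map_infinitePi_infinitePi_of_inj (P := fun _ : List ℕ => ν) hinj
    have h2 := Measure.infinitePi_map_curry (fun (_ : ℕ) (_ : List ℕ) => ν)
    rw [← h2, ← h1, Measure.map_map (MeasurableEquiv.measurable _) (by fun_prop)]
    rfl
  have hind : IndepFun (fun ω : List ℕ → X => ω []) (fun ω (j : ℕ) (k : List ℕ) => ω (k ++ [j])) Q := by
    have h1 : iIndepFun (fun (k : List ℕ) (ω : List ℕ → X) => ω k) Q :=
      iIndepFun_infinitePi (X := fun _ x => x) fun _ => measurable_id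
    rw [iIndepFun_iff_iIndep] at h1
    have h2 := indep_iSup_of_disjoint (fun k => (measurable_pi_apply k).comap_le) h1
      (S := {[]}) (T := {[]}ᶜ) disjoint_compl_right
    rw [IndepFun_iff_Indep]
    refine indep_of_indep_of_le_left (indep_of_indep_of_le_right h2 ?_) ?_
    · rw [← measurable_iff_comap_le]
      refine @measurable_pi_lambda _ _ _ (_) _ _ fun j => @measurable_pi_lambda _ _ _ (_) _ _ fun k => ?_
      rw [measurable_iff_comap_le]
      exact le_iSup₂ (f := fun (k : List ℕ) (_ : k ∈ ({[]}ᶜ : Set (List ℕ))) =>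
        MeasurableSpace.comap (fun ω : List ℕ → X => ω k) inferInstance) (k ++ [j]) (by simp)
    · exact le_iSup₂ (f := fun (k : List ℕ) (_ : k ∈ ({[]} : Set (List ℕ))) =>
        MeasurableSpace.comap (fun ω : List ℕ → X => ω k) inferInstance) [] rfl
  rw [(indepFun_iff_map_prod_eq_prod_map_map (measurable_pi_apply _).aemeasurable
    hrest.aemeasurable).1 hind, hlaw, hQ, Measure.infinitePi_map_eval]

theorem measurable_root_subtrees : Measurable
    fun ω : List ℕ → X => (ω [], fun (j : ℕ) (k : List ℕ) => ω (k ++ [j])) :=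
  (measurable_pi_apply _).prodMk
    (measurable_pi_lambda _ fun _ => measurable_pi_lambda _ fun _ => measurable_pi_apply _)

variable {ν}

theorem measurable_prod_Icc {Y E : Type*} [MeasurableSpace Y] [CommMonoid E] [MeasurableSpace E]
    [MeasurableMul₂ E] {N : Y → ℕ} (hN : Measurable N) {h : ℕ → Y → E}
    (hh : ∀ j, Measurable (h j)) : Measurable fun y => ∏ j ∈ Finset.Icc 1 (N y), h j y := by
  have : Measurable fun z : ℕ × Y => ∏ j ∈ Finset.Icc 1 z.1, h j z.2 :=
    measurable_from_prod_countable_right fun n => by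
      show Measurable fun y => ∏ j ∈ Finset.Icc 1 n, h j y
      exact Finset.measurable_fun_prod _ fun j _ => hh j
  exact this.comp (hN.prodMk measurable_id)

/-- Conditionally on the ancestor, the expectation of a product over its subtrees is a power, as the
subtrees are independent copies of the tree. -/
theorem lintegral_root_subtrees {g : X → ℝ≥0∞} (hg : Measurable g) {N : X → ℕ} (hN : Measurable N)
    {h : X → (List ℕ → X) → ℝ≥0∞} (hh : Measurable (Function.uncurry h)) :
    ∫⁻ ω, g (ω []) * ∏ j ∈ Finset.Icc 1 (N (ω [])), h (ω []) (fun k => ω (k ++ [j]))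
        ∂(Measure.infinitePi fun _ : List ℕ => ν) =
      ∫⁻ a, g a * (∫⁻ η, h a η ∂(Measure.infinitePi fun _ : List ℕ => ν)) ^ N a ∂ν := by
  set Q := Measure.infinitePi fun _ : List ℕ => ν with hQ
  set G : X × (ℕ → List ℕ → X) → ℝ≥0∞ := fun z =>
    g z.1 * ∏ j ∈ Finset.Icc 1 (N z.1), h z.1 (z.2 j) with hG
  have hGm : Measurable G := (hg.comp measurable_fst).mul
    (measurable_prod_Icc (hN.comp measurable_fst) fun j =>
      hh.comp (measurable_fst.prodMk ((measurable_pi_apply j).comp measurable_snd)))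
  have h1 : ∫⁻ ω, G (ω [], fun (j : ℕ) (k : List ℕ) => ω (k ++ [j])) ∂Q =
      ∫⁻ z, G z ∂(ν.prod (Measure.infinitePi fun _ : ℕ => Q)) := by
    rw [← infinitePi_list_split ν, lintegral_map hGm measurable_root_subtrees]
  refine h1.trans ?_
  rw [lintegral_prod _ hGm.aemeasurable]
  refine lintegral_congr fun a => ?_
  simp only [hG]
  have hha : Measurable (h a) := hh.of_uncurry_left
  have hind := iIndepFun_infinitePi (P := fun _ : ℕ => Q) (X := fun _ η => h a η) fun _ => hha
  have hm : ∀ j : ℕ, Measurable fun y : ℕ → List ℕ → X => h a (y j) := fun j =>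
    hha.comp (measurable_pi_apply j)
  rw [lintegral_const_mul _ (Finset.measurable_fun_prod _ fun j _ => hm j),
    lintegral_prod_eq_prod_lintegral_of_indepFun _ _ hind hm]
  have h2 : ∀ j : ℕ, ∫⁻ ωs : ℕ → List ℕ → X, h a (ωs j) ∂(Measure.infinitePi fun _ : ℕ => Q) =
      ∫⁻ η, h a η ∂Q := fun j => by
    conv_rhs => rw [← Measure.infinitePi_map_eval (fun _ : ℕ => Q) j]
    rw [lintegral_map hha (measurable_pi_apply j)]
  simp only [h2, Finset.prod_const, Nat.card_Icc, Nat.add_sub_cancel]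

/-- The version of `lintegral_root_subtrees` for integrable functions. -/
theorem integral_root_subtrees {g : X → ℝ} (hg : Measurable g) {N : X → ℕ} (hN : Measurable N)
    {h : X → (List ℕ → X) → ℝ} (hh : Measurable (Function.uncurry h))
    (hint : Integrable (fun ω : List ℕ → X =>
      g (ω []) * ∏ j ∈ Finset.Icc 1 (N (ω [])), h (ω []) (fun k => ω (k ++ [j])))
      (Measure.infinitePi fun _ : List ℕ => ν)) :
    ∫ ω, g (ω []) * ∏ j ∈ Finset.Icc 1 (N (ω [])), h (ω []) (fun k => ω (k ++ [j]))
        ∂(Measure.infinitePi fun _ : List ℕ => ν) =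
      ∫ a, g a * (∫ η, h a η ∂(Measure.infinitePi fun _ : List ℕ => ν)) ^ N a ∂ν := by
  set Q := Measure.infinitePi fun _ : List ℕ => ν with hQ
  set G : X × (ℕ → List ℕ → X) → ℝ := fun z =>
    g z.1 * ∏ j ∈ Finset.Icc 1 (N z.1), h z.1 (z.2 j) with hG
  have hGm : Measurable G := (hg.comp measurable_fst).mul
    (measurable_prod_Icc (hN.comp measurable_fst) fun j =>
      hh.comp (measurable_fst.prodMk ((measurable_pi_apply j).comp measurable_snd)))
  have hGint : Integrable G (ν.prod (Measure.infinitePi fun _ : ℕ => Q)) := by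
    rw [← infinitePi_list_split ν, integrable_map_measure hGm.aestronglyMeasurable
      measurable_root_subtrees.aemeasurable]
    exact hint
  have h1 : ∫ ω, G (ω [], fun (j : ℕ) (k : List ℕ) => ω (k ++ [j])) ∂Q =
      ∫ z, G z ∂(ν.prod (Measure.infinitePi fun _ : ℕ => Q)) := by
    rw [← infinitePi_list_split ν, integral_map measurable_root_subtrees.aemeasurable
      hGm.aestronglyMeasurable]
  refine h1.trans ?_
  rw [integral_prod _ hGint]
  refine integral_congr_ae (Filter.Eventually.of_forall fun a => ?_)
  simp only [hG]
  have hha : Measurable (h a) := hh.of_uncurry_left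
  have hind := (iIndepFun_infinitePi (P := fun _ : ℕ => Q) (X := fun _ η => h a η) fun _ => hha).precomp
    (Subtype.val_injective (p := fun j => j ∈ Finset.Icc 1 (N a)))
  have h3 := hind.integral_fun_prod_eq_prod_integral fun j =>
    (hha.comp (measurable_pi_apply _)).aestronglyMeasurable
  have h2 : ∀ j : ℕ, ∫ ωs : ℕ → List ℕ → X, h a (ωs j) ∂(Measure.infinitePi fun _ : ℕ => Q) =
      ∫ η, h a η ∂Q := fun j => by
    conv_rhs => rw [← Measure.infinitePi_map_eval (fun _ : ℕ => Q) j]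
    rw [integral_map (measurable_pi_apply j).aemeasurable hha.aestronglyMeasurable]
  rw [integral_const_mul]
  congr 1
  simp only [← Finset.prod_coe_sort (Finset.Icc 1 (N a))]
  refine h3.trans ?_
  simp only [h2, Finset.prod_const, Finset.card_univ, Fintype.card_coe,
    Nat.card_Icc, Nat.add_sub_cancel]

end Split

/-! ### Measurability of the canonical branching functional -/

section Measurability

variable (P : Problem m d) (γ : Fin (m + 1) → ℝ → Space d → ℝ) (ρ : ℝ → ℝ)
  (Θ : Fin (m + 1) → ℝ → unitInterval → Space d)

/-- The factor of an ancestor living at time `t`. -/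
def aliveTerm (t : ℝ) (x : Space d) (a : Cell m) : ℝ :=
  γ a.1.2.1 t (Θ a.1.2.1 t a.2) / tail ρ t * P.f a.1.2.1 (x - Θ a.1.2.1 t a.2)

/-- The position of an ancestor when it branches. -/
def branchPos (x : Space d) (a : Cell m) : Space d := x - Θ (Fin.last m) a.1.1 a.2

/-- The factor of an ancestor which branches before `t`. -/
def branchTerm (t : ℝ) (x : Space d) (a : Cell m) : ℝ :=
  γ (Fin.last m) a.1.1 (Θ (Fin.last m) a.1.1 a.2) / ρ a.1.1 *
    P.c a.1.2.2 ((t - a.1.1).toNNReal, branchPos Θ x a)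

/-- The branching functional on the canonical space. -/
def canonXi (t : ℝ) (x : Space d) (ω : Particle → Cell m) : ℝ :=
  xi P γ ρ canonτ canonI canonJ (canonZ Θ) t x ω

/-- The branching property: the functional of the tree in terms of the functionals of the
subtrees. -/
theorem canonXi_eq (t : ℝ) (x : Space d) (ω : Particle → Cell m) :
    canonXi P γ ρ Θ t x ω = if t ≤ (ω []).1.1 then aliveTerm P γ ρ Θ t x (ω []) else
      branchTerm P γ ρ Θ t x (ω []) * ∏ j ∈ Finset.Icc 1 (ω []).1.2.2,
        canonXi P γ ρ Θ (t - (ω []).1.1) (branchPos Θ x (ω [])) (fun k => ω (k ++ [j])) := by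
  split_ifs with h
  · exact xi_of_le P γ ρ x h
  · exact xi_of_lt P γ ρ x (not_le.1 h)

theorem truncXi_succ (n : ℕ) (t : ℝ) (x : Space d) (ω : Particle → Cell m) :
    truncXi P γ ρ Θ (n + 1) t x ω = if t ≤ (ω []).1.1 then aliveTerm P γ ρ Θ t x (ω []) else
      branchTerm P γ ρ Θ t x (ω []) * ∏ j ∈ Finset.Icc 1 (ω []).1.2.2,
        truncXi P γ ρ Θ n (t - (ω []).1.1) (branchPos Θ x (ω [])) (fun k => ω (k ++ [j])) := rfl

variable {P γ ρ Θ}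

theorem measurable_branchPos (hΘ : ∀ n, Measurable (Function.uncurry (Θ n))) :
    Measurable fun z : Space d × Cell m => branchPos Θ z.1 z.2 :=
  measurable_fst.sub ((hΘ _).comp ((measurable_fst.comp (measurable_fst.comp measurable_snd)).prodMk
    (measurable_snd.comp measurable_snd)))

theorem measurable_aliveTerm (hγ : ∀ n, Measurable (Function.uncurry (γ n)))
    (hρ' : Measurable (tail ρ)) (hΘ : ∀ n, Measurable (Function.uncurry (Θ n))) :
    Measurable fun z : ℝ × Space d × Cell m => aliveTerm P γ ρ Θ z.1 z.2.1 z.2.2 := by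
  have hγ' : Measurable fun z : Fin (m + 1) × ℝ × Space d => γ z.1 z.2.1 z.2.2 :=
    measurable_from_prod_countable_right fun n => hγ n
  have hf : Measurable fun z : Fin (m + 1) × Space d => P.f z.1 z.2 :=
    measurable_from_prod_countable_right fun j => (P.f j).continuous.measurable
  have hI : Measurable fun z : ℝ × Space d × Cell m => z.2.2.1.2.1 := by fun_prop
  have hZ : Measurable fun z : ℝ × Space d × Cell m => Θ z.2.2.1.2.1 z.1 z.2.2.2 :=
    (measurable_uncurry_types hΘ).comp (hI.prodMk (measurable_fst.prodMk (by fun_prop)))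
  exact ((hγ'.comp (hI.prodMk (measurable_fst.prodMk hZ))).div (hρ'.comp measurable_fst)).mul
    (hf.comp (hI.prodMk ((measurable_fst.comp measurable_snd).sub hZ)))

theorem measurable_branchTerm (hγ : ∀ n, Measurable (Function.uncurry (γ n)))
    (hρ : Measurable ρ) (hΘ : ∀ n, Measurable (Function.uncurry (Θ n))) :
    Measurable fun z : ℝ × Space d × Cell m => branchTerm P γ ρ Θ z.1 z.2.1 z.2.2 := by
  have hc : Measurable fun z : ℕ × (ℝ≥0 × Space d) => P.c z.1 z.2 :=
    measurable_from_prod_countable_right fun j => (P.c j).continuous.measurable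
  have hτ : Measurable fun z : ℝ × Space d × Cell m => z.2.2.1.1 := by fun_prop
  have hJ : Measurable fun z : ℝ × Space d × Cell m => z.2.2.1.2.2 := by fun_prop
  have hZ : Measurable fun z : ℝ × Space d × Cell m => Θ (Fin.last m) z.2.2.1.1 z.2.2.2 :=
    (hΘ _).comp (hτ.prodMk (by fun_prop))
  exact (((hγ _).comp (hτ.prodMk hZ)).div (hρ.comp hτ)).mul
    (hc.comp (hJ.prodMk ((measurable_fst.sub hτ).real_toNNReal.prodMk
      ((measurable_branchPos hΘ).comp measurable_snd))))

theorem measurable_truncXi (hγ : ∀ n, Measurable (Function.uncurry (γ n)))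
    (hρ : Measurable ρ) (hρ' : Measurable (tail ρ)) (hΘ : ∀ n, Measurable (Function.uncurry (Θ n)))
    (n : ℕ) :
    Measurable fun z : (ℝ × Space d) × (Particle → Cell m) => truncXi P γ ρ Θ n z.1.1 z.1.2 z.2 := by
  induction n with
  | zero => exact measurable_const
  | succ n ih =>
    simp only [truncXi_succ]
    have h0 : Measurable fun z : (ℝ × Space d) × (Particle → Cell m) => z.2 [] :=
      (measurable_pi_apply _).comp measurable_snd
    have hroot : Measurable fun z : (ℝ × Space d) × (Particle → Cell m) =>
        (z.1.1, z.1.2, z.2 []) := by fun_prop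
    refine Measurable.ite (measurableSet_le (by fun_prop) (by fun_prop)) ?_ ?_
    · exact (measurable_aliveTerm hγ hρ' hΘ).comp hroot
    · refine ((measurable_branchTerm hγ hρ hΘ).comp hroot).mul
        (measurable_prod_Icc (by fun_prop) fun j => ?_)
      exact ih.comp (((by fun_prop : Measurable fun z : (ℝ × Space d) × (Particle → Cell m) =>
        z.1.1 - (z.2 []).1.1).prodMk ((measurable_branchPos hΘ).comp
          ((measurable_snd.comp measurable_fst).prodMk h0))).prodMk (by fun_prop))

theorem measurable_canonXi (hγ : ∀ n, Measurable (Function.uncurry (γ n)))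
    (hρ : Measurable ρ) (hρ' : Measurable (tail ρ)) (hΘ : ∀ n, Measurable (Function.uncurry (Θ n))) :
    Measurable fun z : (ℝ × Space d) × (Particle → Cell m) => canonXi P γ ρ Θ z.1.1 z.1.2 z.2 :=
  measurable_of_tendsto_metrizable (measurable_truncXi hγ hρ hρ' hΘ) (tendsto_pi_nhds.2 fun z =>
    tendsto_const_nhds.congr' ((truncXi_eventually_eq P γ ρ Θ z.1.1 z.1.2 z.2).mono
      fun _ h => h.symm))

end Measurability

/-! ### Conditioning on the ancestor -/

section Ancestor

variable {P : Problem m d} {μ : Fin (m + 1) → Kernel ℝ (Space d)}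
  {γ : Fin (m + 1) → ℝ → Space d → ℝ} {ρ : ℝ → ℝ} {Θ : Fin (m + 1) → ℝ → unitInterval → Space d}

/-- Almost surely, the ancestor does not die exactly at time `0` or `t`. -/
theorem Ici_ae_eq_Ioo_union_Ioi {t : ℝ} (ht : 0 ≤ t) :
    (Ici (0 : ℝ) : Set ℝ) =ᵐ[volume] (Ioo 0 t ∪ Ioi t : Set ℝ) :=
  (Ioi_ae_eq_Ici.symm).trans (by
    rw [← Ioc_union_Ioi_eq_Ioi ht]
    exact Ioo_ae_eq_Ioc.symm.union (Filter.EventuallyEq.refl _ _))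

theorem disjoint_Ioo_Ioi (t : ℝ) : Disjoint (Ioo 0 t) (Ioi t) :=
  Set.disjoint_left.2 fun _ h1 h2 => lt_asymm h1.2 h2

theorem lintegral_lifeLaw (hρm : Measurable ρ) {t : ℝ} (ht : 0 ≤ t) (g : ℝ → ℝ≥0∞) :
    ∫⁻ s, g s ∂lifeLaw ρ = (∫⁻ s in Ioo 0 t, ENNReal.ofReal (ρ s) * g s) +
      ∫⁻ s in Ioi t, ENNReal.ofReal (ρ s) * g s := by
  rw [lifeLaw, lintegral_withDensity_eq_lintegral_mul_non_measurable _ hρm.ennreal_ofReal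
    (Filter.Eventually.of_forall fun _ => ENNReal.ofReal_lt_top),
    setLIntegral_congr (Ici_ae_eq_Ioo_union_Ioi ht),
    lintegral_union measurableSet_Ioi (disjoint_Ioo_Ioi t)]
  rfl

theorem integral_lifeLaw (hρ : IsLifeDensity ρ) (hρm : Measurable ρ) {t : ℝ} (ht : 0 ≤ t)
    {g : ℝ → ℝ} (hg : Integrable g (lifeLaw ρ)) :
    ∫ s, g s ∂lifeLaw ρ = (∫ s in Ioo 0 t, ρ s * g s) + ∫ s in Ioi t, ρ s * g s := by
  have hint : IntegrableOn (fun s => ρ s * g s) (Ici 0) := by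
    rw [lifeLaw, integrable_withDensity_iff_integrable_smul' hρm.ennreal_ofReal
      (Filter.Eventually.of_forall fun _ => ENNReal.ofReal_lt_top)] at hg
    refine (integrableOn_congr_fun (fun s hs => ?_) measurableSet_Ici).1 hg
    simp only [ENNReal.toReal_ofReal (hρ.nonneg hs), smul_eq_mul]
  rw [lifeLaw, integral_withDensity_eq_integral_toReal_smul hρm.ennreal_ofReal
    (Filter.Eventually.of_forall fun _ => ENNReal.ofReal_lt_top)]
  have h1 : ∫ s in Ici 0, (ENNReal.ofReal (ρ s)).toReal • g s = ∫ s in Ici 0, ρ s * g s :=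
    setIntegral_congr_fun measurableSet_Ici fun s hs => by
      simp only [ENNReal.toReal_ofReal (hρ.nonneg hs), smul_eq_mul]
  have hint' := hint.congr_set_ae (Ici_ae_eq_Ioo_union_Ioi ht).symm
  rw [h1, setIntegral_congr_set (Ici_ae_eq_Ioo_union_Ioi ht),
    setIntegral_union (disjoint_Ioo_Ioi t) measurableSet_Ioi
      (hint'.mono_set subset_union_left) (hint'.mono_set subset_union_right)]

theorem lintegral_offspringLaw (P : Problem m d) (g : ℕ → ℝ≥0∞) :
    ∫⁻ j, g j ∂offspringLaw P = ∑' j, ENNReal.ofReal (P.q j) * g j := by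
  simp only [offspringLaw, lintegral_sum_measure, lintegral_smul_measure, lintegral_dirac,
    smul_eq_mul]

theorem integral_offspringLaw (P : Problem m d) (g : ℕ → ℝ) :
    ∫ j, g j ∂offspringLaw P = ∑' j, P.q j * g j := by
  rw [offspringLaw, integral_sum_dirac fun _ => ENNReal.ofReal_ne_top]
  simp only [ENNReal.toReal_ofReal (P.q_nonneg _), smul_eq_mul]

theorem integral_typeLaw (P : Problem m d) (g : Fin (m + 1) → ℝ) :
    ∫ n, g n ∂typeLaw P = ∑ n, P.p n * g n := by
  rw [typeLaw, integral_sum_dirac fun _ => ENNReal.ofReal_ne_top, tsum_fintype]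
  simp only [ENNReal.toReal_ofReal (P.p_pos _).le, smul_eq_mul]

section Displacement

variable {S : Set ℝ} {n : Fin (m + 1)} {s : ℝ} (hker : IsSignedKernel S (μ n) (γ n))
  (hΘ : ∀ n, Measurable (Function.uncurry (Θ n)))
  (hΘμ : ∀ n s, (volume : Measure unitInterval).map (Θ n s) = μ n s)
include hΘ hΘμ

theorem lintegral_displacement {g : Space d → ℝ≥0∞} (hg : Measurable g) :
    ∫⁻ θ, g (Θ n s θ) = ∫⁻ y, g y ∂(μ n s) := by
  rw [← hΘμ n s, lintegral_map hg (hΘ n).of_uncurry_left]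

theorem integral_displacement {g : Space d → ℝ} (hg : Measurable g) :
    ∫ θ, g (Θ n s θ) = ∫ y, g y ∂(μ n s) := by
  rw [← hΘμ n s, integral_map (hΘ n).of_uncurry_left.aemeasurable hg.aestronglyMeasurable]

include hker

theorem lintegral_enorm_displacement (hs : s ∈ S) :
    ∫⁻ θ, ‖γ n s (Θ n s θ)‖ₑ = ENNReal.ofReal (mass (μ n) (γ n) s) := by
  have := hker.markov
  rw [lintegral_displacement hΘ hΘμ (hker.measurable_slice s).enorm, mass,
    ← ofReal_integral_norm_eq_lintegral_enorm (hker.integrable hs)]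
  rfl

end Displacement

variable {S : Set ℝ} (hker : ∀ n, IsSignedKernel S (μ n) (γ n)) (hρ : IsLifeDensity ρ)
  (hρm : Measurable ρ) (hρ' : Measurable (tail ρ))
  (hΘ : ∀ n, Measurable (Function.uncurry (Θ n)))
  (hΘμ : ∀ n s, (volume : Measure unitInterval).map (Θ n s) = μ n s)
include hker hρ hΘ hΘμ

/-- The bound for an ancestor which survives, in expectation over its displacement only. -/
theorem lintegral_aliveTerm_le {r t : ℝ} (ht : 0 ≤ t) (htS : t ∈ S)
    (hr : ∀ n, ‖P.f n‖ * mass (μ n) (γ n) t ≤ r) (x : Space d) (s : ℝ) (n : Fin (m + 1)) (j : ℕ) :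
    ∫⁻ θ, ‖aliveTerm P γ ρ Θ t x ((s, n, j), θ)‖ₑ ≤ ENNReal.ofReal (r / tail ρ t) := by
  have htail := hρ.tail_pos ht
  have h1 : ∀ θ, ‖aliveTerm P γ ρ Θ t x ((s, n, j), θ)‖ₑ ≤
      ‖γ n t (Θ n t θ)‖ₑ * ENNReal.ofReal (‖P.f n‖ / tail ρ t) := fun θ => by
    rw [← ofReal_norm, ← ofReal_norm, ← ENNReal.ofReal_mul (norm_nonneg _)]
    refine ENNReal.ofReal_le_ofReal ?_
    simp only [aliveTerm, norm_mul, norm_div, Real.norm_of_nonneg htail.le]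
    have := (P.f n).norm_coe_le_norm (x - Θ n t θ)
    rw [div_mul_eq_mul_div, mul_div_assoc]
    gcongr
  have hm : Measurable fun θ => ‖γ n t (Θ n t θ)‖ₑ :=
    (((hker n).measurable_slice t).comp (hΘ n).of_uncurry_left).enorm
  refine (lintegral_mono h1).trans ?_
  rw [lintegral_mul_const _ hm, lintegral_enorm_displacement (hker n) hΘ hΘμ htS,
    ← ENNReal.ofReal_mul (IsSignedKernel.mass_nonneg _ _ _)]
  refine ENNReal.ofReal_le_ofReal ?_
  rw [mul_div_assoc', mul_comm]
  gcongr
  exact hr n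

/-- The bound for an ancestor which branches at time `s` into `j` children, in expectation over its
displacement only, if the expectation over each subtree is bounded by `w`. -/
theorem lintegral_branchTerm_le {t s : ℝ} (hs0 : 0 < s) (hsS : s ∈ S) {w : ℝ}
    (hw0 : 0 ≤ w) {V : Space d → ℝ≥0∞} (hV : ∀ y, V y ≤ ENNReal.ofReal w)
    (x : Space d) (n : Fin (m + 1)) (j : ℕ) :
    ∫⁻ θ, ‖branchTerm P γ ρ Θ t x ((s, n, j), θ)‖ₑ * V (branchPos Θ x ((s, n, j), θ)) ^ j ≤
      ENNReal.ofReal (mass (μ (Fin.last m)) (γ (Fin.last m)) s / ρ s * (‖P.c j‖ * w ^ j)) := by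
  have hρs := hρ.pos s hs0
  set N := Fin.last m
  have h1 : ∀ θ, ‖branchTerm P γ ρ Θ t x ((s, n, j), θ)‖ₑ * V (branchPos Θ x ((s, n, j), θ)) ^ j ≤
      ‖γ N s (Θ N s θ)‖ₑ * ENNReal.ofReal (‖P.c j‖ * w ^ j / ρ s) := fun θ => by
    have h2 : V (branchPos Θ x ((s, n, j), θ)) ^ j ≤ ENNReal.ofReal (w ^ j) := by
      rw [ENNReal.ofReal_pow hw0]
      exact pow_le_pow_left' (hV _) j
    refine (mul_le_mul_right h2 _).trans ?_
    rw [← ofReal_norm, ← ofReal_norm, ← ENNReal.ofReal_mul (norm_nonneg _),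
      ← ENNReal.ofReal_mul (norm_nonneg _)]
    refine ENNReal.ofReal_le_ofReal ?_
    simp only [branchTerm, norm_mul, norm_div, Real.norm_of_nonneg hρs.le]
    have := (P.c j).norm_coe_le_norm ((t - s).toNNReal, branchPos Θ x ((s, n, j), θ))
    calc _ ≤ ‖γ N s (Θ N s θ)‖ / ρ s * ‖P.c j‖ * w ^ j := by gcongr
      _ = _ := by ring
  have hm : Measurable fun θ => ‖γ N s (Θ N s θ)‖ₑ :=
    (((hker N).measurable_slice s).comp (hΘ N).of_uncurry_left).enorm
  refine (lintegral_mono h1).trans (le_of_eq ?_)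
  rw [lintegral_mul_const _ hm, lintegral_enorm_displacement (hker N) hΘ hΘμ hsS,
    ← ENNReal.ofReal_mul (IsSignedKernel.mass_nonneg _ _ _)]
  congr 1
  ring

omit hker hρ in
theorem integral_aliveTerm (hγ : ∀ n, Measurable (Function.uncurry (γ n))) (t : ℝ) (x : Space d)
    (s : ℝ) (n : Fin (m + 1)) (j : ℕ) :
    ∫ θ, aliveTerm P γ ρ Θ t x ((s, n, j), θ) =
      greenConv (μ n) (γ n) t (P.f n) x / tail ρ t := by
  have hm : Measurable fun y => γ n t y / tail ρ t * P.f n (x - y) :=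
    ((hγ n).of_uncurry_left.div_const _).mul
      ((P.f n).continuous.measurable.comp (measurable_const.sub measurable_id))
  refine (integral_displacement hΘ hΘμ hm).trans ?_
  rw [greenConv, ← integral_div]
  refine integral_congr_ae (Filter.Eventually.of_forall fun y => ?_)
  simp only
  ring

omit hker hρ in
/-- The expectation over the displacement of an ancestor which branches at time `s` into `j`
children, if `v` is the expectation over a subtree. -/
theorem integral_branchTerm (hγ : ∀ n, Measurable (Function.uncurry (γ n))) (t s : ℝ)
    {v : Space d → ℝ} (hv : Measurable v) (x : Space d) (n : Fin (m + 1)) (j : ℕ) :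
    ∫ θ, branchTerm P γ ρ Θ t x ((s, n, j), θ) * v (branchPos Θ x ((s, n, j), θ)) ^ j =
      greenConv (μ (Fin.last m)) (γ (Fin.last m)) s
        (fun y => P.c j ((t - s).toNNReal, y) * v y ^ j) x / ρ s := by
  have hsub : Measurable fun y : Space d => x - y := measurable_const.sub measurable_id
  have hm : Measurable fun y => γ (Fin.last m) s y / ρ s *
      P.c j ((t - s).toNNReal, x - y) * v (x - y) ^ j :=
    (((hγ _).of_uncurry_left.div_const _).mul ((P.c j).continuous.measurable.comp
      (measurable_const.prodMk hsub))).mul ((hv.comp hsub).pow_const j)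
  refine (integral_displacement hΘ hΘμ hm).trans ?_
  rw [greenConv, ← integral_div]
  refine integral_congr_ae (Filter.Eventually.of_forall fun y => ?_)
  simp only
  ring

omit hρ hΘ hΘμ in
/-- Summation over the number of children turns the powers into the nonlinearity. -/
theorem tsum_greenConv {s : ℝ} (hs : s ∈ S) {v : Space d → ℝ} (hv : Measurable v) {s₁ : ℝ}
    (hs₁ : ENNReal.ofReal s₁ < R₁ P) (hvs : ∀ y, |v y| ≤ s₁) (τ : ℝ≥0) (x : Space d) :
    ∑' j, P.q j * greenConv (μ (Fin.last m)) (γ (Fin.last m)) s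
        (fun y => P.c j (τ, y) * v y ^ j) x =
      greenConv (μ (Fin.last m)) (γ (Fin.last m)) s (fun y => nonlin P (τ, y) (v y)) x := by
  have := (hker (Fin.last m)).markov
  have hs0 : 0 ≤ s₁ := (abs_nonneg _).trans (hvs 0)
  have hint := (hker (Fin.last m)).integrable hs
  have hsub : Measurable fun y : Space d => x - y := measurable_const.sub measurable_id
  set F : ℕ → Space d → ℝ := fun j y =>
    P.q j * P.c j (τ, x - y) * v (x - y) ^ j * γ (Fin.last m) s y with hF
  have hb : ∀ j y, ‖P.q j * P.c j (τ, x - y) * v (x - y) ^ j‖ ≤ P.q j * ‖P.c j‖ * s₁ ^ j :=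
    fun j y => abs_term_le _ (hvs _) j
  have hFi : ∀ j, Integrable (F j) (μ (Fin.last m) s) := fun j =>
    hint.bdd_mul ((((P.c j).continuous.measurable.comp (measurable_const.prodMk hsub)).const_mul
      (P.q j)).mul ((hv.comp hsub).pow_const j)).aestronglyMeasurable
      (Filter.Eventually.of_forall (hb j))
  have hsum : Summable fun j => ∫ y, ‖F j y‖ ∂(μ (Fin.last m) s) := by
    refine Summable.of_nonneg_of_le (fun j => integral_nonneg fun y => norm_nonneg _) (fun j => ?_)
      ((summable_coeff hs0 hs₁).mul_right (∫ y, ‖γ (Fin.last m) s y‖ ∂(μ (Fin.last m) s)))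
    rw [← integral_const_mul]
    refine integral_mono (hFi j).norm (hint.norm.const_mul _) fun y => ?_
    simp only [hF, norm_mul _ (γ (Fin.last m) s y)]
    exact mul_le_mul_of_nonneg_right (hb j y) (norm_nonneg _)
  have h := (hasSum_integral_of_summable_integral_norm hFi hsum).tsum_eq
  simp only [hF, tsum_mul_right] at h
  refine Eq.trans (tsum_congr fun j => ?_) h
  rw [greenConv, ← integral_const_mul]
  refine integral_congr_ae (Filter.Eventually.of_forall fun y => ?_)
  simp only
  ring

include hρm

/-- The expectation over the whole tree is given by the right-hand side of the mild equation, if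
`v` is the expectation over the subtrees. -/
theorem integral_step (hγ : ∀ n, Measurable (Function.uncurry (γ n))) {t : ℝ} (ht : 0 ≤ t)
    (htS : Icc 0 t ⊆ S) {v : ℝ → Space d → ℝ} (hvm : Measurable (Function.uncurry v)) {s₁ : ℝ}
    (hs₁ : ENNReal.ofReal s₁ < R₁ P) (hv : ∀ s ∈ Icc 0 t, ∀ y, |v s y| ≤ s₁) (x : Space d)
    (hint : Integrable (fun a => if t ≤ a.1.1 then aliveTerm P γ ρ Θ t x a else
      branchTerm P γ ρ Θ t x a * v (t - a.1.1) (branchPos Θ x a) ^ a.1.2.2) (cellLaw P ρ)) :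
    ∫ a, (if t ≤ a.1.1 then aliveTerm P γ ρ Θ t x a else
        branchTerm P γ ρ Θ t x a * v (t - a.1.1) (branchPos Θ x a) ^ a.1.2.2) ∂cellLaw P ρ =
      mild P μ γ (fun s y => nonlin P (s.toNNReal, y) (v s y)) t x := by
  have hprob := hρ.isProbabilityMeasure
  set G : Cell m → ℝ := fun a => if t ≤ a.1.1 then aliveTerm P γ ρ Θ t x a else
      branchTerm P γ ρ Θ t x a * v (t - a.1.1) (branchPos Θ x a) ^ a.1.2.2 with hG
  have hint1 : Integrable (fun z : Mark m => ∫ θ, G (z, θ)) (markLaw P ρ) := by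
    have : IsProbabilityMeasure (markLaw P ρ) := by unfold markLaw; infer_instance
    exact Integrable.integral_prod_left hint
  have hint2 : Integrable (fun s => ∫ nj, (∫ θ, G ((s, nj), θ))
      ∂((typeLaw P).prod (offspringLaw P))) (lifeLaw ρ) := Integrable.integral_prod_left hint1
  have hK : ∫ a, G a ∂cellLaw P ρ = ∫ s, (∫ nj, (∫ θ, G ((s, nj), θ))
      ∂((typeLaw P).prod (offspringLaw P))) ∂lifeLaw ρ := by
    have : IsProbabilityMeasure (markLaw P ρ) := by unfold markLaw; infer_instance
    rw [cellLaw, integral_prod _ hint, markLaw, integral_prod _ hint1]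
  have htail := hρ.tail_pos ht
  rw [hK, integral_lifeLaw hρ hρm ht hint2, mild, add_comm]
  congr 1
  · have h1 : ∀ s ∈ Ioi t, ρ s * ∫ nj, (∫ θ, G ((s, nj), θ))
        ∂((typeLaw P).prod (offspringLaw P)) =
        ρ s * ((∑ n, P.p n * greenConv (μ n) (γ n) t (P.f n) x) / tail ρ t) := fun s hs => by
      congr 1
      simp only [hG, if_pos (le_of_lt (show t < s from hs))]
      have h2 : ∀ nj : Fin (m + 1) × ℕ, ∫ θ, aliveTerm P γ ρ Θ t x ((s, nj), θ) =
          greenConv (μ nj.1) (γ nj.1) t (P.f nj.1) x / tail ρ t := fun nj =>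
        integral_aliveTerm hΘ hΘμ hγ t x s nj.1 nj.2
      simp only [h2]
      rw [integral_fun_fst (fun n => greenConv (μ n) (γ n) t (P.f n) x / tail ρ t),
        probReal_univ, one_smul, integral_typeLaw, Finset.sum_div]
      simp only [mul_div_assoc]
    rw [setIntegral_congr_fun measurableSet_Ioi h1, integral_mul_const]
    exact mul_div_cancel₀ _ htail.ne'
  · have h1 : ∀ s ∈ Ioo 0 t, ρ s * ∫ nj, (∫ θ, G ((s, nj), θ))
        ∂((typeLaw P).prod (offspringLaw P)) = greenConv (μ (Fin.last m)) (γ (Fin.last m)) s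
          (fun y => nonlin P ((t - s).toNNReal, y) (v (t - s) y)) x := fun s hs => by
      have hts : t - s ∈ Icc 0 t := ⟨by linarith [hs.2], by linarith [hs.1]⟩
      have hρs := hρ.pos s hs.1
      have hvs : Measurable (v (t - s)) := hvm.of_uncurry_left
      simp only [hG, if_neg (not_le.2 hs.2)]
      have h2 : ∀ nj : Fin (m + 1) × ℕ, ∫ θ, branchTerm P γ ρ Θ t x ((s, nj), θ) *
          v (t - s) (branchPos Θ x ((s, nj), θ)) ^ nj.2 = greenConv (μ (Fin.last m))
            (γ (Fin.last m)) s (fun y => P.c nj.2 ((t - s).toNNReal, y) * v (t - s) y ^ nj.2) x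
              / ρ s := fun nj => integral_branchTerm hΘ hΘμ hγ t s hvs x nj.1 nj.2
      simp only [h2]
      rw [integral_fun_snd (fun j => greenConv (μ (Fin.last m)) (γ (Fin.last m)) s
          (fun y => P.c j ((t - s).toNNReal, y) * v (t - s) y ^ j) x / ρ s),
        probReal_univ, one_smul, integral_offspringLaw]
      simp only [mul_div_assoc']
      rw [tsum_div_const, tsum_greenConv hker (htS ⟨hs.1.le, hs.2.le⟩) hvs hs₁ (hv _ hts)]
      exact mul_div_cancel₀ _ hρs.ne'
    rw [setIntegral_congr_fun measurableSet_Ioo h1, sourceConv,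
      intervalIntegral.integral_of_le ht, setIntegral_congr_set Ioo_ae_eq_Ioc]

include hρ'

/-- If the expectation over each subtree is bounded by `w`, then the expectation over the whole
tree is bounded by the right-hand side of the integral equation `w = r + ∫ |g_N| H₁(w)`. -/
theorem lintegral_step_le (hγ : ∀ n, Measurable (Function.uncurry (γ n)))
    {r t : ℝ} (ht : 0 ≤ t) (htS : Icc 0 t ⊆ S)
    (hr : ∀ n, ‖P.f n‖ * mass (μ n) (γ n) t ≤ r) {V : ℝ → Space d → ℝ≥0∞}
    (hVm : Measurable (Function.uncurry V)) {w : ℝ → ℝ} (hw0 : ∀ s ∈ Icc 0 t, 0 ≤ w s)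
    (hwR : ∀ s ∈ Icc 0 t, ENNReal.ofReal (w s) < R₁ P)
    (hV : ∀ s ∈ Icc 0 t, ∀ y, V s y ≤ ENNReal.ofReal (w s)) (x : Space d) :
    ∫⁻ a, (if t ≤ a.1.1 then ‖aliveTerm P γ ρ Θ t x a‖ₑ else
        ‖branchTerm P γ ρ Θ t x a‖ₑ * V (t - a.1.1) (branchPos Θ x a) ^ a.1.2.2) ∂cellLaw P ρ ≤
      ENNReal.ofReal r + ∫⁻ s in Ioc 0 t,
        ENNReal.ofReal (mass (μ (Fin.last m)) (γ (Fin.last m)) s * H₁ P (w (t - s))) := by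
  have hprob := hρ.isProbabilityMeasure
  set G : Cell m → ℝ≥0∞ := fun a => if t ≤ a.1.1 then ‖aliveTerm P γ ρ Θ t x a‖ₑ else
        ‖branchTerm P γ ρ Θ t x a‖ₑ * V (t - a.1.1) (branchPos Θ x a) ^ a.1.2.2 with hG
  have hpow : Measurable fun z : ℝ≥0∞ × ℕ => z.1 ^ z.2 :=
    measurable_from_prod_countable_left fun n => by
      simpa using measurable_id.pow_const n
  have hGm : Measurable G := by
    refine Measurable.ite (measurableSet_le measurable_const (by fun_prop)) ?_ (.mul ?_ ?_)
    · exact ((measurable_aliveTerm hγ hρ' hΘ).comp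
        (measurable_const.prodMk (measurable_const.prodMk measurable_id))).enorm
    · exact ((measurable_branchTerm hγ hρm hΘ).comp
        (measurable_const.prodMk (measurable_const.prodMk measurable_id))).enorm
    · exact hpow.comp ((hVm.comp ((by fun_prop : Measurable fun a : Cell m => t - a.1.1).prodMk
        ((measurable_branchPos hΘ).comp (measurable_const.prodMk measurable_id)))).prodMk
          (by fun_prop))
  have hK : ∫⁻ a, G a ∂cellLaw P ρ = ∫⁻ s, (∫⁻ nj, (∫⁻ θ, G ((s, nj), θ))
      ∂((typeLaw P).prod (offspringLaw P))) ∂lifeLaw ρ := by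
    rw [cellLaw, lintegral_prod _ hGm.aemeasurable, markLaw,
      lintegral_prod _ (Measurable.lintegral_prod_right' hGm).aemeasurable]
  rw [hK, lintegral_lifeLaw hρm ht, add_comm]
  have htail := hρ.tail_pos ht
  refine add_le_add ?_ ?_
  · have h1 : ∀ s ∈ Ioi t, ENNReal.ofReal (ρ s) * ∫⁻ nj, (∫⁻ θ, G ((s, nj), θ))
        ∂((typeLaw P).prod (offspringLaw P)) ≤
        ENNReal.ofReal (ρ s) * ENNReal.ofReal (r / tail ρ t) := fun s hs => by
      refine mul_le_mul_right ?_ _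
      calc _ ≤ ∫⁻ nj, ENNReal.ofReal (r / tail ρ t) ∂((typeLaw P).prod (offspringLaw P)) := by
            refine lintegral_mono fun nj => ?_
            simp only [hG, if_pos (le_of_lt (show t < s from hs))]
            exact lintegral_aliveTerm_le hker hρ hΘ hΘμ ht (htS ⟨ht, le_rfl⟩) hr x s nj.1 nj.2
        _ = _ := by rw [lintegral_const, measure_univ, mul_one]
    refine (setLIntegral_mono' measurableSet_Ioi h1).trans (le_of_eq ?_)
    rw [lintegral_mul_const _ hρm.ennreal_ofReal, ← hρ.ofReal_tail ht,
      ← ENNReal.ofReal_mul htail.le, mul_div_cancel₀ _ htail.ne']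
  · refine (setLIntegral_mono' measurableSet_Ioo fun s hs => ?_).trans
      (lintegral_mono_set Ioo_subset_Ioc_self)
    have hts : t - s ∈ Icc 0 t := ⟨by linarith [hs.2], by linarith [hs.1]⟩
    have hρs := hρ.pos s hs.1
    have hM := IsSignedKernel.mass_nonneg (μ (Fin.last m)) (γ (Fin.last m)) s
    have hc0 : ∀ j, 0 ≤ ‖P.c j‖ * w (t - s) ^ j := fun j =>
      mul_nonneg (norm_nonneg _) (pow_nonneg (hw0 _ hts) j)
    have h2 : ∫⁻ nj, (∫⁻ θ, G ((s, nj), θ)) ∂((typeLaw P).prod (offspringLaw P)) ≤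
        ENNReal.ofReal (mass (μ (Fin.last m)) (γ (Fin.last m)) s / ρ s * H₁ P (w (t - s))) := by
      calc _ ≤ ∫⁻ nj, ENNReal.ofReal (mass (μ (Fin.last m)) (γ (Fin.last m)) s / ρ s *
              (‖P.c nj.2‖ * w (t - s) ^ nj.2)) ∂((typeLaw P).prod (offspringLaw P)) := by
            refine lintegral_mono fun nj => ?_
            simp only [hG, if_neg (not_le.2 hs.2)]
            exact lintegral_branchTerm_le hker hρ hΘ hΘμ hs.1 (htS ⟨hs.1.le, hs.2.le⟩)
              (hw0 _ hts) (hV _ hts) x nj.1 nj.2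
        _ = ∑' j, ENNReal.ofReal (P.q j) * ENNReal.ofReal
              (mass (μ (Fin.last m)) (γ (Fin.last m)) s / ρ s * (‖P.c j‖ * w (t - s) ^ j)) := by
            rw [lintegral_prod _ (Measurable.of_discrete).aemeasurable]
            simp only [lintegral_const, measure_univ, mul_one, lintegral_offspringLaw]
        _ = ∑' j, ENNReal.ofReal (mass (μ (Fin.last m)) (γ (Fin.last m)) s / ρ s *
              (P.q j * ‖P.c j‖ * w (t - s) ^ j)) := by
            refine tsum_congr fun j => ?_
            rw [← ENNReal.ofReal_mul (P.q_nonneg j)]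
            congr 1
            ring
        _ = _ := by
            rw [← ENNReal.ofReal_tsum_of_nonneg, tsum_mul_left]
            · rfl
            · exact fun j => mul_nonneg (div_nonneg hM hρs.le)
                (mul_nonneg (coeff_nonneg P j) (pow_nonneg (hw0 _ hts) j))
            · exact (summable_coeff (hw0 _ hts) (hwR _ hts)).mul_left _
    refine (mul_le_mul_right h2 _).trans (le_of_eq ?_)
    rw [← ENNReal.ofReal_mul hρs.le]
    congr 1
    field_simp

end Ancestor

/-! ### The expectation of the branching functional -/

section Expectation

variable {P : Problem m d} {μ : Fin (m + 1) → Kernel ℝ (Space d)}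
  {γ : Fin (m + 1) → ℝ → Space d → ℝ} {ρ : ℝ → ℝ} {Θ : Fin (m + 1) → ℝ → unitInterval → Space d}

theorem enorm_finset_prod {ι : Type*} (s : Finset ι) (f : ι → ℝ) :
    ‖∏ i ∈ s, f i‖ₑ = ∏ i ∈ s, ‖f i‖ₑ := by
  classical
  induction s using Finset.induction_on with
  | empty => simp
  | insert i s hi ih => rw [Finset.prod_insert hi, Finset.prod_insert hi, enorm_mul, ih]

theorem isProbabilityMeasure_cellLaw (P : Problem m d) (hρ : IsLifeDensity ρ) :
    IsProbabilityMeasure (cellLaw P ρ) := by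
  have := hρ.isProbabilityMeasure
  unfold cellLaw markLaw
  infer_instance

theorem isProbabilityMeasure_canonLaw (P : Problem m d) (hρ : IsLifeDensity ρ) :
    IsProbabilityMeasure (canonLaw P ρ) := by
  have := isProbabilityMeasure_cellLaw P hρ
  unfold canonLaw
  infer_instance

/-- The expectation of the branching functional on the canonical space. -/
def expectedXi (P : Problem m d) (γ : Fin (m + 1) → ℝ → Space d → ℝ) (ρ : ℝ → ℝ)
    (Θ : Fin (m + 1) → ℝ → unitInterval → Space d) (t : ℝ) (x : Space d) : ℝ :=
  ∫ ω, canonXi P γ ρ Θ t x ω ∂canonLaw P ρ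

variable {S 𝕀 : Set ℝ} (hker : ∀ n, IsSignedKernel S (μ n) (γ n)) (hρ : IsLifeDensity ρ)
  (hρm : Measurable ρ) (hρ' : Measurable (tail ρ))
  (hΘ : ∀ n, Measurable (Function.uncurry (Θ n)))
  (hΘμ : ∀ n s, (volume : Measure unitInterval).map (Θ n s) = μ n s)
  (hγ : ∀ n, Measurable (Function.uncurry (γ n)))
include hρ hρm hρ' hΘ hγ

omit hρm hρ' hΘ hγ hρ in
theorem measurable_if_children (t : ℝ) :
    Measurable fun a : Cell m => if t ≤ a.1.1 then 0 else a.1.2.2 :=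
  Measurable.ite (measurableSet_le measurable_const (by fun_prop)) measurable_const (by fun_prop)

omit hρ in
theorem measurable_ancestorTerm (t : ℝ) (x : Space d) :
    Measurable fun a : Cell m =>
      if t ≤ a.1.1 then aliveTerm P γ ρ Θ t x a else branchTerm P γ ρ Θ t x a :=
  Measurable.ite (measurableSet_le measurable_const (by fun_prop))
    ((measurable_aliveTerm hγ hρ' hΘ).comp
      (measurable_const.prodMk (measurable_const.prodMk measurable_id)))
    ((measurable_branchTerm hγ hρm hΘ).comp
      (measurable_const.prodMk (measurable_const.prodMk measurable_id)))

theorem measurable_expectedXi : Measurable (Function.uncurry (expectedXi P γ ρ Θ)) := by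
  have := isProbabilityMeasure_canonLaw P hρ
  exact (measurable_canonXi hγ hρm hρ' hΘ).stronglyMeasurable.integral_prod_right.measurable

include hker hΘμ

section Bound

variable (h𝕀S : 𝕀 ⊆ S) (hord : ∀ t ∈ 𝕀, 0 ≤ t ∧ Icc 0 t ⊆ 𝕀) {r : ℝ}
  (hr : ∀ n, ∀ t ∈ 𝕀, ‖P.f n‖ * mass (μ n) (γ n) t ≤ r) {w : ℝ → ℝ} (hw0 : ∀ t ∈ 𝕀, 0 ≤ w t)
  (hwR : ∀ t ∈ 𝕀, ENNReal.ofReal (w t) < R₁ P)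
  (hw : ∀ t ∈ 𝕀, ENNReal.ofReal r + ∫⁻ s in Ioc 0 t,
        ENNReal.ofReal (mass (μ (Fin.last m)) (γ (Fin.last m)) s * H₁ P (w (t - s))) ≤
          ENNReal.ofReal (w t))
include h𝕀S hord hr hw0 hwR hw

/-- The bound by the majorant, by induction over the generations. -/
theorem lintegral_truncXi_le (n : ℕ) {t : ℝ} (ht : t ∈ 𝕀) (x : Space d) :
    ∫⁻ ω, ‖truncXi P γ ρ Θ n t x ω‖ₑ ∂canonLaw P ρ ≤ ENNReal.ofReal (w t) := by
  have hprob := isProbabilityMeasure_cellLaw P hρ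
  have hprob' := isProbabilityMeasure_canonLaw P hρ
  induction n generalizing t x with
  | zero =>
    simp only [truncXi, enorm_zero, lintegral_zero]
    exact zero_le
  | succ n ih =>
    obtain ⟨ht0, htI⟩ := hord t ht
    have hXm := measurable_truncXi (P := P) hγ hρm hρ' hΘ n
    set V : ℝ → Space d → ℝ≥0∞ := fun s y => ∫⁻ ω, ‖truncXi P γ ρ Θ n s y ω‖ₑ ∂canonLaw P ρ with hV
    have hVm : Measurable (Function.uncurry V) := hXm.enorm.lintegral_prod_right'
    have hroot := lintegral_root_subtrees (ν := cellLaw P ρ)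
      (measurable_ancestorTerm (P := P) hρm hρ' hΘ hγ t x).enorm
      (measurable_if_children t)
      (h := fun a η => ‖truncXi P γ ρ Θ n (t - a.1.1) (branchPos Θ x a) η‖ₑ)
      (hXm.enorm.comp ((((by fun_prop : Measurable fun a : Cell m => t - a.1.1).prodMk
        ((measurable_branchPos hΘ).comp (measurable_const.prodMk measurable_id))).comp
          measurable_fst).prodMk measurable_snd))
    refine le_trans (le_of_eq ?_) ((lintegral_step_le hker hρ hρm hρ' hΘ hΘμ hγ ht0
      (htI.trans h𝕀S) (fun n => hr n t ht) hVm (fun s hs => hw0 s (htI hs))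
      (fun s hs => hwR s (htI hs)) (fun s hs y => ih (htI hs) y) x).trans (hw t ht))
    refine Eq.trans ?_ (hroot.trans ?_)
    · refine lintegral_congr fun ω => ?_
      rw [truncXi_succ]
      split_ifs with h
      · simp
      · rw [enorm_mul, enorm_finset_prod]
    · refine lintegral_congr fun a => ?_
      split_ifs with h
      · simp
      · rfl

/-- The bound by the majorant for the whole tree, by Fatou's lemma. -/
theorem lintegral_canonXi_le {t : ℝ} (ht : t ∈ 𝕀) (x : Space d) :
    ∫⁻ ω, ‖canonXi P γ ρ Θ t x ω‖ₑ ∂canonLaw P ρ ≤ ENNReal.ofReal (w t) := by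
  have hlim : ∀ ω, ‖canonXi P γ ρ Θ t x ω‖ₑ =
      Filter.liminf (fun n => ‖truncXi P γ ρ Θ n t x ω‖ₑ) Filter.atTop := fun ω =>
    (Filter.Tendsto.liminf_eq (tendsto_const_nhds.congr'
      ((truncXi_eventually_eq P γ ρ Θ t x ω).mono fun _ h => by
        rw [h]
        rfl))).symm
  simp only [hlim]
  refine (lintegral_liminf_le fun n => ((measurable_truncXi hγ hρm hρ' hΘ n).comp
    (measurable_prodMk_left (x := (t, x)))).enorm).trans ?_
  refine Filter.liminf_le_of_le (by isBoundedDefault) fun b hb => ?_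
  obtain ⟨n, hn⟩ := hb.exists
  exact hn.trans (lintegral_truncXi_le hker hρ hρm hρ' hΘ hΘμ hγ h𝕀S hord hr hw0 hwR hw n ht x)

theorem integrable_canonXi {t : ℝ} (ht : t ∈ 𝕀) (x : Space d) :
    Integrable (canonXi P γ ρ Θ t x) (canonLaw P ρ) :=
  ⟨((measurable_canonXi hγ hρm hρ' hΘ).comp
    (measurable_prodMk_left (x := (t, x)))).aestronglyMeasurable,
    (lintegral_canonXi_le hker hρ hρm hρ' hΘ hΘμ hγ h𝕀S hord hr hw0 hwR hw ht x).trans_lt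
      ENNReal.ofReal_lt_top⟩

theorem abs_expectedXi_le {t : ℝ} (ht : t ∈ 𝕀) (x : Space d) :
    |expectedXi P γ ρ Θ t x| ≤ w t := by
  rw [← Real.norm_eq_abs, ← ENNReal.ofReal_le_ofReal_iff (hw0 t ht), ofReal_norm]
  exact (enorm_integral_le_lintegral_enorm _).trans
    (lintegral_canonXi_le hker hρ hρm hρ' hΘ hΘμ hγ h𝕀S hord hr hw0 hwR hw ht x)

/-- The expectation of the branching functional solves the mild equation. -/
theorem expectedXi_eq_mild {s₁ : ℝ} (hs₁ : ENNReal.ofReal s₁ < R₁ P) (hws : ∀ t ∈ 𝕀, w t ≤ s₁)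
    {t : ℝ} (ht : t ∈ 𝕀) (x : Space d) :
    expectedXi P γ ρ Θ t x =
      mild P μ γ (fun s y => nonlin P (s.toNNReal, y) (expectedXi P γ ρ Θ s y)) t x := by
  have hprob := isProbabilityMeasure_cellLaw P hρ
  have hprob' := isProbabilityMeasure_canonLaw P hρ
  obtain ⟨ht0, htI⟩ := hord t ht
  have hub : ∀ s ∈ Icc 0 t, ∀ y, |expectedXi P γ ρ Θ s y| ≤ w s := fun s hs y =>
    abs_expectedXi_le hker hρ hρm hρ' hΘ hΘμ hγ h𝕀S hord hr hw0 hwR hw (htI hs) y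
  have hum := measurable_expectedXi (P := P) hρ hρm hρ' hΘ hγ
  have hXm := measurable_canonXi (P := P) hγ hρm hρ' hΘ
  have hgm := measurable_ancestorTerm (P := P) hρm hρ' hΘ hγ t x
  -- the branching property, written as a product in both cases
  have hform : ∀ ω : Particle → Cell m, canonXi P γ ρ Θ t x ω =
      (if t ≤ (ω []).1.1 then aliveTerm P γ ρ Θ t x (ω []) else branchTerm P γ ρ Θ t x (ω [])) *
        ∏ j ∈ Finset.Icc 1 (if t ≤ (ω []).1.1 then 0 else (ω []).1.2.2),
          canonXi P γ ρ Θ (t - (ω []).1.1) (branchPos Θ x (ω [])) (fun k => ω (k ++ [j])) :=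
    fun ω => by
      rw [canonXi_eq]
      split_ifs with h
      · simp
      · rfl
  have hint := integrable_canonXi hker hρ hρm hρ' hΘ hΘμ hγ h𝕀S hord hr hw0 hwR hw ht x
  have hroot := integral_root_subtrees (ν := cellLaw P ρ) hgm (measurable_if_children t)
      (h := fun a η => canonXi P γ ρ Θ (t - a.1.1) (branchPos Θ x a) η)
      (hXm.comp ((((by fun_prop : Measurable fun a : Cell m => t - a.1.1).prodMk
        ((measurable_branchPos hΘ).comp (measurable_const.prodMk measurable_id))).comp
          measurable_fst).prodMk measurable_snd))
      (hint.congr (Filter.Eventually.of_forall hform))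
  have hite : ∀ a : Cell m, (if t ≤ a.1.1 then aliveTerm P γ ρ Θ t x a else
      branchTerm P γ ρ Θ t x a) * expectedXi P γ ρ Θ (t - a.1.1) (branchPos Θ x a) ^
        (if t ≤ a.1.1 then 0 else a.1.2.2) = if t ≤ a.1.1 then aliveTerm P γ ρ Θ t x a else
      branchTerm P γ ρ Θ t x a * expectedXi P γ ρ Θ (t - a.1.1) (branchPos Θ x a) ^ a.1.2.2 :=
    fun a => by split_ifs <;> simp
  have hstep := lintegral_step_le (P := P) hker hρ hρm hρ' hΘ hΘμ hγ ht0
      (htI.trans h𝕀S) (fun n => hr n t ht) (V := fun s y => ‖expectedXi P γ ρ Θ s y‖ₑ)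
      hum.enorm (fun s hs => hw0 s (htI hs)) (fun s hs => hwR s (htI hs))
      (fun s hs y => by
        rw [← ofReal_norm]
        exact ENNReal.ofReal_le_ofReal (hub s hs y)) x
  have hpow : Measurable fun z : ℝ × ℕ => z.1 ^ z.2 :=
    measurable_from_prod_countable_left fun n => by
      simpa using measurable_id.pow_const n
  have hGint : Integrable (fun a : Cell m => if t ≤ a.1.1 then aliveTerm P γ ρ Θ t x a else
      branchTerm P γ ρ Θ t x a * expectedXi P γ ρ Θ (t - a.1.1) (branchPos Θ x a) ^ a.1.2.2)
      (cellLaw P ρ) := by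
    refine ⟨?_, ?_⟩
    · refine Measurable.aestronglyMeasurable ?_
      simp only [← hite]
      exact hgm.mul (hpow.comp ((hum.comp ((by fun_prop : Measurable fun a : Cell m =>
        t - a.1.1).prodMk ((measurable_branchPos hΘ).comp
          (measurable_const.prodMk measurable_id)))).prodMk (measurable_if_children t)))
    · refine lt_of_le_of_lt (le_of_eq (lintegral_congr fun a => ?_))
        ((hstep.trans (hw t ht)).trans_lt ENNReal.ofReal_lt_top)
      beta_reduce
      split_ifs
      · rfl
      · rw [enorm_mul, enorm_pow]
  rw [← integral_step hker hρ hρm hΘ hΘμ hγ ht0 (htI.trans h𝕀S) hum hs₁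
    (fun s hs y => (hub s hs y).trans (hws s (htI hs))) x hGint]
  refine ((integral_congr_ae (Filter.Eventually.of_forall hform)).trans hroot).trans ?_
  exact integral_congr_ae (Filter.Eventually.of_forall hite)

end Bound

end Expectation

/-! ### The mild equation as a fixed point problem -/

section Contraction

variable {P : Problem m d} {T₀ : EReal} {μ : Fin (m + 1) → Kernel ℝ (Space d)}
  {γ : Fin (m + 1) → ℝ → Space d → ℝ}

namespace IsSignedKernel

variable {S : Set ℝ} {μ : Kernel ℝ (Space d)} {γ : ℝ → Space d → ℝ} (h : IsSignedKernel S μ γ)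
include h

theorem greenConv_sub {s : ℝ} (hs : s ∈ S) {f f' : Space d → ℝ} (hf : Measurable f)
    (hf' : Measurable f') {C : ℝ} (hC : ∀ x, |f x| ≤ C) (hC' : ∀ x, |f' x| ≤ C) (x : Space d) :
    greenConv μ γ s f x - greenConv μ γ s f' x = greenConv μ γ s (fun y => f y - f' y) x := by
  have := h.markov
  have hsub : Measurable fun y : Space d => x - y := measurable_const.sub measurable_id
  have h1 : ∀ {f : Space d → ℝ}, Measurable f → (∀ x, |f x| ≤ C) →
      Integrable (fun y => f (x - y) * γ s y) (μ s) := fun hf hC =>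
    (h.integrable hs).bdd_mul (hf.comp hsub).aestronglyMeasurable
      (Filter.Eventually.of_forall fun y => hC _)
  rw [greenConv, greenConv, greenConv, ← integral_sub (h1 hf hC) (h1 hf' hC')]
  simp only [sub_mul]

theorem intervalIntegrable_sourceConv {F : ℝ → Space d → ℝ} (hF : Measurable (Function.uncurry F))
    {t C : ℝ} (ht : 0 ≤ t) (hS : Icc 0 t ⊆ S) (hmass : IntegrableOn (mass μ γ) (Icc 0 t))
    (hC : ∀ s ∈ Icc 0 t, ∀ x, |F s x| ≤ C) (x : Space d) :
    IntervalIntegrable (fun s => greenConv μ γ s (F (t - s)) x) volume 0 t := by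
  rw [intervalIntegrable_iff_integrableOn_Ioc_of_le ht]
  refine ((hmass.mono_set Ioc_subset_Icc_self).const_mul C).mono' ?_ ?_
  · exact ((h.measurable_sourceConv_integrand hF t).comp
      (measurable_id.prodMk measurable_const)).aestronglyMeasurable
  · refine (ae_restrict_iff' measurableSet_Ioc).2 (Filter.Eventually.of_forall fun s hs => ?_)
    exact h.abs_greenConv_le (hS (Ioc_subset_Icc_self hs))
      (hC _ ⟨by linarith [hs.2], by linarith [hs.1]⟩) x

end IsSignedKernel

/-- If two sources differ by at most `g(s)` at time `s`, the mild solutions differ by at most the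
convolution of `g` with the mass of `g_N`. -/
theorem abs_mild_sub_le (hGreen : GreenDensities P T₀ μ γ) {F F' : ℝ → Space d → ℝ}
    (hF : Measurable (Function.uncurry F)) (hF' : Measurable (Function.uncurry F')) {t C : ℝ}
    (ht : 0 ≤ t) (htT : (t : EReal) < T₀) (hC : ∀ s ∈ Icc 0 t, ∀ y, |F s y| ≤ C)
    (hC' : ∀ s ∈ Icc 0 t, ∀ y, |F' s y| ≤ C) {g : ℝ → ℝ}
    (hg : ∀ s ∈ Icc 0 t, ∀ y, |F s y - F' s y| ≤ g s)
    (hgi : IntervalIntegrable (fun s => g (t - s) * mass (μ (Fin.last m)) (γ (Fin.last m)) s)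
      volume 0 t) (x : Space d) :
    |mild P μ γ F t x - mild P μ γ F' t x| ≤
      ∫ s in (0 : ℝ)..t, g (t - s) * mass (μ (Fin.last m)) (γ (Fin.last m)) s := by
  have hker := hGreen.isSignedKernel (Fin.last m)
  have hS := Icc_subset_times htT
  have hmass := hGreen.integrable_mass t ht htT
  rw [mild, mild, add_sub_add_left_eq_sub, sourceConv, sourceConv,
    ← intervalIntegral.integral_sub (hker.intervalIntegrable_sourceConv hF ht hS hmass hC x)
      (hker.intervalIntegrable_sourceConv hF' ht hS hmass hC' x)]
  rw [← Real.norm_eq_abs]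
  refine intervalIntegral.norm_integral_le_of_norm_le ht
    (Filter.Eventually.of_forall fun s hs => ?_) hgi
  have hts : t - s ∈ Icc 0 t := ⟨by linarith [hs.2], by linarith [hs.1]⟩
  have hsS := hS (Ioc_subset_Icc_self hs)
  rw [hker.greenConv_sub hsS hF.of_uncurry_left hF'.of_uncurry_left (hC _ hts) (hC' _ hts)]
  exact hker.abs_greenConv_le hsS (hg _ hts) x

/-- For a large exponential weight, the mass of the kernel becomes small. -/
theorem exists_weight {κ : ℝ → ℝ} {b : ℝ} (hb : 0 ≤ b) (hκ : IntegrableOn κ (Icc 0 b)) {ε : ℝ}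
    (hε : 0 < ε) : ∃ l : ℝ, ∫ s in (0 : ℝ)..b, Real.exp (-(l * s)) * κ s < ε := by
  have hlim : Filter.Tendsto (fun n : ℕ => ∫ s in Ioc 0 b, Real.exp (-(n * s)) * κ s)
      Filter.atTop (𝓝 (∫ s in Ioc 0 b, (0 : ℝ))) := by
    refine tendsto_integral_of_dominated_convergence (fun s => |κ s|) (fun n => ?_)
      (hκ.mono_set Ioc_subset_Icc_self).abs (fun n => ?_) ?_
    · exact (by fun_prop : Continuous fun s : ℝ => Real.exp (-(n * s))).aestronglyMeasurable.mul
        (hκ.mono_set Ioc_subset_Icc_self).aestronglyMeasurable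
    · refine (ae_restrict_iff' measurableSet_Ioc).2 (Filter.Eventually.of_forall fun s hs => ?_)
      rw [norm_mul, Real.norm_of_nonneg (Real.exp_pos _).le]
      refine mul_le_of_le_one_left (norm_nonneg _) (Real.exp_le_one_iff.2 ?_)
      have := mul_nonneg (Nat.cast_nonneg (α := ℝ) n) hs.1.le
      linarith
    · refine (ae_restrict_iff' measurableSet_Ioc).2 (Filter.Eventually.of_forall fun s hs => ?_)
      have h1 : Filter.Tendsto (fun n : ℕ => Real.exp (-(n * s))) Filter.atTop (𝓝 0) :=
        Real.tendsto_exp_neg_atTop_nhds_zero.comp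
          (tendsto_natCast_atTop_atTop.atTop_mul_const hs.1)
      simpa using h1.mul_const (κ s)
  rw [integral_zero] at hlim
  obtain ⟨n, hn⟩ := (hlim.eventually_lt_const hε).exists
  exact ⟨n, by rwa [intervalIntegral.integral_of_le hb]⟩

/-- The nonlinearity of a function truncated to the values in `[-s₁, s₁]`. -/
def clampSource (P : Problem m d) (s₁ : ℝ) (v : ℝ → Space d → ℝ) (s : ℝ) (y : Space d) : ℝ :=
  nonlin P (s.toNNReal, y) (max (-s₁) (min s₁ (v s y)))

section Clamp

variable {s₁ : ℝ}

theorem abs_clamp_le (hs0 : 0 ≤ s₁) (s : ℝ) : |max (-s₁) (min s₁ s)| ≤ s₁ :=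
  abs_le.2 ⟨le_max_left _ _, max_le (by linarith) (min_le_left _ _)⟩

theorem clamp_eq {s : ℝ} (hs : |s| ≤ s₁) : max (-s₁) (min s₁ s) = s := by
  obtain ⟨h1, h2⟩ := abs_le.1 hs
  rw [min_eq_right h2, max_eq_right h1]

theorem abs_clamp_sub_le (s₁ s s' : ℝ) :
    |max (-s₁) (min s₁ s) - max (-s₁) (min s₁ s')| ≤ |s - s'| := by
  refine (abs_max_sub_max_le_max _ _ _ _).trans ?_
  refine max_le (by simp) ((abs_min_sub_min_le_max _ _ _ _).trans (max_le (by simp) le_rfl))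

theorem clampSource_eq {v : ℝ → Space d → ℝ} {s : ℝ} {y : Space d} (h : |v s y| ≤ s₁) :
    clampSource P s₁ v s y = nonlin P (s.toNNReal, y) (v s y) := by
  rw [clampSource, clamp_eq h]

theorem abs_clampSource_le (hs0 : 0 ≤ s₁) (hs₁ : ENNReal.ofReal s₁ < R₁ P)
    (v : ℝ → Space d → ℝ) (s : ℝ) (y : Space d) : |clampSource P s₁ v s y| ≤ H₁ P s₁ :=
  abs_nonlin_le _ (abs_clamp_le hs0 _) hs₁

theorem continuous_nonlin_clamp (hs0 : 0 ≤ s₁) (hs₁ : ENNReal.ofReal s₁ < R₁ P) :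
    Continuous fun z : (ℝ × Space d) × ℝ =>
      nonlin P (z.1.1.toNNReal, z.1.2) (max (-s₁) (min s₁ z.2)) :=
  (continuousOn_nonlin hs₁).comp_continuous
    (f := fun z : (ℝ × Space d) × ℝ => ((z.1.1.toNNReal, z.1.2), max (-s₁) (min s₁ z.2)))
    (by fun_prop) fun z => abs_clamp_le hs0 _

theorem measurable_clampSource (hs0 : 0 ≤ s₁) (hs₁ : ENNReal.ofReal s₁ < R₁ P)
    {v : ℝ → Space d → ℝ} (hv : Measurable (Function.uncurry v)) :
    Measurable (Function.uncurry (clampSource P s₁ v)) :=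
  (continuous_nonlin_clamp hs0 hs₁).measurable.comp (measurable_id.prodMk hv)

theorem continuousOn_clampSource (hs0 : 0 ≤ s₁) (hs₁ : ENNReal.ofReal s₁ < R₁ P)
    {v : ℝ → Space d → ℝ} {D : Set (ℝ × Space d)} (hv : ContinuousOn (Function.uncurry v) D) :
    ContinuousOn (Function.uncurry (clampSource P s₁ v)) D :=
  (continuous_nonlin_clamp hs0 hs₁).comp_continuousOn (continuousOn_id.prodMk hv)

end Clamp

/-- The map `v ↦ mild (clampSource v)` is a contraction in a suitable exponentially weighted
supremum norm on `[0,b]`. -/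
theorem exists_contraction (hGreen : GreenDensities P T₀ μ γ) {b : ℝ} (hb : 0 ≤ b)
    (hbT : (b : EReal) < T₀) {s₁ : ℝ} (hs0 : 0 ≤ s₁) (hs₁ : ENNReal.ofReal s₁ < R₁ P) :
    ∃ l : ℝ, ∀ u v : ℝ → Space d → ℝ, Measurable (Function.uncurry u) →
      Measurable (Function.uncurry v) → ∀ K, 0 ≤ K → ∀ t ∈ Icc 0 b,
      (∀ s ∈ Icc 0 t, ∀ y, |u s y - v s y| ≤ K * Real.exp (l * s)) → ∀ x,
      |mild P μ γ (clampSource P s₁ u) t x - mild P μ γ (clampSource P s₁ v) t x| ≤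
        K / 2 * Real.exp (l * t) := by
  obtain ⟨L, hL0, hL⟩ := exists_lipschitz_nonlin P hs0 hs₁
  set κ := mass (μ (Fin.last m)) (γ (Fin.last m)) with hκdef
  have hκ : IntegrableOn κ (Icc 0 b) := hGreen.integrable_mass b hb hbT
  have hκ0 : ∀ s, 0 ≤ κ s := fun s => IsSignedKernel.mass_nonneg _ _ s
  -- with this weight, the Lipschitz constant of the map is at most `L / (2 (L + 1)) ≤ 1 / 2`
  obtain ⟨l, hl⟩ := exists_weight hb hκ (ε := 1 / (2 * (L + 1))) (by positivity)
  refine ⟨l, fun u v hu hv K hK t ht huv x => ?_⟩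
  have htT : (t : EReal) < T₀ := (EReal.coe_le_coe_iff.2 ht.2).trans_lt hbT
  have hexp : Continuous fun s : ℝ => Real.exp (-(l * s)) := by fun_prop
  have hi : ∀ t ∈ Icc 0 b, IntervalIntegrable (fun s => Real.exp (-(l * s)) * κ s) volume 0 t :=
    fun t ht => ((intervalIntegrable_iff_integrableOn_Icc_of_le ht.1).2
      (hκ.mono_set (Icc_subset_Icc_right ht.2))).continuousOn_mul hexp.continuousOn
  have hform : ∀ s, L * (K * Real.exp (l * (t - s))) * κ s =
      L * K * Real.exp (l * t) * (Real.exp (-(l * s)) * κ s) := fun s => by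
    rw [mul_sub, sub_eq_add_neg, Real.exp_add]
    ring
  have h1 := abs_mild_sub_le hGreen (measurable_clampSource hs0 hs₁ hu)
    (measurable_clampSource hs0 hs₁ hv) ht.1 htT
    (fun s _ y => abs_clampSource_le hs0 hs₁ u s y) (fun s _ y => abs_clampSource_le hs0 hs₁ v s y)
    (g := fun s => L * (K * Real.exp (l * s))) (fun s hs y => by
      refine (hL _ _ _ (abs_clamp_le hs0 _) (abs_clamp_le hs0 _)).trans ?_
      exact mul_le_mul_of_nonneg_left ((abs_clamp_sub_le _ _ _).trans (huv s hs y)) hL0)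
    (by
      simp only [← hκdef, hform]
      exact (hi t ht).const_mul _) x
  refine h1.trans ?_
  simp only [← hκdef, hform]
  rw [intervalIntegral.integral_const_mul]
  have h2 : ∫ s in (0 : ℝ)..t, Real.exp (-(l * s)) * κ s ≤
      ∫ s in (0 : ℝ)..b, Real.exp (-(l * s)) * κ s :=
    intervalIntegral.integral_mono_interval le_rfl ht.1 ht.2
      (Filter.Eventually.of_forall fun s => mul_nonneg (Real.exp_pos _).le (hκ0 s)) (hi b ⟨hb, le_rfl⟩)
  have h3 : L * ∫ s in (0 : ℝ)..t, Real.exp (-(l * s)) * κ s ≤ 1 / 2 := by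
    calc _ ≤ L * (1 / (2 * (L + 1))) := mul_le_mul_of_nonneg_left (h2.trans hl.le) hL0
      _ ≤ 1 / 2 := by
        rw [mul_one_div, div_le_div_iff₀ (by positivity) (by positivity)]
        linarith
  calc _ = K * Real.exp (l * t) * (L * ∫ s in (0 : ℝ)..t, Real.exp (-(l * s)) * κ s) := by ring
    _ ≤ K * Real.exp (l * t) * (1 / 2) := mul_le_mul_of_nonneg_left h3 (by positivity)
    _ = _ := by ring

variable {𝕀 : Set ℝ}

/-- A bounded measurable solution of the mild equation is continuous, as a uniform limit of Picard
iterates. -/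
theorem continuousOn_of_eq_mild (hGreen : GreenDensities P T₀ μ γ) (h𝕀 : IsTimeInterval 𝕀)
    (hT₀ : ∀ t ∈ 𝕀, (t : EReal) < T₀) {s₁ : ℝ} (hs0 : 0 ≤ s₁) (hs₁ : ENNReal.ofReal s₁ < R₁ P)
    {u : ℝ → Space d → ℝ} (hum : Measurable (Function.uncurry u))
    (hus : ∀ t ∈ 𝕀, ∀ x, |u t x| ≤ s₁)
    (hu : ∀ t ∈ 𝕀, ∀ x, u t x = mild P μ γ (clampSource P s₁ u) t x) :
    ContinuousOn (Function.uncurry u) (𝕀 ×ˢ univ) := by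
  have key : ∀ b ∈ 𝕀, ContinuousOn (Function.uncurry u) (Icc 0 b ×ˢ univ) := by
    intro b hb
    obtain ⟨l, hl⟩ := exists_contraction hGreen (h𝕀.nonneg b hb) (hT₀ b hb) hs0 hs₁
    set B := Real.exp (|l| * b) with hB
    have hbI := h𝕀.Icc_subset hb
    have hle : ∀ t ∈ Icc 0 b, |l * t| ≤ |l| * b := fun t ht => by
      rw [abs_mul, abs_of_nonneg ht.1]
      exact mul_le_mul_of_nonneg_left ht.2 (abs_nonneg _)
    -- the Picard iterates, clamped to `[-s₁, s₁]`
    have happ : ∀ n : ℕ, ∃ v : ℝ → Space d → ℝ, ContinuousOn (Function.uncurry v) (𝕀 ×ˢ univ) ∧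
        (∀ t ∈ 𝕀, ∀ x, |v t x| ≤ s₁) ∧ ∀ t ∈ Icc 0 b, ∀ x,
          |u t x - v t x| ≤ s₁ * B * (1 / 2) ^ n * Real.exp (l * t) := by
      intro n
      induction n with
      | zero =>
        refine ⟨fun _ _ => 0, continuousOn_const, fun _ _ _ => by simpa using hs0,
          fun t ht x => ?_⟩
        have h1 : 1 ≤ B * Real.exp (l * t) := by
          rw [hB, ← Real.exp_add]
          refine Real.one_le_exp ?_
          linarith [neg_abs_le (l * t), hle t ht]
        have h2 := hus t (hbI ht) x
        simp only [sub_zero, pow_zero, mul_one]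
        nlinarith
      | succ n ih =>
        obtain ⟨v, hvc, hvs, hv⟩ := ih
        have hFc := continuousOn_clampSource hs0 hs₁ hvc
        have hmc := continuousOn_mild hGreen h𝕀 hT₀ hFc fun c _ =>
          ⟨H₁ P s₁, fun t _ x => abs_clampSource_le hs0 hs₁ v t x⟩
        obtain ⟨v', hv'c, -, hv'⟩ := IsBoundedContinuousOn.exists_extension h𝕀 hvc hb
          fun t ht x => hvs t (hbI ht) x
        refine ⟨fun t x => max (-s₁) (min s₁ (mild P μ γ (clampSource P s₁ v) t x)),
          (continuous_const.max (continuous_const.min continuous_id)).comp_continuousOn hmc, fun t _ x => abs_clamp_le hs0 _,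
          fun t ht x => ?_⟩
        have heq : mild P μ γ (clampSource P s₁ v') t = mild P μ γ (clampSource P s₁ v) t :=
          mild_congr ht.1 fun s hs => by
            funext y
            rw [clampSource, clampSource, hv' s ⟨hs.1, hs.2.trans ht.2⟩]
        have h1 := hl u v' hum hv'c.measurable (s₁ * B * (1 / 2) ^ n) (by positivity) t ht
          (fun s hs y => by
            have hsb : s ∈ Icc 0 b := ⟨hs.1, hs.2.trans ht.2⟩
            rw [hv' s hsb]
            exact hv s hsb y) x
        rw [heq, ← hu t (hbI ht) x] at h1
        have h2 := abs_clamp_sub_le s₁ (u t x) (mild P μ γ (clampSource P s₁ v) t x)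
        rw [clamp_eq (hus t (hbI ht) x)] at h2
        refine (h2.trans h1).trans (le_of_eq ?_)
        rw [pow_succ]
        ring
    refine continuousOn_of_uniform_approx_of_continuousOn fun U hU => ?_
    obtain ⟨ε, hε, hεU⟩ := Metric.mem_uniformity_dist.1 hU
    have hlim : Filter.Tendsto (fun n : ℕ => s₁ * B * (1 / 2) ^ n * B) Filter.atTop
        (𝓝 (s₁ * B * 0 * B)) :=
      ((tendsto_pow_atTop_nhds_zero_of_lt_one (by norm_num) (by norm_num)).const_mul _).mul_const _
    simp only [mul_zero, zero_mul] at hlim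
    obtain ⟨n, hn⟩ := (hlim.eventually_lt_const hε).exists
    obtain ⟨v, hvc, -, hv⟩ := happ n
    refine ⟨Function.uncurry v, hvc.mono (prod_mono_left hbI), fun z hz => hεU ?_⟩
    rw [Real.dist_eq]
    refine (hv z.1 hz.1 z.2).trans_lt (lt_of_le_of_lt ?_ hn)
    refine mul_le_mul_of_nonneg_left (Real.exp_le_exp.2 ?_) (by positivity)
    exact (le_abs_self _).trans (hle _ hz.1)
  rintro ⟨t, x⟩ ⟨ht, -⟩
  obtain ⟨b, hb, htb, hnhds⟩ := h𝕀.exists_nhds ht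
  refine (key b hb (t, x) ⟨⟨h𝕀.nonneg t ht, htb⟩, trivial⟩).mono_of_mem_nhdsWithin ?_
  rw [nhdsWithin_prod_eq]
  exact Filter.prod_mem_prod hnhds (by simp)

end Contraction

/-! ### Existence and uniqueness for the semilinear problem -/

section Semilinear

variable {P : Problem m d} {T₀ : EReal} {μ : Fin (m + 1) → Kernel ℝ (Space d)}
  {γ : Fin (m + 1) → ℝ → Space d → ℝ} {𝕀 : Set ℝ}

theorem IsBoundedContinuousOn.congr {u u' : ℝ → Space d → ℝ} (h : IsBoundedContinuousOn 𝕀 u)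
    (huu' : ∀ t ∈ 𝕀, u' t = u t) : IsBoundedContinuousOn 𝕀 u' := by
  obtain ⟨hc, C, hC⟩ := h
  exact ⟨hc.congr fun z hz => congrFun (huu' z.1 hz.1) z.2, C, fun t ht x => huu' t ht ▸ hC t ht x⟩

theorem IsLinearSolution.congr {F F' u u' : ℝ → Space d → ℝ} (h : IsLinearSolution P 𝕀 F u)
    (h0 : (0 : ℝ) ∈ 𝕀) (hFF' : ∀ t ∈ 𝕀, F' t = F t) (huu' : ∀ t ∈ 𝕀, u' t = u t) :
    IsLinearSolution P 𝕀 F' u' := by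
  have hp : ∀ φ : 𝓢(Space d, ℝ), EqOn (fun t => pairing (u' t) φ) (fun t => pairing (u t) φ) 𝕀 :=
    fun φ t ht => by simp only [huu' t ht]
  refine ⟨h.boundedContinuous.congr huu', fun φ => (h.smooth φ).congr (hp φ),
    fun φ t ht => ?_, fun φ n => ?_⟩
  · rw [← h.equation φ t ht]
    simp only [huu' t ht, hFF' t ht, iteratedDerivWithin_congr (hp φ) ht]
  · rw [← h.initial φ n, iteratedDerivWithin_congr (hp φ) h0]

theorem IsSolution.congr {u u' : ℝ → Space d → ℝ} (h : IsSolution P 𝕀 u) (h0 : (0 : ℝ) ∈ 𝕀)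
    (huu' : ∀ t ∈ 𝕀, u' t = u t) : IsSolution P 𝕀 u' := by
  have hF : ∀ t ∈ 𝕀, (fun x => ∑' j, P.q j * P.c j (t.toNNReal, x) * u' t x ^ j) =
      fun x => ∑' j, P.q j * P.c j (t.toNNReal, x) * u t x ^ j := fun t ht => by
    simp only [huu' t ht]
  exact ⟨fun t ht x => huu' t ht ▸ h.summable t ht x, h.source.congr hF, h.linear.congr h0 hF huu'⟩

/-- A bounded measurable solution of the mild equation is a bounded continuous solution of the
Cauchy problem. -/
theorem isSolution_of_eq_mild (hTempered : TemperedGreen P T₀) (hGreen : GreenDensities P T₀ μ γ)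
    (h𝕀 : IsTimeInterval 𝕀) (hT₀ : ∀ t ∈ 𝕀, (t : EReal) < T₀)
    (hmass : ∀ t ∈ 𝕀, InitialMassIntegrable P μ γ t) {s₁ : ℝ} (hs0 : 0 ≤ s₁)
    (hs₁ : ENNReal.ofReal s₁ < R₁ P) {u : ℝ → Space d → ℝ} (hum : Measurable (Function.uncurry u))
    (hus : ∀ t ∈ 𝕀, ∀ x, |u t x| ≤ s₁)
    (hu : ∀ t ∈ 𝕀, ∀ x, u t x = mild P μ γ (fun s y => nonlin P (s.toNNReal, y) (u s y)) t x) :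
    IsSolution P 𝕀 u := by
  set F : ℝ → Space d → ℝ := fun s y => nonlin P (s.toNNReal, y) (u s y) with hF
  have hFeq : ∀ t ∈ 𝕀, clampSource P s₁ u t = F t := fun t ht => by
    funext y
    exact clampSource_eq (hus t ht y)
  have huc : ContinuousOn (Function.uncurry u) (𝕀 ×ˢ univ) :=
    continuousOn_of_eq_mild hGreen h𝕀 hT₀ hs0 hs₁ hum hus fun t ht x => by
      rw [hu t ht x, mild_congr (h𝕀.nonneg t ht) fun s hs => hFeq s (h𝕀.Icc_subset ht hs)]
  have hFb : IsBoundedContinuousOn 𝕀 F := by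
    refine ⟨(continuousOn_clampSource hs0 hs₁ huc).congr fun z hz => ?_, H₁ P s₁, fun t ht x => ?_⟩
    · exact (congrFun (hFeq z.1 hz.1) z.2).symm
    · exact abs_nonlin_le _ (hus t ht x) hs₁
  refine ⟨fun t ht x => summable_nonlin _ (hus t ht x) hs₁, hFb, ?_⟩
  refine (isLinearSolution_mild hTempered hGreen h𝕀 hT₀ hmass hFb (R := s₁)
    fun t ht x => ?_).congr h𝕀.zero_mem (fun _ _ => rfl) fun t ht => ?_
  · rw [← hu t ht x]
    exact hus t ht x
  · funext x
    exact hu t ht x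

/-- Uniqueness for the mild equation among functions with values in `[-s₁, s₁]`. -/
theorem eq_of_eq_mild (hGreen : GreenDensities P T₀ μ γ) {b : ℝ} (hb : 0 ≤ b)
    (hbT : (b : EReal) < T₀) {s₁ : ℝ} (hs0 : 0 ≤ s₁) (hs₁ : ENNReal.ofReal s₁ < R₁ P)
    {u v : ℝ → Space d → ℝ} (hum : Measurable (Function.uncurry u))
    (hvm : Measurable (Function.uncurry v)) (hus : ∀ t ∈ Icc 0 b, ∀ x, |u t x| ≤ s₁)
    (hvs : ∀ t ∈ Icc 0 b, ∀ x, |v t x| ≤ s₁)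
    (hu : ∀ t ∈ Icc 0 b, ∀ x, u t x = mild P μ γ (clampSource P s₁ u) t x)
    (hv : ∀ t ∈ Icc 0 b, ∀ x, v t x = mild P μ γ (clampSource P s₁ v) t x) {t : ℝ}
    (ht : t ∈ Icc 0 b) (x : Space d) : u t x = v t x := by
  obtain ⟨l, hl⟩ := exists_contraction hGreen hb hbT hs0 hs₁
  set B := 2 * s₁ * Real.exp (|l| * b) with hB
  have hB0 : 0 ≤ B := by positivity
  have key : ∀ n : ℕ, ∀ t ∈ Icc 0 b, ∀ x, |u t x - v t x| ≤ B * (1 / 2) ^ n * Real.exp (l * t) := by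
    intro n
    induction n with
    | zero =>
      intro t ht x
      have h1 : 1 ≤ Real.exp (|l| * b) * Real.exp (l * t) := by
        rw [← Real.exp_add]
        refine Real.one_le_exp ?_
        have : |l * t| ≤ |l| * b := by
          rw [abs_mul, abs_of_nonneg ht.1]
          exact mul_le_mul_of_nonneg_left ht.2 (abs_nonneg _)
        linarith [neg_abs_le (l * t)]
      calc |u t x - v t x| ≤ |u t x| + |v t x| := abs_sub _ _
        _ ≤ 2 * s₁ * 1 := by linarith [hus t ht x, hvs t ht x]
        _ ≤ 2 * s₁ * (Real.exp (|l| * b) * Real.exp (l * t)) := by gcongr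
        _ = _ := by rw [hB]; ring
    | succ n ih =>
      intro t ht x
      have h1 := hl u v hum hvm (B * (1 / 2) ^ n) (by positivity) t ht
        (fun s hs y => ih s ⟨hs.1, hs.2.trans ht.2⟩ y) x
      rw [← hu t ht x, ← hv t ht x] at h1
      refine h1.trans (le_of_eq ?_)
      rw [pow_succ]
      ring
  have hlim : Filter.Tendsto (fun n : ℕ => B * (1 / 2) ^ n * Real.exp (l * t)) Filter.atTop
      (𝓝 (B * 0 * Real.exp (l * t))) :=
    ((tendsto_pow_atTop_nhds_zero_of_lt_one (by norm_num) (by norm_num)).const_mul _).mul_const _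
  simp only [mul_zero, zero_mul] at hlim
  have h0 : |u t x - v t x| ≤ 0 := ge_of_tendsto' hlim fun n => key n t ht x
  linarith [abs_nonpos_iff.1 h0]

theorem exists_small_mass {κ : ℝ → ℝ} {b : ℝ} (hb : 0 ≤ b) (hκ : IntegrableOn κ (Icc 0 b)) {ε : ℝ}
    (hε : 0 < ε) : ∃ δ > 0, ∀ t ∈ Icc 0 b, t < δ → ∫ s in Ioc 0 t, κ s < ε := by
  have h := intervalIntegral.continuousOn_primitive_interval (f := κ) (a := 0) (b := b)
    (by rwa [uIcc_of_le hb])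
  rw [uIcc_of_le hb] at h
  have h0 := h 0 ⟨le_rfl, hb⟩
  obtain ⟨δ, hδ, hδε⟩ := Metric.continuousWithinAt_iff.1 h0 ε hε
  refine ⟨δ, hδ, fun t ht htδ => ?_⟩
  have := hδε ht (by rwa [Real.dist_eq, sub_zero, abs_of_nonneg ht.1])
  rw [Real.dist_eq, intervalIntegral.integral_same, sub_zero,
    intervalIntegral.integral_of_le ht.1] at this
  exact (le_abs_self _).trans_lt this

/-- Two solutions of the mild equation with sources bounded by `C`, which agree before time `a`,
differ at a later time `t` by at most `2 C` times the mass of the kernel on `[0, t - a]`. -/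
theorem abs_sub_le_of_eq_before (hGreen : GreenDensities P T₀ μ γ) {F F' : ℝ → Space d → ℝ}
    (hF : Measurable (Function.uncurry F)) (hF' : Measurable (Function.uncurry F')) {C : ℝ}
    (hC : ∀ s y, |F s y| ≤ C) (hC' : ∀ s y, |F' s y| ≤ C) {a t : ℝ} (ha : 0 ≤ a) (hat : a ≤ t)
    (htT : (t : EReal) < T₀) (hFF' : ∀ s ∈ Ico 0 a, ∀ y, F s y = F' s y) (x : Space d) :
    |mild P μ γ F t x - mild P μ γ F' t x| ≤
      2 * C * ∫ s in Ioc 0 (t - a), mass (μ (Fin.last m)) (γ (Fin.last m)) s := by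
  have ht : 0 ≤ t := ha.trans hat
  set κ := mass (μ (Fin.last m)) (γ (Fin.last m)) with hκdef
  have hκ : IntegrableOn κ (Icc 0 t) := hGreen.integrable_mass t ht htT
  have hform : ∀ s, (Ici a).indicator (fun _ => 2 * C) (t - s) * κ s =
      (Iic (t - a)).indicator (fun s => 2 * C * κ s) s := fun s => by
    by_cases hs : s ≤ t - a
    · rw [indicator_of_mem (show t - s ∈ Ici a by rw [mem_Ici]; linarith),
        indicator_of_mem (show s ∈ Iic (t - a) from hs)]
    · rw [indicator_of_notMem (show t - s ∉ Ici a by rw [mem_Ici]; push Not at hs ⊢; linarith),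
        indicator_of_notMem (show s ∉ Iic (t - a) from hs), zero_mul]
  refine (abs_mild_sub_le hGreen hF hF' ht htT (fun s _ y => hC s y) (fun s _ y => hC' s y)
    (g := (Ici a).indicator fun _ => 2 * C) (fun s hs y => ?_) ?_ x).trans (le_of_eq ?_)
  · by_cases hsa : a ≤ s
    · rw [indicator_of_mem (show s ∈ Ici a from hsa)]
      exact (abs_sub _ _).trans (by linarith [hC s y, hC' s y])
    · rw [hFF' s ⟨hs.1, not_le.1 hsa⟩ y, sub_self, abs_zero]
      exact indicator_nonneg (fun _ _ => by linarith [(abs_nonneg _).trans (hC s y)]) _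
  · simp only [← hκdef, hform]
    rw [intervalIntegrable_iff_integrableOn_Ioc_of_le ht]
    exact ((hκ.mono_set Ioc_subset_Icc_self).const_mul _).indicator measurableSet_Iic
  · simp only [← hκdef, hform]
    rw [intervalIntegral.integral_of_le ht, setIntegral_indicator measurableSet_Iic,
      Ioc_inter_Iic, min_eq_right (by linarith), integral_const_mul]

/-- A bounded continuous solution is unique, provided that it takes its values in a compact subset
of the domain of convergence of the nonlinearity. -/
theorem IsSolution.eq_of_abs_le (hTempered : TemperedGreen P T₀) (hGreen : GreenDensities P T₀ μ γ)
    (h𝕀 : IsTimeInterval 𝕀) (hT₀ : ∀ t ∈ 𝕀, (t : EReal) < T₀) {r : ℝ}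
    (hmass : ∀ n, ∀ t ∈ 𝕀, ‖P.f n‖ * mass (μ n) (γ n) t ≤ r) {s₁ : ℝ} (hs0 : 0 ≤ s₁)
    (hs₁ : ENNReal.ofReal s₁ < R₁ P) {u v : ℝ → Space d → ℝ} (hu : IsSolution P 𝕀 u)
    (hus : ∀ t ∈ 𝕀, ∀ x, |u t x| ≤ s₁) (hv : IsSolution P 𝕀 v) {b : ℝ} (hb : b ∈ 𝕀)
    (x : Space d) : v b x = u b x := by
  have hbI := h𝕀.Icc_subset hb
  have hb0 := h𝕀.nonneg b hb
  obtain ⟨s₂, h12, hs₂⟩ := exists_between_ofReal hs0 hs₁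
  have hs20 : 0 ≤ s₂ := hs0.trans h12.le
  set S : (ℝ → Space d → ℝ) → ℝ → Space d → ℝ := fun u s y => nonlin P (s.toNNReal, y) (u s y)
    with hS
  have hum : ∀ t ∈ 𝕀, ∀ x, u t x = mild P μ γ (S u) t x := fun t ht x =>
    hu.linear.eq_mild hTempered hGreen h𝕀 hT₀ hmass hu.source ht x
  have hvm : ∀ t ∈ 𝕀, ∀ x, v t x = mild P μ γ (S v) t x := fun t ht x =>
    hv.linear.eq_mild hTempered hGreen h𝕀 hT₀ hmass hv.source ht x
  have hext : ∀ {w : ℝ → Space d → ℝ}, IsBoundedContinuousOn 𝕀 w → ∃ w' : ℝ → Space d → ℝ,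
      Continuous (Function.uncurry w') ∧ (∃ C, ∀ t x, |w' t x| ≤ C) ∧
        ∀ t ∈ Icc 0 b, w' t = w t := by
    rintro w ⟨hw, C, hC⟩
    obtain ⟨w', h1, h2, h3⟩ := IsBoundedContinuousOn.exists_extension h𝕀 hw hb
      fun t ht x => hC t (hbI ht) x
    exact ⟨w', h1, ⟨C, h2⟩, h3⟩
  obtain ⟨u', hu'c, -, hu'⟩ := hext hu.linear.boundedContinuous
  obtain ⟨v', hv'c, -, hv'⟩ := hext hv.linear.boundedContinuous
  obtain ⟨F, hFc, ⟨C₁, hC₁⟩, hF⟩ := hext hu.source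
  obtain ⟨G, hGc, ⟨C₂, hC₂⟩, hG⟩ := hext hv.source
  set C := max C₁ C₂ with hCdef
  have hC0 : 0 ≤ C := ((abs_nonneg _).trans (hC₁ 0 0)).trans (le_max_left _ _)
  obtain ⟨δ, hδ, hδC⟩ := exists_small_mass hb0
    (hGreen.integrable_mass b hb0 (hT₀ b hb)) (ε := (s₂ - s₁) / (2 * C + 1))
    (div_pos (by linarith) (by linarith))
  have huF : ∀ t ∈ Icc 0 b, ∀ x, u t x = mild P μ γ F t x := fun t ht x => by
    rw [hum t (hbI ht) x, mild_congr ht.1 fun s hs => hF s ⟨hs.1, hs.2.trans ht.2⟩]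
    rfl
  have hvG : ∀ t ∈ Icc 0 b, ∀ x, v t x = mild P μ γ G t x := fun t ht x => by
    rw [hvm t (hbI ht) x, mild_congr ht.1 fun s hs => hG s ⟨hs.1, hs.2.trans ht.2⟩]
    rfl
  -- The solutions agree on successive intervals of length `δ`: there, `v` cannot leave
  -- `[-s₂, s₂]`, whence both are fixed points of the contraction.
  have key : ∀ k : ℕ, ∀ t ∈ Icc 0 b, t < k * δ → ∀ x, v t x = u t x := by
    intro k
    induction k with
    | zero =>
      intro t ht ht'
      rw [Nat.cast_zero, zero_mul] at ht'
      exact absurd ht.1 (not_le.2 ht')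
    | succ k ih =>
      have hvs : ∀ t ∈ Icc 0 b, t < (k + 1 : ℕ) * δ → ∀ x, |v t x| ≤ s₂ := by
        intro t ht ht' x
        have hux := hus t (hbI ht) x
        by_cases htk : t < k * δ
        · rw [ih t ht htk x]
          linarith
        · push Not at htk
          have hka : 0 ≤ k * δ := by positivity
          have h1 := abs_sub_le_of_eq_before hGreen (P := P) hGc.measurable hFc.measurable
            (fun s y => (hC₂ s y).trans (le_max_right C₁ C₂))
            (fun s y => (hC₁ s y).trans (le_max_left C₁ C₂)) hka htk (hT₀ t (hbI ht))
            (fun s hs y => by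
              have hsb : s ∈ Icc 0 b := ⟨hs.1, hs.2.le.trans (htk.trans ht.2)⟩
              rw [hG s hsb, hF s hsb]
              simp only [ih s hsb hs.2 y]) x
          rw [← hvG t ht x, ← huF t ht x] at h1
          push_cast at ht'
          have h2 := hδC (t - k * δ) ⟨by linarith, by linarith [ht.2]⟩ (by linarith)
          have h3 : 2 * C * ∫ s in Ioc 0 (t - k * δ), mass (μ (Fin.last m)) (γ (Fin.last m)) s ≤
              s₂ - s₁ := by
            refine (mul_le_mul_of_nonneg_left h2.le (by positivity)).trans ?_
            rw [mul_div_assoc', div_le_iff₀ (by positivity)]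
            nlinarith
          have h4 := abs_sub_abs_le_abs_sub (v t x) (u t x)
          linarith
      intro t ht ht' x
      have hsub : ∀ s ∈ Icc 0 t, s ∈ Icc 0 b ∧ s < (k + 1 : ℕ) * δ := fun s hs =>
        ⟨⟨hs.1, hs.2.trans ht.2⟩, hs.2.trans_lt ht'⟩
      have hu's : ∀ s ∈ Icc 0 t, ∀ y, |u' s y| ≤ s₂ := fun s hs y => by
        rw [hu' s (hsub s hs).1]
        exact (hus s (hbI (hsub s hs).1) y).trans h12.le
      have hv's : ∀ s ∈ Icc 0 t, ∀ y, |v' s y| ≤ s₂ := fun s hs y => by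
        rw [hv' s (hsub s hs).1]
        exact hvs s (hsub s hs).1 (hsub s hs).2 y
      have hfix : ∀ {w w' : ℝ → Space d → ℝ}, (∀ s ∈ Icc 0 b, w' s = w s) →
          (∀ s ∈ Icc 0 t, ∀ y, |w' s y| ≤ s₂) → (∀ s ∈ 𝕀, ∀ y, w s y = mild P μ γ (S w) s y) →
          ∀ s ∈ Icc 0 t, ∀ y, w' s y = mild P μ γ (clampSource P s₂ w') s y := by
        intro w w' hw' hws hw s hs y
        rw [hw' s (hsub s hs).1, hw s (hbI (hsub s hs).1) y]
        refine congrFun (mild_congr hs.1 fun q hq => ?_) y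
        have hqt : q ∈ Icc 0 t := ⟨hq.1, hq.2.trans hs.2⟩
        funext z
        rw [clampSource_eq (hws q hqt z), hw' q (hsub q hqt).1]
      have := eq_of_eq_mild hGreen ht.1 (hT₀ t (hbI ht)) hs20 hs₂ hv'c.measurable hu'c.measurable
        hv's hu's (hfix hv' hv's hvm) (hfix hu' hu's hum) ⟨ht.1, le_rfl⟩ x
      rwa [hv' t ht, hu' t ht] at this
  obtain ⟨k, hk⟩ := exists_nat_gt (b / δ)
  exact key k b ⟨hb0, le_rfl⟩ ((div_lt_iff₀ hδ).1 hk) x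

end Semilinear

/-! ### The branching process and its canonical version -/

section Transfer

variable {P : Problem m d} {T₀ : EReal} {μ : Fin (m + 1) → Kernel ℝ (Space d)}
  {γ : Fin (m + 1) → ℝ → Space d → ℝ} {𝕀 : Set ℝ} {ρ : ℝ → ℝ}

theorem isTimeInterval_timeSet {T : ℝ} (hT : 0 < T) (hTT₀ : (T : EReal) ≤ T₀) :
    IsTimeInterval (timeSet T T₀) := by
  have hord : OrdConnected (timeSet T T₀) := ⟨fun s hs t ht q hq =>
    ⟨hs.1.trans hq.1, hq.2.trans ht.2.1, (EReal.coe_le_coe_iff.2 hq.2).trans_lt ht.2.2⟩⟩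
  have hmem : ∀ t, 0 ≤ t → t < T → t ∈ timeSet T T₀ := fun t h0 ht =>
    ⟨h0, ht.le, (EReal.coe_lt_coe_iff.2 ht).trans_le hTT₀⟩
  refine ⟨hmem 0 le_rfl hT, hord, fun t ht => ht.1, ?_⟩
  refine uniqueDiffOn_convex hord.convex ⟨T / 2, ?_⟩
  exact interior_mono (fun t (ht : t ∈ Ioo 0 T) => hmem t ht.1.le ht.2)
    (by rw [interior_Ioo]; exact ⟨by linarith, by linarith⟩)

theorem lifeLaw_indicator (ρ : ℝ → ℝ) : lifeLaw ((Ici 0).indicator ρ) = lifeLaw ρ := by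
  refine withDensity_congr_ae ((ae_restrict_iff' measurableSet_Ici).2
    (Filter.Eventually.of_forall fun t ht => ?_))
  simp only [indicator_of_mem ht]

theorem HasPathLaw.indicator {Ω : Type*} [MeasurableSpace Ω] {Pr : Measure Ω}
    {τ : Particle → Ω → ℝ} {I : Particle → Ω → Fin (m + 1)} {J : Particle → Ω → ℕ}
    {Z : ℝ → Particle → Ω → Space d} {t : ℝ} (h : HasPathLaw P μ ρ Pr τ I J Z t) :
    HasPathLaw P μ ((Ici 0).indicator ρ) Pr τ I J Z t :=
  { h with map_marks := by rw [markLaw, lifeLaw_indicator]; exact h.map_marks }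

theorem BranchingMechanism.ae_nonneg {Ω : Type*} [MeasurableSpace Ω] {Pr : Measure Ω}
    {τ : Particle → Ω → ℝ} {I : Particle → Ω → Fin (m + 1)} {J : Particle → Ω → ℕ}
    {Z : ℝ → Particle → Ω → Space d} (h : BranchingMechanism P 𝕀 μ ρ Pr τ I J Z) :
    ∀ᵐ ω ∂Pr, ∀ k, 0 ≤ τ k ω := by
  refine ae_all_iff.2 fun k => ?_
  have h1 : ∀ᵐ s ∂(Pr.map (τ k)), 0 ≤ s := by
    rw [h.law_τ k]
    exact (withDensity_absolutelyContinuous _ _).ae_le (ae_restrict_mem measurableSet_Ici)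
  exact ae_of_ae_map (h.measurable_τ k).aemeasurable h1

/-- The branching functional has the same expectation as on the canonical space, where the life
time density is set to `0` on the negative half-line. -/
theorem BranchingMechanism.integral_xi (hGreen : GreenDensities P T₀ μ γ)
    {Ω : Type*} [MeasurableSpace Ω] {Pr : Measure Ω} [IsProbabilityMeasure Pr]
    {τ : Particle → Ω → ℝ} {I : Particle → Ω → Fin (m + 1)} {J : Particle → Ω → ℕ}
    {Z : ℝ → Particle → Ω → Space d} (h : BranchingMechanism P 𝕀 μ ρ Pr τ I J Z)
    (hρ : IsLifeDensity ρ) {Θ : Fin (m + 1) → ℝ → unitInterval → Space d}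
    (hΘ : ∀ n, Measurable (Function.uncurry (Θ n)))
    (hΘμ : ∀ n s, (volume : Measure unitInterval).map (Θ n s) = μ n s) {t : ℝ} (ht : t ∈ 𝕀)
    (ht0 : 0 ≤ t) (x : Space d) :
    (Integrable (xi P γ ρ τ I J Z t x) Pr ↔ Integrable (canonXi P γ ((Ici 0).indicator ρ) Θ t x)
        (canonLaw P ((Ici 0).indicator ρ))) ∧
      ∫ ω, xi P γ ρ τ I J Z t x ω ∂Pr = expectedXi P γ ((Ici 0).indicator ρ) Θ t x := by
  have := hGreen.markov
  have := hρ.indicator.isProbabilityMeasure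
  have := isProbabilityMeasure_canonLaw P hρ.indicator
  have hae : xi P γ ((Ici 0).indicator ρ) τ I J Z t x =ᵐ[Pr] xi P γ ρ τ I J Z t x := by
    filter_upwards [h.ae_nonneg] with ω hω
    exact xi_indicator P γ ρ x ht0 hω
  have h1 := (h.hasPathLaw ht).indicator.xi_transfer (hasPathLaw_canon hΘ hΘμ t) hGreen.measurable
    hρ.measurable_indicator hρ.measurable_tail x
  rw [← integrable_congr hae, ← integral_congr_ae hae]
  exact h1

end Transfer

end BranchingCauchy

end

theorem theorem3p1 {m d : ℕ} (P : BranchingCauchy.Problem m d)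
    (T₀ : EReal) (T : ℝ) (hT : 0 < T) (hTT₀ : (T : EReal) ≤ T₀)
    (hTempered : BranchingCauchy.TemperedGreen P T₀)
    (μ : Fin (m + 1) → Kernel ℝ (BranchingCauchy.Space d))
    (γ : Fin (m + 1) → ℝ → BranchingCauchy.Space d → ℝ)
    (hGreen : BranchingCauchy.GreenDensities P T₀ μ γ)
    (hODE : BranchingCauchy.NonExplosion P T (BranchingCauchy.timeSet T T₀) γ)
    (ρ : ℝ → ℝ) (hρ : BranchingCauchy.IsLifeDensity ρ)
    {Ω : Type*} [MeasurableSpace Ω] (Pr : Measure Ω) [IsProbabilityMeasure Pr]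
    (τ : BranchingCauchy.Particle → Ω → ℝ) (I : BranchingCauchy.Particle → Ω → Fin (m + 1))
    (J : BranchingCauchy.Particle → Ω → ℕ)
    (Z : ℝ → BranchingCauchy.Particle → Ω → BranchingCauchy.Space d)
    (hBranching : BranchingCauchy.BranchingMechanism P (BranchingCauchy.timeSet T T₀) μ ρ Pr
      τ I J Z) :
    (∀ t ∈ BranchingCauchy.timeSet T T₀, ∀ x : BranchingCauchy.Space d,
      Integrable (BranchingCauchy.xi P γ ρ τ I J Z t x) Pr) ∧
    BranchingCauchy.IsSolution P (BranchingCauchy.timeSet T T₀)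
      (fun t x => ∫ ω, BranchingCauchy.xi P γ ρ τ I J Z t x ω ∂Pr) ∧
    ∀ v : ℝ → BranchingCauchy.Space d → ℝ,
      BranchingCauchy.IsSolution P (BranchingCauchy.timeSet T T₀) v →
      ∀ t ∈ BranchingCauchy.timeSet T T₀, ∀ x : BranchingCauchy.Space d,
        v t x = ∫ ω, BranchingCauchy.xi P γ ρ τ I J Z t x ω ∂Pr := by
  open BranchingCauchy in
  have h𝕀 := isTimeInterval_timeSet hT hTT₀
  have hT₀ : ∀ t ∈ timeSet T T₀, 0 ≤ t ∧ (t : EReal) < T₀ := fun t ht => ⟨ht.1, ht.2.2⟩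
  have hT₀' : ∀ t ∈ timeSet T T₀, (t : EReal) < T₀ := fun t ht => ht.2.2
  have hmarkov := hGreen.markov
  have hker := hGreen.isSignedKernel
  -- the laws of the displacements are images of the uniform distribution
  choose Θ hΘ hΘμ using fun n => (μ n).exists_measurable_map_eq_unitInterval
  have hmass : ∀ n, ∀ t ∈ timeSet T T₀, ‖P.f n‖ * mass (μ n) (γ n) t ≤
      (r₁ P (timeSet T T₀) γ).toReal := fun n t ht =>
    norm_mul_mass_le_r₁ hGreen hT₀ hODE.1.ne_top n ht
  obtain ⟨s₁, w, hs₁, hrs, hw, hmaj⟩ := hODE.exists_majorant hGreen hT hT₀ (fun t ht => ht.2.1)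
    fun t ht => h𝕀.Icc_subset ht
  have hs0 : 0 ≤ s₁ := ENNReal.toReal_nonneg.trans hrs
  have hw0 : ∀ t ∈ timeSet T T₀, 0 ≤ w t := fun t ht => (hw t ⟨ht.1, ht.2.1⟩).1
  have hws : ∀ t ∈ timeSet T T₀, w t ≤ s₁ := fun t ht => (hw t ⟨ht.1, ht.2.1⟩).2
  have hwR : ∀ t ∈ timeSet T T₀, ENNReal.ofReal (w t) < R₁ P := fun t ht =>
    (ENNReal.ofReal_le_ofReal (hws t ht)).trans_lt hs₁
  have hord : ∀ t ∈ timeSet T T₀, 0 ≤ t ∧ Icc 0 t ⊆ timeSet T T₀ := fun t ht =>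
    ⟨ht.1, h𝕀.Icc_subset ht⟩
  have hρ₀ := hρ.indicator
  have hρm := hρ.measurable_indicator
  have hρ' := hρ.measurable_tail
  have hxi := fun (t : ℝ) (ht : t ∈ timeSet T T₀) (x : Space d) =>
    hBranching.integral_xi hGreen hρ hΘ hΘμ ht ht.1 x
  set u := expectedXi P γ ((Ici 0).indicator ρ) Θ with hu
  have hus : ∀ t ∈ timeSet T T₀, ∀ x, |u t x| ≤ s₁ := fun t ht x =>
    (abs_expectedXi_le hker hρ₀ hρm hρ' hΘ hΘμ hGreen.measurable hT₀ hord hmass hw0 hwR hmaj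
      ht x).trans (hws t ht)
  have hsol : IsSolution P (timeSet T T₀) u :=
    isSolution_of_eq_mild hTempered hGreen h𝕀 hT₀'
      (fun t ht => initialMassIntegrable_of_le hGreen h𝕀 hmass ht) hs0 hs₁
      (measurable_expectedXi hρ₀ hρm hρ' hΘ hGreen.measurable) hus fun t ht x =>
        expectedXi_eq_mild hker hρ₀ hρm hρ' hΘ hΘμ hGreen.measurable hT₀ hord hmass hw0 hwR hmaj
          hs₁ hws ht x
  refine ⟨fun t ht x => ?_, hsol.congr h𝕀.zero_mem fun t ht => ?_, fun v hv t ht x => ?_⟩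
  · exact (hxi t ht x).1.2 (integrable_canonXi hker hρ₀ hρm hρ' hΘ hΘμ hGreen.measurable hT₀ hord
      hmass hw0 hwR hmaj ht x)
  · funext x
    exact (hxi t ht x).2
  · rw [(hxi t ht x).2]
    exact hsol.eq_of_abs_le hTempered hGreen h𝕀 hT₀' hmass hs0 hs₁ hus hv ht x
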